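/- Let $p$ be an odd prime and let $m,n,q,l\ge 1$ be integers with $q\le m$, $(p^l+1)^{p^n}\equiv 1 \pmod{p^m}$ and $(p^l+1)p^q\equiv p^q \pmod{p^m}$. Let $G=P(m,n,q,l)$ be the metacyclic $p$-group $$G=\langle x,y \mid x^{p^m}=1,\ y^{p^n}=x^{p^q},\ (x,y)=x^{p^l}\rangle,\qquad (x,y)=x^{-1}y^{-1}xy .$$ Let $G=\Gamma_1\supseteq\Gamma_2\supseteq\cdots$ be the mod-$p$ lower central series of $G$, i.e. the fastest descending series of subgroups with $\Gamma_1=G$, $(\Gamma_i,\Gamma_j)\subseteq\Gamma_{i+j}$ and $\Gamma_i^p\subseteq\Gamma_{pi}$. Let $\mathcal L G=\bigoplus_{i}\Gamma_i/\Gamma_{i+1}$ be the associated restricted Lie algebra over $\mathbb F_p$, whose bracket and restriction are induced by commutators and $p$-th powers, with $\Gamma_i/\Gamma_{i+1}$ placed in degree $2i$. Let $\mathcal{VL}G$ be its universal restricted enveloping algebra, the quotient of the tensor algebra of $\mathcal LG$ by the relations $\alpha\beta-\beta\alpha=[\alpha,\beta]$ and $\alpha^p=\xi(\alpha)$. Put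 $$(a,b)=\begin{cases}(p^m,\,p^n) & \text{if } q\ge n,\\ (p^q,\,p^{m+n-q}) & \text{if } q<n.\end{cases}$$ (i) There is an isomorphism of graded $\mathbb F_p$-algebras $\mathcal{VL}G\cong\mathbb F_p[X,Y]/(X^a,Y^b)$ with $X,Y$ of degree $2$. (ii) Let $H^{*}=H^{*,*}(\mathcal{VL}G)=\mathrm{Ext}^{*,*}_{\mathcal{VL}G}(\mathbb F_p,\mathbb F_p)$ be the cohomology algebra, i.e. the cohomology of the cobar complex of $\mathcal{VL}G$, bigraded by homological and internal degree. There are classes $x,y\in H^{1,2}$, $u\in H^{2,2a}$ and $v\in H^{2,2b}$ such that $$H^{*}\cong\Lambda[x,y]\otimes\mathbb F_p[u,v]$$ as $\mathbb F_p$-algebras, and such that the symmetric Massey products $\langle x\rangle^a$ and $\langle y\rangle^b$ are defined with zero indeterminacy and equal $u$ and $v$ respectively. Here, for $\alpha\in H^{1,t}$ with $t$ even, $\langle\alpha\rangle^r$ is the set of classes of the cocycles $\sum_{j=1}^{r-1}a_ja_{r-j}$, where $a_1,\dots,a_{r-1}$ runs over the sequences of cochains $a_i$ of bidegree $(1,it)$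 in the cobar complex such that $a_1$ represents $\alpha$ and $\delta a_i=\sum_{j=1}^{i-1}a_ja_{i-j}$ for $2\le i\le r-1$. -/

import Mathlib

open scoped TensorProduct DirectSum

noncomputable section

namespace MetacyclicCohomology

/-! ### The mod-`p` lower central series and its restricted Lie algebra -/

/-- A `p`-restricted `N`-sequence `G = F 1 ⊇ F 2 ⊇ ⋯`: `(F i, F j) ⊆ F (i + j)` and
`(F i) ^ p ⊆ F (p * i)`, where `(g, h) = g⁻¹ h⁻¹ g h`.  The convention `F 0 = G` is added, so the
case `i = 0` of the commutator condition says that every `F j` is normal. -/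
structure IsRestrictedNSeq (p : ℕ) {G : Type*} [Group G] (F : ℕ → Subgroup G) : Prop where
  zero : F 0 = ⊤
  one : F 1 = ⊤
  antitone : Antitone F
  comm : ∀ i j : ℕ, ∀ g ∈ F i, ∀ h ∈ F j, g⁻¹ * h⁻¹ * g * h ∈ F (i + j)
  pow : ∀ i : ℕ, ∀ g ∈ F i, g ^ p ∈ F (p * i)

/-- The mod-`p` lower central series of `G`: the fastest descending `p`-restricted `N`-sequence.
The term of index `n` has filtration degree `2 * n`. -/
def lowerSeries (p : ℕ) (G : Type*) [Group G] (n : ℕ) : Subgroup G :=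
  sInf {H | ∃ F : ℕ → Subgroup G, IsRestrictedNSeq p F ∧ F n = H}

theorem mem_lowerSeries {p : ℕ} {G : Type*} [Group G] {n : ℕ} {g : G} :
    g ∈ lowerSeries p G n ↔ ∀ F : ℕ → Subgroup G, IsRestrictedNSeq p F → g ∈ F n := by
  simp only [lowerSeries, Subgroup.mem_sInf, Set.mem_ofPred_eq]
  constructor
  · intro h F hF
    exact h _ ⟨F, hF, rfl⟩
  · rintro h _ ⟨F, hF, rfl⟩
    exact h F hF

theorem isRestrictedNSeq_lowerSeries (p : ℕ) (G : Type*) [Group G] :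
    IsRestrictedNSeq p (lowerSeries p G) where
  zero := by
    refine eq_top_iff.2 fun g _ => mem_lowerSeries.2 fun F hF => ?_
    rw [hF.zero]; trivial
  one := by
    refine eq_top_iff.2 fun g _ => mem_lowerSeries.2 fun F hF => ?_
    rw [hF.one]; trivial
  antitone := fun _ _ hij _ hg =>
    mem_lowerSeries.2 fun F hF => hF.antitone hij (mem_lowerSeries.1 hg F hF)
  comm := fun i j g hg h hh => mem_lowerSeries.2 fun F hF =>
    hF.comm i j g (mem_lowerSeries.1 hg F hF) h (mem_lowerSeries.1 hh F hF)
  pow := fun i g hg => mem_lowerSeries.2 fun F hF =>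
    hF.pow i g (mem_lowerSeries.1 hg F hF)

variable (p : ℕ) (G : Type*) [Group G]

instance lowerSeries_normal (n : ℕ) : (lowerSeries p G n).Normal where
  conj_mem := by
    intro h hh g
    have hS := isRestrictedNSeq_lowerSeries p G
    have hg : g⁻¹ ∈ lowerSeries p G 0 := by rw [hS.zero]; trivial
    have h1 := hS.comm 0 n _ hg _ hh
    rw [zero_add, inv_inv] at h1
    have h2 : g * h * g⁻¹ = (g * h⁻¹ * g⁻¹ * h * h⁻¹)⁻¹ := by group
    rw [h2]
    exact inv_mem (mul_mem h1 (inv_mem hh))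

/-- The subgroup `Γ (n + 1)` inside `Γ n`. -/
abbrev nextSeries (n : ℕ) : Subgroup (lowerSeries p G n) :=
  (lowerSeries p G (n + 1)).subgroupOf (lowerSeries p G n)

instance gradedPiece_commGroup (n : ℕ) : CommGroup (lowerSeries p G n ⧸ nextSeries p G n) where
  mul_comm := by
    intro a b
    induction a using QuotientGroup.induction_on with | _ a =>
    induction b using QuotientGroup.induction_on with | _ b =>
    have hS := isRestrictedNSeq_lowerSeries p G
    rw [← QuotientGroup.mk_mul, ← QuotientGroup.mk_mul, eq_comm, QuotientGroup.eq,
      Subgroup.mem_subgroupOf]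
    have h1 : ((b : G) * (a : G))⁻¹ * ((a : G) * (b : G)) ∈ lowerSeries p G (n + 1) := by
      rcases Nat.eq_zero_or_pos n with rfl | hn
      · rw [zero_add, hS.one]; trivial
      · have h2 := hS.comm n n a a.2 b b.2
        have h3 := hS.antitone (show n + 1 ≤ n + n by omega) h2
        have h4 : ((b : G) * (a : G))⁻¹ * ((a : G) * (b : G)) =
            (a : G)⁻¹ * (b : G)⁻¹ * a * b := by group
        rw [h4]; exact h3
    exact h1

/-- The graded piece `Γ n / Γ (n + 1)`, written additively; its degree is `2 * n`
(the pieces of odd degree vanish). -/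
def GradedPiece (n : ℕ) : Type _ := Additive (lowerSeries p G n ⧸ nextSeries p G n)

instance (n : ℕ) : AddCommGroup (GradedPiece p G n) :=
  inferInstanceAs (AddCommGroup (Additive (lowerSeries p G n ⧸ nextSeries p G n)))

variable {p G} in
/-- The class in `Γ n / Γ (n + 1)` of an element `g` of `Γ n`. -/
def rho (n : ℕ) (g : lowerSeries p G n) : GradedPiece p G n :=
  Additive.ofMul (QuotientGroup.mk g : lowerSeries p G n ⧸ nextSeries p G n)

instance [Fact p.Prime] (n : ℕ) : Module (ZMod p) (GradedPiece p G n) :=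
  AddCommGroup.zmodModule (n := p) <| by
    intro a
    change Additive.ofMul (Additive.toMul a ^ p) = Additive.ofMul 1
    congr 1
    generalize Additive.toMul a = b
    induction b using QuotientGroup.induction_on with | _ b =>
    have hS := isRestrictedNSeq_lowerSeries p G
    rw [← QuotientGroup.mk_pow, QuotientGroup.eq_one_iff, Subgroup.mem_subgroupOf]
    rcases Nat.eq_zero_or_pos n with rfl | hn
    · rw [zero_add, hS.one]; trivial
    · have hp : 2 ≤ p := (Fact.out : p.Prime).two_le
      have h1 := hS.pow n b b.2
      exact hS.antitone (show n + 1 ≤ p * n by nlinarith) h1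

variable [Fact p.Prime]

/-- The vector space over `𝔽_p` underlying the restricted Lie algebra `gr G = ⨁ Γ n / Γ (n + 1)`. -/
abbrev LieG : Type _ := ⨁ n : ℕ, GradedPiece p G n

variable {p G} in
/-- The class of `g ∈ Γ n` as a homogeneous element of degree `2 * n` of the Lie algebra. -/
def cls (n : ℕ) (g : lowerSeries p G n) : LieG p G :=
  DirectSum.lof (ZMod p) ℕ (GradedPiece p G) n (rho n g)

/-! ### The universal restricted enveloping algebra -/

/-- The defining relations `a b - b a = [a, b]` and `a ^ p = ξ a` of the restricted enveloping
algebra, for homogeneous `a, b`.  The bracket and the restriction of the Lie algebra are given on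
classes of group elements by `[ρ_r g, ρ_s h] = ρ_{r+s} (g, h)` and `ξ (ρ_r g) = ρ_{pr} (g ^ p)`.
All degrees are even, so no signs occur. -/
inductive EnvRel : TensorAlgebra (ZMod p) (LieG p G) → TensorAlgebra (ZMod p) (LieG p G) → Prop
  | bracket (r s : ℕ) (g : lowerSeries p G r) (h : lowerSeries p G s) :
      EnvRel
        (TensorAlgebra.ι (ZMod p) (cls r g) * TensorAlgebra.ι (ZMod p) (cls s h)
          - TensorAlgebra.ι (ZMod p) (cls s h) * TensorAlgebra.ι (ZMod p) (cls r g))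
        (TensorAlgebra.ι (ZMod p)
          (cls (r + s) ⟨(g : G)⁻¹ * (h : G)⁻¹ * g * h,
            (isRestrictedNSeq_lowerSeries p G).comm r s g g.2 h h.2⟩))
  | restriction (r : ℕ) (g : lowerSeries p G r) :
      EnvRel
        (TensorAlgebra.ι (ZMod p) (cls r g) ^ p)
        (TensorAlgebra.ι (ZMod p)
          (cls (p * r) ⟨(g : G) ^ p, (isRestrictedNSeq_lowerSeries p G).pow r g g.2⟩))

/-- The universal restricted enveloping algebra of the restricted Lie algebra of `G`: the tensor
algebra modulo the two-sided ideal generated by the relations above. -/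
def VL : Type _ := RingQuot (EnvRel p G)

instance : Ring (VL p G) := inferInstanceAs (Ring (RingQuot (EnvRel p G)))

instance : Algebra (ZMod p) (VL p G) := inferInstanceAs (Algebra (ZMod p) (RingQuot (EnvRel p G)))

namespace VL

/-- The canonical map from the restricted Lie algebra to its enveloping algebra. -/
def ι : LieG p G →ₗ[ZMod p] VL p G :=
  (RingQuot.mkAlgHom (ZMod p) (EnvRel p G)).toLinearMap ∘ₗ TensorAlgebra.ι (ZMod p)

/-- The augmentation, which kills the Lie algebra. -/
def augmentation : VL p G →ₐ[ZMod p] ZMod p :=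
  RingQuot.liftAlgHom (ZMod p) ⟨TensorAlgebra.algebraMapInv, by
    have h0 : ∀ a : LieG p G,
        (TensorAlgebra.algebraMapInv (TensorAlgebra.ι (ZMod p) a) : ZMod p) = 0 := by
      intro a; simp [TensorAlgebra.algebraMapInv]
    rintro _ _ (⟨r, s, g, h⟩ | ⟨r, g⟩)
    · simp [h0]
    · simp [h0, (Fact.out : p.Prime).ne_zero]⟩

/-- The homogeneous elements of internal degree `t`: the span of the products of homogeneous
elements of the Lie algebra whose degrees `2 * n` add up to `t`. -/
def degreePart (t : ℕ) : Submodule (ZMod p) (VL p G) :=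
  Submodule.span (ZMod p)
    {z | ∃ l : List (Σ n : ℕ, lowerSeries p G n),
      (l.map fun e => 2 * e.1).sum = t ∧ (l.map fun e => ι p G (cls e.1 e.2)).prod = z}

/-- The augmentation ideal, as an algebra without unit. -/
def augIdeal : NonUnitalSubalgebra (ZMod p) (VL p G) where
  carrier := {a | augmentation p G a = 0}
  add_mem' := by intro a b ha hb; simp_all
  zero_mem' := by simp
  mul_mem' := by intro a b ha hb; simp_all
  smul_mem' := by intro c a ha; simp_all

/-- The homogeneous elements of internal degree `t` of the augmentation ideal. -/
def augDegreePart (t : ℕ) : Submodule (ZMod p) (augIdeal p G) where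
  carrier := {a | (a : VL p G) ∈ degreePart p G t}
  add_mem' := fun ha hb => (degreePart p G t).add_mem ha hb
  zero_mem' := (degreePart p G t).zero_mem
  smul_mem' := fun c _ ha => (degreePart p G t).smul_mem c ha

end VL

end MetacyclicCohomology

/-! ### The cobar complex

`I` is the augmentation ideal of an augmented algebra over `k`, graded by the subspaces `d t`,
with all nonzero `d t` in even degrees, so that signs depend on homological degrees only. -/

namespace Cobar

/-- Functions on words `[a₁, …, a_s]` in `I`.  The multilinear ones on words of length `s` are the
linear forms on `I ^ ⊗ s`. -/
def Fun (k I : Type*) : Type _ := List I → k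

section

variable {k I : Type*}

@[ext] theorem Fun.ext {f g : Fun k I} (h : ∀ w : List I, f w = g w) : f = g := funext h

/-- `(tail a f) w = f (a :: w)`. -/
def tail (a : I) (f : Fun k I) : Fun k I := fun w => f (a :: w)

@[simp] theorem tail_apply (a : I) (f : Fun k I) (w : List I) : tail a f w = f (a :: w) := rfl

variable [Field k]

instance : AddCommGroup (Fun k I) := inferInstanceAs (AddCommGroup (List I → k))
instance : Module k (Fun k I) := inferInstanceAs (Module k (List I → k))

@[simp] theorem add_apply (f g : Fun k I) (w : List I) : (f + g) w = f w + g w := rfl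
@[simp] theorem neg_apply (f : Fun k I) (w : List I) : (-f) w = -f w := rfl
@[simp] theorem zero_apply (w : List I) : (0 : Fun k I) w = 0 := rfl
@[simp] theorem smul_apply (c : k) (f : Fun k I) (w : List I) : (c • f) w = c * f w := rfl

/-- The product dual to cutting a word in two: on forms on `I ^ ⊗ s` and `I ^ ⊗ s'` it is
`(f ∪ g) [a₁, …, a_{s+s'}] = f [a₁, …, a_s] * g [a_{s+1}, …, a_{s+s'}]`. -/
instance : Mul (Fun k I) :=
  ⟨fun f g w => ∑ i ∈ Finset.range (w.length + 1), f (w.take i) * g (w.drop i)⟩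

instance : One (Fun k I) := ⟨fun w => if w.length = 0 then 1 else 0⟩

theorem mul_apply (f g : Fun k I) (w : List I) :
    (f * g) w = ∑ i ∈ Finset.range (w.length + 1), f (w.take i) * g (w.drop i) := rfl

theorem one_apply (w : List I) : (1 : Fun k I) w = if w.length = 0 then 1 else 0 := rfl

theorem mul_nil (f g : Fun k I) : (f * g) [] = f [] * g [] := by
  simp [mul_apply]

theorem mul_cons (f g : Fun k I) (a : I) (w : List I) :
    (f * g) (a :: w) = f [] * g (a :: w) + (tail a f * g) w := by
  simp only [mul_apply, List.length_cons]
  rw [Finset.sum_range_succ']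
  simp [add_comm]

theorem tail_mul (f g : Fun k I) (a : I) :
    tail a (f * g) = f [] • tail a g + tail a f * g := by
  ext w; simp [mul_cons]

theorem fun_add_mul (f g h : Fun k I) : (f + g) * h = f * h + g * h := by
  ext w; simp [mul_apply, add_mul, Finset.sum_add_distrib]

theorem fun_mul_add (f g h : Fun k I) : f * (g + h) = f * g + f * h := by
  ext w; simp [mul_apply, mul_add, Finset.sum_add_distrib]

theorem fun_smul_mul (c : k) (f g : Fun k I) : (c • f) * g = c • (f * g) := by
  ext w; simp [mul_apply, mul_assoc, Finset.mul_sum]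

theorem fun_mul_smul (c : k) (f g : Fun k I) : f * (c • g) = c • (f * g) := by
  ext w; simp [mul_apply, mul_left_comm, Finset.mul_sum]

theorem fun_zero_mul (f : Fun k I) : 0 * f = 0 := by
  ext w; simp [mul_apply]

theorem fun_mul_zero (f : Fun k I) : f * 0 = 0 := by
  ext w; simp [mul_apply]

theorem fun_mul_assoc (f g h : Fun k I) : f * g * h = f * (g * h) := by
  ext w
  induction w generalizing f with
  | nil => simp [mul_nil, mul_assoc]
  | cons a w ih =>
    simp only [mul_cons, tail_mul, fun_add_mul, fun_smul_mul, add_apply, smul_apply, ih, mul_nil]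
    ring

theorem fun_one_mul (f : Fun k I) : 1 * f = f := by
  ext w
  cases w with
  | nil => simp [mul_nil, one_apply]
  | cons a w =>
    have h : tail a (1 : Fun k I) = 0 := by ext v; simp [one_apply]
    simp [mul_cons, h, fun_zero_mul, one_apply]

theorem fun_mul_one (f : Fun k I) : f * 1 = f := by
  ext w
  induction w generalizing f with
  | nil => simp [mul_nil, one_apply]
  | cons a w ih => simp [mul_cons, ih, one_apply]

instance : Ring (Fun k I) :=
  { (inferInstance : AddCommGroup (Fun k I)), (inferInstance : Mul (Fun k I)),
    (inferInstance : One (Fun k I)) with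
    left_distrib := fun_mul_add
    right_distrib := fun_add_mul
    zero_mul := fun_zero_mul
    mul_zero := fun_mul_zero
    mul_assoc := fun_mul_assoc
    one_mul := fun_one_mul
    mul_one := fun_mul_one }

instance : Algebra k (Fun k I) := Algebra.ofModule fun_smul_mul fun_mul_smul

/-- The sign `f ↦ (-1) ^ s f` on forms on `I ^ ⊗ s`. -/
def sign (f : Fun k I) : Fun k I := fun w => (-1) ^ w.length * f w

@[simp] theorem sign_apply (f : Fun k I) (w : List I) : sign f w = (-1) ^ w.length * f w := rfl

theorem sign_sign (f : Fun k I) : sign (sign f) = f := by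
  ext w; simp [← mul_assoc, ← pow_add, ← two_mul]

variable [NonUnitalRing I]

/-- Multiplies the letters `i` and `i + 1` (counted from `0`) of a word. -/
def merge : ℕ → List I → List I
  | 0, a :: b :: w => (a * b) :: w
  | i + 1, a :: w => a :: merge i w
  | _, w => w

/-- The cobar differential
`(δ f) [a₁, …, a_{s+1}] = ∑_{i=1}^{s} (-1) ^ (i + 1) f [a₁, …, a_i a_{i+1}, …, a_{s+1}]`. -/
def delta (f : Fun k I) : Fun k I :=
  fun w => ∑ i ∈ Finset.range (w.length - 1), (-1) ^ i * f (merge i w)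

theorem delta_apply (f : Fun k I) (w : List I) :
    delta f w = ∑ i ∈ Finset.range (w.length - 1), (-1) ^ i * f (merge i w) := rfl

@[simp] theorem delta_nil (f : Fun k I) : delta f [] = 0 := by simp [delta_apply]

@[simp] theorem delta_single (f : Fun k I) (a : I) : delta f [a] = 0 := by simp [delta_apply]

theorem delta_cons_cons (f : Fun k I) (a b : I) (w : List I) :
    delta f (a :: b :: w) = f ((a * b) :: w) - delta (tail a f) (b :: w) := by
  simp only [delta_apply, List.length_cons, Nat.add_sub_cancel]
  rw [Finset.sum_range_succ']
  simp only [merge, tail_apply, pow_zero, one_mul, pow_succ, mul_neg, mul_one, neg_mul,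
    Finset.sum_neg_distrib]
  ring

theorem delta_add (f g : Fun k I) : delta (f + g) = delta f + delta g := by
  ext w; simp [delta_apply, mul_add, Finset.sum_add_distrib]

theorem delta_smul (c : k) (f : Fun k I) : delta (c • f) = c • delta f := by
  ext w; simp [delta_apply, mul_left_comm, Finset.mul_sum]

theorem delta_sign (f : Fun k I) : delta (sign f) = -sign (delta f) := by
  ext w
  induction w generalizing f with
  | nil => simp
  | cons a w ih =>
    cases w with
    | nil => simp
    | cons b w =>
      have h : tail a (sign f) = (-1 : k) • sign (tail a f) := by
        ext v; simp [pow_succ]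
      rw [delta_cons_cons, h, delta_smul, smul_apply, ih]
      simp only [neg_apply, sign_apply, delta_cons_cons, List.length_cons, pow_succ]
      ring

/-- The Leibniz rule. -/
theorem delta_mul (f g : Fun k I) : delta (f * g) = delta f * g + sign f * delta g := by
  ext w
  induction w generalizing f with
  | nil => simp [mul_nil]
  | cons a w ih =>
    cases w with
    | nil => simp [mul_cons, mul_nil]
    | cons b w =>
      have h : tail a (sign f) = (-1 : k) • sign (tail a f) := by
        ext v; simp [pow_succ]
      have h2 : tail b (tail a (delta f)) = tail (a * b) f - tail b (delta (tail a f)) := by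
        ext v; simp [delta_cons_cons, sub_eq_add_neg]
      have h3 : tail b ((-1 : k) • sign (tail a f)) = (-1 : k) • tail b (sign (tail a f)) := rfl
      rw [delta_cons_cons, tail_mul, delta_add, delta_smul, add_apply, smul_apply, ih]
      simp only [add_apply, mul_cons, h2, h3, h, delta_cons_cons, tail_apply, delta_nil,
        delta_single, sign_apply, smul_apply, sub_eq_add_neg, neg_mul, fun_smul_mul,
        neg_apply, fun_add_mul]
      simp
      ring

variable [Module k I]

/-- `C^{s,t}`: the forms on `I ^ ⊗ s` that vanish on tensors of homogeneous elements whose degrees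
do not add up to `t`. -/
def bidegree (d : ℕ → Submodule k I) (s t : ℕ) : Submodule k (Fun k I) where
  carrier := {f |
    (∀ (u v : List I) (a b : I), f (u ++ (a + b) :: v) = f (u ++ a :: v) + f (u ++ b :: v)) ∧
    (∀ (u v : List I) (c : k) (a : I), f (u ++ (c • a) :: v) = c * f (u ++ a :: v)) ∧
    (∀ w : List I, w.length ≠ s → f w = 0) ∧
    (∀ (w : List I) (e : List ℕ), List.Forall₂ (fun a i => a ∈ d i) w e → e.sum ≠ t → f w = 0)}
  add_mem' := by
    rintro f g ⟨h1, h2, h3, h4⟩ ⟨h1', h2', h3', h4'⟩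
    refine ⟨fun u v a b => ?_, fun u v c a => ?_, fun w hw => ?_, fun w e he ht => ?_⟩
    · simp only [add_apply, h1, h1']; ring
    · simp only [add_apply, h2, h2']; ring
    · simp [h3 w hw, h3' w hw]
    · simp [h4 w e he ht, h4' w e he ht]
  zero_mem' := by simp
  smul_mem' := by
    rintro c f ⟨h1, h2, h3, h4⟩
    refine ⟨fun u v a b => ?_, fun u v c a => ?_, fun w hw => ?_, fun w e he ht => ?_⟩
    · simp only [smul_apply, h1]; ring
    · simp only [smul_apply, h2]; ring
    · simp [h3 w hw]
    · simp [h4 w e he ht]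

theorem one_mem_bidegree (d : ℕ → Submodule k I) : (1 : Fun k I) ∈ bidegree d 0 0 := by
  refine ⟨fun u v a b => ?_, fun u v c a => ?_, fun w hw => ?_, fun w e he ht => ?_⟩
  · simp [one_apply]
  · simp [one_apply]
  · simpa [one_apply] using hw
  · cases he with
    | nil => simp at ht
    | cons => simp [one_apply]

theorem mul_mem_bidegree {d : ℕ → Submodule k I} {s t s' t' : ℕ} {f g : Fun k I}
    (hf : f ∈ bidegree d s t) (hg : g ∈ bidegree d s' t') :
    f * g ∈ bidegree d (s + s') (t + t') := by
  obtain ⟨h1, h2, h3, h4⟩ := hf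
  obtain ⟨h1', h2', h3', h4'⟩ := hg
  refine ⟨fun u v a b => ?_, fun u v c a => ?_, fun w hw => ?_, fun w e he ht => ?_⟩
  · clear h2 h3 h4
    induction u generalizing f with
    | nil =>
      have h : tail (a + b) f = tail a f + tail b f := by ext w; simpa using h1 [] w a b
      have h' := h1' [] v a b
      simp only [List.nil_append] at h' ⊢
      simp only [mul_cons, h, h', fun_add_mul, add_apply]
      ring
    | cons c u ih =>
      have h' := h1' (c :: u) v a b
      have hi := ih (f := tail c f) (fun u v a b => by simpa using h1 (c :: u) v a b)
      simp only [List.cons_append] at h' ⊢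
      simp only [mul_cons, h', hi]
      ring
  · clear h1 h3 h4
    induction u generalizing f with
    | nil =>
      have h : tail (c • a) f = c • tail a f := by ext w; simpa using h2 [] w c a
      have h' := h2' [] v c a
      simp only [List.nil_append] at h' ⊢
      simp only [mul_cons, h, h', fun_smul_mul, smul_apply]
      ring
    | cons b u ih =>
      have h' := h2' (b :: u) v c a
      have hi := ih (f := tail b f) (fun u v c a => by simpa using h2 (b :: u) v c a)
      simp only [List.cons_append] at h' ⊢
      simp only [mul_cons, h', hi]
      ring
  · refine Finset.sum_eq_zero fun i hi => ?_
    have hi' : i ≤ w.length := by simpa [Nat.lt_succ_iff] using hi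
    by_cases his : i = s
    · rw [h3' (w.drop i) (by simp; omega), mul_zero]
    · rw [h3 (w.take i) (by simp; omega), zero_mul]
  · refine Finset.sum_eq_zero fun i _ => ?_
    have hs : e.sum = (e.take i).sum + (e.drop i).sum := by
      rw [← List.sum_append, List.take_append_drop]
    by_cases hit : (e.take i).sum = t
    · rw [h4' (w.drop i) (e.drop i) (List.forall₂_drop i he) (by omega), mul_zero]
    · rw [h4 (w.take i) (e.take i) (List.forall₂_take i he) hit, zero_mul]

theorem sign_mem_bidegree {d : ℕ → Submodule k I} {s t : ℕ} {f : Fun k I}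
    (hf : f ∈ bidegree d s t) : sign f ∈ bidegree d s t := by
  have h : sign f = ((-1) ^ s : k) • f := by
    ext w
    by_cases hw : w.length = s
    · simp [hw]
    · simp [hf.2.2.1 w hw]
  rw [h]
  exact Submodule.smul_mem _ _ hf

/-- The cobar complex `C = ⨁ C^{s,t}`, a subalgebra of the algebra of functions on words. -/
def complex (d : ℕ → Submodule k I) : Subalgebra k (Fun k I) :=
  Submodule.toSubalgebra (⨆ x : ℕ × ℕ, bidegree d x.1 x.2)
    (Submodule.mem_iSup_of_mem (0, 0) (one_mem_bidegree d))
    (fun f g hf hg => by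
      induction hf using Submodule.iSup_induction' with
      | zero => rw [zero_mul]; exact zero_mem _
      | add f f' _ _ h h' => rw [add_mul]; exact add_mem h h'
      | mem x f hf =>
        induction hg using Submodule.iSup_induction' with
        | zero => rw [mul_zero]; exact zero_mem _
        | add g g' _ _ h h' => rw [mul_add]; exact add_mem h h'
        | mem y g hg =>
          exact Submodule.mem_iSup_of_mem (x.1 + y.1, x.2 + y.2) (mul_mem_bidegree hf hg))

theorem sign_mem_complex {d : ℕ → Submodule k I} {f : Fun k I} (hf : f ∈ complex d) :
    sign f ∈ complex d := by
  change f ∈ ⨆ x : ℕ × ℕ, bidegree d x.1 x.2 at hf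
  change sign f ∈ ⨆ x : ℕ × ℕ, bidegree d x.1 x.2
  induction hf using Submodule.iSup_induction' with
  | zero =>
    have h : sign (0 : Fun k I) = 0 := by ext w; simp
    rw [h]; exact zero_mem _
  | add f f' _ _ h h' =>
    have h0 : sign (f + f') = sign f + sign f' := by ext w; simp [mul_add]
    rw [h0]; exact add_mem h h'
  | mem x f hf => exact Submodule.mem_iSup_of_mem x (sign_mem_bidegree hf)

/-- The algebra of cocycles. -/
def cocycles (d : ℕ → Submodule k I) : Subalgebra k (Fun k I) where
  carrier := {f | f ∈ complex d ∧ delta f = 0}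
  add_mem' := by
    rintro f g ⟨hf, hf'⟩ ⟨hg, hg'⟩
    exact ⟨add_mem hf hg, by rw [delta_add, hf', hg', add_zero]⟩
  mul_mem' := by
    rintro f g ⟨hf, hf'⟩ ⟨hg, hg'⟩
    exact ⟨mul_mem hf hg, by rw [delta_mul, hf', hg', zero_mul, mul_zero, add_zero]⟩
  algebraMap_mem' := by
    intro c
    refine ⟨Subalgebra.algebraMap_mem _ c, ?_⟩
    ext w
    rw [Algebra.algebraMap_eq_smul_one, delta_smul, smul_apply, zero_apply]
    rcases w with _ | ⟨a, _ | ⟨b, w⟩⟩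
    · simp
    · simp
    · have h : tail a (1 : Fun k I) = (0 : k) • 1 := by ext v; simp [one_apply]
      rw [delta_cons_cons, h, delta_smul]
      simp [one_apply]

/-- The two-sided ideal of coboundaries in the algebra of cocycles. -/
def coboundaries (d : ℕ → Submodule k I) : Ideal (cocycles d) where
  carrier := {z | ∃ c ∈ complex d, delta c = z}
  add_mem' := by
    rintro z z' ⟨c, hc, h⟩ ⟨c', hc', h'⟩
    exact ⟨c + c', add_mem hc hc', by rw [delta_add, h, h']; rfl⟩
  zero_mem' := ⟨0, zero_mem _, by ext w; simp [delta_apply]⟩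
  smul_mem' := by
    rintro z z' ⟨c, hc, h⟩
    refine ⟨sign z * c, mul_mem (sign_mem_complex z.2.1) hc, ?_⟩
    have h0 : sign (0 : Fun k I) = 0 := by ext w; simp
    rw [delta_mul, delta_sign, z.2.2, sign_sign, h, h0, neg_zero, zero_mul, zero_add]
    rfl

instance (d : ℕ → Submodule k I) : (coboundaries d).IsTwoSided where
  mul_mem_of_left := by
    rintro z z' ⟨c, hc, h⟩
    refine ⟨c * z', mul_mem hc z'.2.1, ?_⟩
    rw [delta_mul, h, z'.2.2, mul_zero, add_zero]
    rfl

/-- The cohomology algebra `H^*`, cocycles modulo coboundaries, with the product induced by that of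
the cobar complex. -/
abbrev Cohomology (d : ℕ → Submodule k I) : Type _ := cocycles d ⧸ coboundaries d

/-- The cohomology class of a cocycle. -/
abbrev toCohomology (d : ℕ → Submodule k I) : cocycles d →ₐ[k] Cohomology d :=
  Ideal.Quotient.mkₐ k (coboundaries d)

/-- `H^{s,t}`: the classes of the cocycles of bidegree `(s, t)`. -/
def cohomologyPart (d : ℕ → Submodule k I) (s t : ℕ) : Submodule k (Cohomology d) :=
  ((bidegree d s t).comap (cocycles d).val.toLinearMap).map (toCohomology d).toLinearMap

/-- The symmetric Massey product `⟨α⟩ ^ r` of a class `α ∈ H^{s,t}`, `s ≥ 1`, `r ≥ 3`: the set of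
the classes of the related cocycles `∑_{j=1}^{r-1} ā_j a_{r-j}` of all defining systems
`a_i ∈ C^{i(s-1)+1, it}`, `1 ≤ i ≤ r - 1`, where `a_1` represents `α` and
`δ a_i = ∑_{j=1}^{i-1} ā_j a_{i-j}` for `2 ≤ i ≤ r - 1`.
Here `ā = (-1) ^ (deg a + 1) a = -(sign a)`. -/
def symMassey (d : ℕ → Submodule k I) (s t r : ℕ) (α : Cohomology d) : Set (Cohomology d) :=
  {β | ∃ a : ℕ → Fun k I,
    (∀ i ∈ Finset.Icc 1 (r - 1), a i ∈ bidegree d (i * (s - 1) + 1) (i * t)) ∧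
    (∃ z : cocycles d, (z : Fun k I) = a 1 ∧ toCohomology d z = α) ∧
    (∀ i ∈ Finset.Icc 2 (r - 1),
      delta (a i) = ∑ j ∈ Finset.Icc 1 (i - 1), -sign (a j) * a (i - j)) ∧
    ∃ z : cocycles d, (z : Fun k I) = ∑ j ∈ Finset.Icc 1 (r - 1), -sign (a j) * a (r - j) ∧
      toCohomology d z = β}

end

end Cobar

namespace MetacyclicCohomology

/-! ### Metacyclic groups -/

/-- The relations `x ^ (p ^ m) = 1`, `y ^ (p ^ n) = x ^ (p ^ q)`, `(x, y) = x ^ (p ^ l)` with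
`(x, y) = x⁻¹ y⁻¹ x y`. -/
def metacyclicRels (p m n q l : ℕ) : Set (FreeGroup (Fin 2)) :=
  let x := FreeGroup.of (0 : Fin 2)
  let y := FreeGroup.of (1 : Fin 2)
  {x ^ p ^ m, y ^ p ^ n * (x ^ p ^ q)⁻¹, x⁻¹ * y⁻¹ * x * y * (x ^ p ^ l)⁻¹}

/-- The group `P(m, n, q, l)`. -/
abbrev Metacyclic (p m n q l : ℕ) : Type := PresentedGroup (metacyclicRels p m n q l)

/-- The cohomology algebra `H^*(VL G)`. -/
abbrev HVL (p : ℕ) [Fact p.Prime] (G : Type*) [Group G] : Type _ :=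
  Cobar.Cohomology (VL.augDegreePart p G)

/-- The bigraded piece `H^{s,t}(VL G)`: homological degree `s`, internal degree `t`. -/
abbrev HVLpart (p : ℕ) [Fact p.Prime] (G : Type*) [Group G] (s t : ℕ) :
    Submodule (ZMod p) (HVL p G) :=
  Cobar.cohomologyPart (VL.augDegreePart p G) s t

end MetacyclicCohomology

end

/-! The theorem combines a computation for an arbitrary algebra `A = k[X, Y] / (X ^ a, Y ^ b)` with
`a, b ≥ 3` and a group-theoretic identification of the enveloping algebra with such an `A`.

Upper bound for the cohomology. Linear forms on `A ⊗ I ^ ⊗ s` that vanish when the first factor lies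
in an ideal `J` are cochains with coefficients dual to `A / J`. For `J = 0` this complex is
contractible up to the class of `1` (`resolves_bot`); for `J = I` its cocycles give back those of
the cobar complex. Since `X` and `X ^ (a - 1)` divide each other's annihilators exactly, passing
from `J` to `J + XA` costs a periodicity of length two, which creates `x` in degree one and `u` in
degree two (`Resolves.step`). Adjoining `Y` and then `X` shows that every cocycle is cohomologous to
a combination of the products `u ^ i x ^ e v ^ j y ^ f` with `e, f ≤ 1`.

Lower bound and relations. The words `[X, X ^ (a - 1), X, …]`, and their analogues for `Y`, are
cycles of the bar complex. As `A` is commutative, their signed shuffles are cycles too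
(`shuffle_delta`), so evaluation on a shuffle depends only on the cohomology class. The monomials
above are dual to these shuffles (`shuffle_mul`, `tower_alternating`); hence they are independent,
and every identity in cohomology can be checked on shuffles. Graded commutativity is the shuffle
sign, and `x ^ 2 = 0` holds because `a - 1 ≠ 1`.

Massey products. The cochains dual to `X ^ i` form a defining system, because `δ` is the transpose
of multiplication. It is the only one: a one-cocycle vanishes on products, so it vanishes altogether
when its internal degree is not that of the generators.

Group side. The elements `x ^ i y ^ j` with `p ^ K` dividing `i` and `j` form a subgroup.
Commutators of such elements gain an extra factor `p`, and, `p` being odd, so do `p`-th powers.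
Therefore these subgroups are the terms of the mod-`p` lower central series, which drops only at
powers of `p`. The Lie algebra is spanned by the classes of `x ^ p ^ k` and `y ^ p ^ k`, its bracket
is zero, and the enveloping algebra is generated by the commuting classes of `x` and `y`. The
relation `y ^ p ^ n = x ^ p ^ q` kills the power of whichever generator has the smaller exponent;
for `q = n` it kills the `p ^ n`-th power of the difference, which then replaces the class of `y`.
That there are no further relations follows from the normal form in the group, proved with a
permutation model, which yields a map onto the truncated polynomial algebra
(`IsMetacyclic.exists_lift`). -/

namespace Cobar

/-! ### Multilinear forms -/

section Forms

variable {k I : Type*} [Field k]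

theorem sum_apply {ι : Type*} (s : Finset ι) (f : ι → Fun k I) (w : List I) :
    (∑ j ∈ s, f j) w = ∑ j ∈ s, f j w :=
  Finset.sum_apply (M := fun _ => k) w s f

@[simp] theorem sub_apply (f g : Fun k I) (w : List I) : (f - g) w = f w - g w := rfl

variable [NonUnitalRing I]

/-- Multiplies the first letter of a word by `a` on the left. -/
def mergeHead (a : I) (f : Fun k I) : Fun k I
  | [] => 0
  | b :: w => f ((a * b) :: w)

@[simp] theorem mergeHead_nil (a : I) (f : Fun k I) : mergeHead a f [] = 0 := rfl

@[simp] theorem mergeHead_cons (a b : I) (f : Fun k I) (w : List I) :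
    mergeHead a f (b :: w) = f ((a * b) :: w) := rfl

theorem tail_delta (a : I) (f : Fun k I) :
    tail a (delta f) = mergeHead a f - delta (tail a f) := by
  ext w
  cases w with
  | nil => simp
  | cons b w => simp [delta_cons_cons, sub_eq_add_neg]

theorem delta_sub (f g : Fun k I) : delta (f - g) = delta f - delta g := by
  have h : f - g = f + (-1 : k) • g := by ext w; simp [sub_eq_add_neg]
  rw [h, delta_add, delta_smul]
  ext w; simp [sub_eq_add_neg]

@[simp] theorem delta_zero : delta (0 : Fun k I) = 0 := by ext w; simp [delta_apply]

theorem delta_sum {ι : Type*} (s : Finset ι) (f : ι → Fun k I) :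
    delta (∑ i ∈ s, f i) = ∑ i ∈ s, delta (f i) := by
  classical
  induction s using Finset.induction_on with
  | empty => simp
  | insert i s hi ih => rw [Finset.sum_insert hi, Finset.sum_insert hi, delta_add, ih]

theorem delta_delta (f : Fun k I) : delta (delta f) = 0 := by
  ext w
  induction w generalizing f with
  | nil => simp
  | cons a w ih =>
    cases w with
    | nil => simp
    | cons b w =>
      have h : delta (mergeHead a f) (b :: w) = delta f ((a * b) :: w) := by
        cases w with
        | nil => simp
        | cons c w =>
          rw [delta_cons_cons, delta_cons_cons, mergeHead_cons, mul_assoc]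
          rfl
      rw [delta_cons_cons, tail_delta, delta_sub, sub_eq_add_neg (delta _), add_apply, neg_apply,
        h, ih]
      simp

variable [Module k I]

variable (k I) in
/-- The multilinear functions on words. -/
def multilinear : Submodule k (Fun k I) where
  carrier := {f |
    (∀ (u v : List I) (a b : I), f (u ++ (a + b) :: v) = f (u ++ a :: v) + f (u ++ b :: v)) ∧
    (∀ (u v : List I) (c : k) (a : I), f (u ++ (c • a) :: v) = c * f (u ++ a :: v))}
  add_mem' := by
    rintro f g ⟨h1, h2⟩ ⟨h1', h2'⟩
    refine ⟨fun u v a b => ?_, fun u v c a => ?_⟩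
    · simp only [add_apply, h1, h1']; ring
    · simp only [add_apply, h2, h2']; ring
  zero_mem' := by simp
  smul_mem' := by
    rintro c f ⟨h1, h2⟩
    refine ⟨fun u v a b => ?_, fun u v c a => ?_⟩
    · simp only [smul_apply, h1]; ring
    · simp only [smul_apply, h2]; ring

theorem tail_mem_multilinear {f : Fun k I} (hf : f ∈ multilinear k I) (a : I) :
    tail a f ∈ multilinear k I :=
  ⟨fun u v b c => by simpa using hf.1 (a :: u) v b c,
    fun u v c b => by simpa using hf.2 (a :: u) v c b⟩

theorem tail_add_left {f : Fun k I} (hf : f ∈ multilinear k I) (a b : I) :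
    tail (a + b) f = tail a f + tail b f := by
  ext w; simpa using hf.1 [] w a b

theorem tail_smul_left {f : Fun k I} (hf : f ∈ multilinear k I) (c : k) (a : I) :
    tail (c • a) f = c • tail a f := by
  ext w; simpa using hf.2 [] w c a

theorem tail_zero_left {f : Fun k I} (hf : f ∈ multilinear k I) : tail (0 : I) f = 0 := by
  simpa using tail_smul_left hf 0 0

theorem mul_mem_multilinear {f g : Fun k I} (hf : f ∈ multilinear k I)
    (hg : g ∈ multilinear k I) : f * g ∈ multilinear k I := by
  refine ⟨fun u v a b => ?_, fun u v c a => ?_⟩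
  · induction u generalizing f with
    | nil =>
      have h' := hg.1 [] v a b
      simp only [List.nil_append] at h' ⊢
      simp only [mul_cons, tail_add_left hf, h', fun_add_mul, add_apply]
      ring
    | cons c u ih =>
      have h' := hg.1 (c :: u) v a b
      have hi := ih (tail_mem_multilinear hf c)
      simp only [List.cons_append] at h' ⊢
      simp only [mul_cons, h', hi]
      ring
  · induction u generalizing f with
    | nil =>
      have h' := hg.2 [] v c a
      simp only [List.nil_append] at h' ⊢
      simp only [mul_cons, tail_smul_left hf, h', fun_smul_mul, smul_apply]
      ring
    | cons b u ih =>
      have h' := hg.2 (b :: u) v c a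
      have hi := ih (tail_mem_multilinear hf b)
      simp only [List.cons_append] at h' ⊢
      simp only [mul_cons, h', hi]
      ring

theorem delta_mem_multilinear [IsScalarTower k I I] [SMulCommClass k I I] {f : Fun k I}
    (hf : f ∈ multilinear k I) : delta f ∈ multilinear k I := by
  refine ⟨fun u v a b => ?_, fun u v c a => ?_⟩
  · induction u generalizing f with
    | nil =>
      cases v with
      | nil => simp
      | cons e v =>
        simp only [List.nil_append, delta_cons_cons, add_mul, tail_add_left hf, delta_add,
          add_apply]
        rw [show f ((a * e + b * e) :: v) = _ from hf.1 [] v _ _]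
        simp only [List.nil_append]
        ring
    | cons e u ih =>
      have hi := ih (tail_mem_multilinear hf e)
      cases u with
      | nil =>
        simp only [List.nil_append, List.cons_append, delta_cons_cons, mul_add] at hi ⊢
        rw [show f ((e * a + e * b) :: v) = _ from hf.1 [] v _ _, hi]
        simp only [List.nil_append]
        ring
      | cons e' u =>
        have h := hf.1 ((e * e') :: u) v a b
        simp only [List.cons_append] at hi h ⊢
        simp only [delta_cons_cons f, hi, h]
        ring
  · induction u generalizing f with
    | nil =>
      cases v with
      | nil => simp
      | cons e v =>
        simp only [List.nil_append, delta_cons_cons, smul_mul_assoc, tail_smul_left hf, delta_smul,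
          smul_apply]
        rw [show f ((c • (a * e)) :: v) = _ from hf.2 [] v _ _]
        simp only [List.nil_append]
        ring
    | cons e u ih =>
      have hi := ih (tail_mem_multilinear hf e)
      cases u with
      | nil =>
        simp only [List.nil_append, List.cons_append, delta_cons_cons, mul_smul_comm] at hi ⊢
        rw [show f ((c • (e * a)) :: v) = _ from hf.2 [] v _ _, hi]
        simp only [List.nil_append]
        ring
      | cons e' u =>
        have h := hf.2 ((e * e') :: u) v c a
        simp only [List.cons_append] at hi h ⊢
        simp only [delta_cons_cons f, hi, h]
        ring

variable (k I) in
/-- The multilinear forms on `I ^ ⊗ s`; they vanish for `s < 0`. -/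
def forms (s : ℤ) : Submodule k (Fun k I) where
  carrier := {f | f ∈ multilinear k I ∧ ∀ w : List I, (w.length : ℤ) ≠ s → f w = 0}
  add_mem' := by
    rintro f g ⟨h1, h2⟩ ⟨h1', h2'⟩
    exact ⟨add_mem h1 h1', fun w hw => by simp [h2 w hw, h2' w hw]⟩
  zero_mem' := ⟨zero_mem _, fun _ _ => rfl⟩
  smul_mem' := by
    rintro c f ⟨h1, h2⟩
    exact ⟨Submodule.smul_mem _ c h1, fun w hw => by simp [h2 w hw]⟩

theorem forms_eq_zero {s : ℤ} (hs : s < 0) {f : Fun k I} (hf : f ∈ forms k I s) : f = 0 := by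
  ext w
  exact hf.2 w (by omega)

theorem one_mem_forms : (1 : Fun k I) ∈ forms k I 0 := by
  refine ⟨⟨fun u v a b => ?_, fun u v c a => ?_⟩, fun w hw => ?_⟩
  · simp [one_apply]
  · simp [one_apply]
  · simpa [one_apply] using hw

theorem mem_forms_zero {f : Fun k I} (hf : f ∈ forms k I 0) : f = f [] • (1 : Fun k I) := by
  ext w
  cases w with
  | nil => simp [one_apply]
  | cons a w => rw [hf.2 _ (by simp; omega)]; simp [one_apply]

theorem tail_mem_forms {s : ℤ} {f : Fun k I} (hf : f ∈ forms k I s) (a : I) :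
    tail a f ∈ forms k I (s - 1) :=
  ⟨tail_mem_multilinear hf.1 a, fun w hw => hf.2 _ (by simp; omega)⟩

theorem mul_mem_forms {s s' : ℤ} {f g : Fun k I} (hf : f ∈ forms k I s) (hg : g ∈ forms k I s') :
    f * g ∈ forms k I (s + s') := by
  refine ⟨mul_mem_multilinear hf.1 hg.1, fun w hw => Finset.sum_eq_zero fun i hi => ?_⟩
  have hi' : i ≤ w.length := by simpa [Nat.lt_succ_iff] using hi
  by_cases his : (i : ℤ) = s
  · rw [hg.2 (w.drop i) (by simp; omega), mul_zero]
  · rw [hf.2 (w.take i) (by simp; omega), zero_mul]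

theorem length_merge (i : ℕ) (w : List I) (h : i + 1 < w.length) :
    (merge i w).length + 1 = w.length := by
  induction w generalizing i with
  | nil => simp at h
  | cons a w ih =>
    cases i with
    | zero =>
      cases w with
      | nil => simp at h
      | cons b w => simp [merge]
    | succ i => simpa [merge] using ih i (by simpa using h)

theorem delta_mem_forms [IsScalarTower k I I] [SMulCommClass k I I] {s : ℤ} {f : Fun k I}
    (hf : f ∈ forms k I s) : delta f ∈ forms k I (s + 1) := by
  refine ⟨delta_mem_multilinear hf.1, fun w hw => Finset.sum_eq_zero fun i hi => ?_⟩
  have h := length_merge i w (by simp at hi; omega)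
  rw [hf.2 _ (by omega), mul_zero]

/-- A factor of degree one reads exactly one letter, so the sum over all cuts of the word collapses
to a single term. -/
theorem mul_apply_cons_of_forms_one {f : Fun k I} (hf : f ∈ forms k I 1) (g : Fun k I) (a : I)
    (w : List I) : (f * g) (a :: w) = f [a] * g w := by
  have h : tail a f ∈ forms k I 0 := by simpa using tail_mem_forms hf a
  rw [mul_cons, hf.2 [] (by simp), mem_forms_zero h, fun_smul_mul, fun_one_mul]
  simp

theorem mul_apply_of_forms_two {f : Fun k I} (hf : f ∈ forms k I 2) (g : Fun k I) (a b : I)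
    (w : List I) : (f * g) (a :: b :: w) = f [a, b] * g w := by
  have h : tail a f ∈ forms k I 1 := by
    have := tail_mem_forms hf a
    norm_num at this
    exact this
  rw [mul_cons, hf.2 [] (by simp), mul_apply_cons_of_forms_one h]
  simp

end Forms

/-! ### Cochains with coefficients -/

section Coefficients

variable {k A : Type*} [Field k] [Ring A] [Algebra k A] {I : NonUnitalSubalgebra k A}

/-- The value at `c` of the differential of `F`. -/
def coeffDeltaFun (F : A →ₗ[k] Fun k I) (c : A) : Fun k I
  | [] => 0
  | a :: w => F (c * a) w - delta (F c) (a :: w)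

/-- The differential on linear maps from `A` to cochains, i.e. on linear forms on `A ⊗ I ^ ⊗ s`. -/
def coeffDelta : (A →ₗ[k] Fun k I) →ₗ[k] (A →ₗ[k] Fun k I) where
  toFun F :=
    { toFun := coeffDeltaFun F
      map_add' := fun c c' => by
        ext w
        cases w with
        | nil => simp [coeffDeltaFun]
        | cons a w => simp only [coeffDeltaFun, add_mul, map_add, delta_add, add_apply]; ring
      map_smul' := fun r c => by
        ext w
        cases w with
        | nil => simp [coeffDeltaFun]
        | cons a w =>
          simp only [coeffDeltaFun, smul_mul_assoc, map_smul, delta_smul, smul_apply,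
            RingHom.id_apply]
          ring }
  map_add' F F' := by
    ext c w
    change coeffDeltaFun (F + F') c w = coeffDeltaFun F c w + coeffDeltaFun F' c w
    cases w with
    | nil => simp [coeffDeltaFun]
    | cons a w => simp only [coeffDeltaFun, LinearMap.add_apply, delta_add, add_apply]; ring
  map_smul' r F := by
    ext c w
    change coeffDeltaFun (r • F) c w = r * coeffDeltaFun F c w
    cases w with
    | nil => simp [coeffDeltaFun]
    | cons a w => simp only [coeffDeltaFun, LinearMap.smul_apply, delta_smul, smul_apply]; ring

@[simp] theorem coeffDelta_nil (F : A →ₗ[k] Fun k I) (c : A) : coeffDelta F c [] = 0 := rfl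

theorem coeffDelta_cons (F : A →ₗ[k] Fun k I) (c : A) (a : I) (w : List I) :
    coeffDelta F c (a :: w) = F (c * a) w - delta (F c) (a :: w) := rfl

theorem tail_coeffDelta (F : A →ₗ[k] Fun k I) (c : A) (a : I) :
    tail a (coeffDelta F c) = F (c * a) - tail a (delta (F c)) := by
  ext w; simp [coeffDelta_cons, sub_eq_add_neg]

theorem coeffDelta_coeffDelta (F : A →ₗ[k] Fun k I) : coeffDelta (coeffDelta F) = 0 := by
  ext c w
  cases w with
  | nil => simp
  | cons a w =>
    cases w with
    | nil => simp [coeffDelta_cons]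
    | cons b w =>
      have h := congrArg (fun f : Fun k I => f (a :: b :: w)) (delta_delta (F c))
      simp only [delta_cons_cons (delta (F c)), zero_apply] at h
      rw [coeffDelta_cons, coeffDelta_cons, delta_cons_cons, tail_coeffDelta, delta_sub,
        coeffDelta_cons, sub_eq_add_neg (delta _), add_apply, neg_apply]
      simp only [NonUnitalSubalgebra.coe_mul, mul_assoc, LinearMap.zero_apply, zero_apply]
      linear_combination h

/-- The differential multiplies the coefficient on the right only, so left multiplication is a
cochain map. This lets `α` and `β` act in the periodicity argument. -/
theorem coeffDelta_comp_mulLeft (F : A →ₗ[k] Fun k I) (α : A) :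
    coeffDelta (F ∘ₗ LinearMap.mulLeft k α) = coeffDelta F ∘ₗ LinearMap.mulLeft k α := by
  ext c w
  cases w with
  | nil => simp
  | cons a w => simp [coeffDelta_cons, mul_assoc]

/-- Multiplies the values of a linear map by a cochain. -/
def mulRight (F : A →ₗ[k] Fun k I) (f : Fun k I) : A →ₗ[k] Fun k I :=
  LinearMap.mulRight k f ∘ₗ F

@[simp] theorem mulRight_apply (F : A →ₗ[k] Fun k I) (f : Fun k I) (c : A) :
    mulRight F f c = F c * f := rfl

theorem coeffDelta_mulRight (F : A →ₗ[k] Fun k I) {f : Fun k I} (hf : delta f = 0) :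
    coeffDelta (mulRight F f) = mulRight (coeffDelta F) f := by
  ext c w
  cases w with
  | nil => simp [mul_nil]
  | cons a w =>
    rw [coeffDelta_cons, mulRight_apply, mulRight_apply, mulRight_apply, mul_cons,
      tail_coeffDelta, delta_mul, hf, fun_mul_zero, add_zero, mul_cons, sub_mul]
    simp [sub_eq_add_neg]

/-- The linear map `c ↦ θ c • f`. -/
def scalarMap (θ : A →ₗ[k] k) (f : Fun k I) : A →ₗ[k] Fun k I := θ.smulRight f

@[simp] theorem scalarMap_apply (θ : A →ₗ[k] k) (f : Fun k I) (c : A) :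
    scalarMap θ f c = θ c • f := rfl

theorem mulRight_scalarMap (θ : A →ₗ[k] k) (f g : Fun k I) :
    mulRight (scalarMap θ f) g = scalarMap θ (f * g) := by
  ext c w
  rw [mulRight_apply, scalarMap_apply, scalarMap_apply, fun_smul_mul]

theorem coeffDelta_mem_forms {s : ℤ} {F : A →ₗ[k] Fun k I} (hF : ∀ c, F c ∈ forms k I s) (c : A) :
    coeffDelta F c ∈ forms k I (s + 1) := by
  have hδ := delta_mem_forms (hF c)
  refine ⟨⟨fun u v a b => ?_, fun u v r a => ?_⟩, fun w hw => ?_⟩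
  · cases u with
    | nil =>
      have h := hδ.1.1 [] v a b
      simp only [List.nil_append, coeffDelta_cons, NonUnitalSubalgebra.coe_add, mul_add, map_add,
        add_apply] at h ⊢
      rw [h]; ring
    | cons e u =>
      have h := hδ.1.1 (e :: u) v a b
      simp only [List.cons_append, coeffDelta_cons, (hF _).1.1] at h ⊢
      rw [h]; ring
  · cases u with
    | nil =>
      have h := hδ.1.2 [] v r a
      simp only [List.nil_append, coeffDelta_cons, NonUnitalSubalgebra.coe_smul, mul_smul_comm,
        map_smul, smul_apply] at h ⊢
      rw [h]; ring
    | cons e u =>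
      have h := hδ.1.2 (e :: u) v r a
      simp only [List.cons_append, coeffDelta_cons, (hF _).1.2] at h ⊢
      rw [h]; ring
  · cases w with
    | nil => rfl
    | cons a w =>
      rw [coeffDelta_cons, (hF _).2 w (by simp at hw; omega), hδ.2 _ hw, sub_zero]

variable {ε : A →ₐ[k] k}

/-- The term with coefficient `c * a` drops out because `ε` vanishes on `I`. -/
theorem coeffDelta_scalarMap (hI : ∀ a : A, a ∈ I ↔ ε a = 0) {f : Fun k I} (hf : delta f = 0) :
    coeffDelta (scalarMap ε.toLinearMap f) = 0 := by
  ext c w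
  cases w with
  | nil => simp
  | cons a w =>
    rw [coeffDelta_cons, scalarMap_apply, scalarMap_apply, delta_smul, hf]
    simp [(hI _).1 a.2]

/-- The projection onto the augmentation ideal. -/
def toAugIdeal (hI : ∀ a : A, a ∈ I ↔ ε a = 0) : A →ₗ[k] I where
  toFun c := ⟨c - algebraMap k A (ε c), (hI _).2 (by simp)⟩
  map_add' c c' := by ext; simp; abel
  map_smul' r c := by ext; simp [Algebra.smul_def, mul_sub]

theorem eq_algebraMap_add (hI : ∀ a : A, a ∈ I ↔ ε a = 0) (c : A) :
    c = ε c • (1 : A) + toAugIdeal hI c := by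
  simp [toAugIdeal, Algebra.algebraMap_eq_smul_one]

theorem toAugIdeal_coe (hI : ∀ a : A, a ∈ I ↔ ε a = 0) (a : I) : toAugIdeal hI a = a := by
  ext; simp [toAugIdeal, (hI _).1 a.2]

/-- Cochains with coefficients in the free module `A` are contractible. -/
theorem exists_coeffDelta_eq (hI : ∀ a : A, a ∈ I ↔ ε a = 0) {s : ℤ} (hs : s ≠ 0)
    {F : A →ₗ[k] Fun k I} (hF : ∀ c, F c ∈ forms k I s) (hd : coeffDelta F = 0) :
    ∃ G : A →ₗ[k] Fun k I, (∀ c, G c ∈ forms k I (s - 1)) ∧ coeffDelta G = F := by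
  have h1 := hF 1
  -- The contracting homotopy turns the coefficient, projected to `I`, into the first letter of a
  -- word for `F 1`.
  refine ⟨{ toFun := fun c => tail (toAugIdeal hI c) (F 1)
            map_add' := fun c c' => by rw [map_add, tail_add_left h1.1]
            map_smul' := fun r c => by rw [map_smul, tail_smul_left h1.1]; rfl },
    fun c => tail_mem_forms h1 _, ?_⟩
  -- The cocycle condition at the coefficient `1` expresses `F` on `I` through `F 1`.
  have key : ∀ (a : I) (w : List I), F (a : A) w = delta (F 1) (a :: w) := by
    intro a w
    have h := congrArg (fun E : A →ₗ[k] Fun k I => E 1 (a :: w)) hd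
    simp only [coeffDelta_cons, one_mul, LinearMap.zero_apply, zero_apply] at h
    exact sub_eq_zero.1 h
  ext c w
  cases w with
  | nil => rw [coeffDelta_nil, (hF c).2 [] (by simpa using hs.symm)]
  | cons a w =>
    have h2 : toAugIdeal hI (c * a) = ε c • a + toAugIdeal hI c * a := by
      have := congrArg (fun x : A => x * a) (eq_algebraMap_add hI c)
      simp only [add_mul, smul_mul_assoc, one_mul] at this
      rw [this, map_add, map_smul, toAugIdeal_coe, ← NonUnitalSubalgebra.coe_mul, toAugIdeal_coe]
    have h3 : F c (a :: w) = ε c * F 1 (a :: w) + delta (F 1) (toAugIdeal hI c :: a :: w) := by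
      conv_lhs => rw [eq_algebraMap_add hI c]
      rw [map_add, map_smul, add_apply, smul_apply, key]
    rw [coeffDelta_cons]
    simp only [LinearMap.coe_mk, AddHom.coe_mk]
    rw [h2, tail_add_left h1.1, tail_smul_left h1.1, h3, delta_cons_cons]
    simp only [add_apply, smul_apply, tail_apply]
    ring

/-- The cocycles with coefficients vanishing on `J` are spanned, up to coboundaries, by those
coming from the cocycles in `S`. -/
def Resolves (ε : A →ₐ[k] k) (J : Submodule k A) (S : ℤ → Submodule k (Fun k I)) : Prop :=
  ∀ (s : ℤ) (F : A →ₗ[k] Fun k I), (∀ c, F c ∈ forms k I s) → coeffDelta F = 0 →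
    (∀ c ∈ J, F c = 0) → ∃ f ∈ S s, ∃ G : A →ₗ[k] Fun k I, (∀ c, G c ∈ forms k I (s - 1)) ∧
      (∀ c ∈ J, G c = 0) ∧ F = scalarMap ε.toLinearMap f + coeffDelta G

/-- The base of the periodicity argument: with coefficients dual to all of `A` only the class of `1`
survives. In degree zero a cocycle vanishes on `I`, hence is a multiple of `ε`; the other degrees
are contractible. -/
theorem resolves_bot (hI : ∀ a : A, a ∈ I ↔ ε a = 0) (S : ℤ → Submodule k (Fun k I))
    (hS : 1 ∈ S 0) : Resolves ε ⊥ S := by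
  intro s F hF hd _
  by_cases hs : s = 0
  · subst hs
    refine ⟨F 1 [] • 1, Submodule.smul_mem _ _ hS, 0, fun c => zero_mem _, fun c _ => rfl, ?_⟩
    have h1 : ∀ a : I, F (a : A) [] = 0 := by
      intro a
      have h := congrArg (fun E : A →ₗ[k] Fun k I => E 1 [a]) hd
      simpa [coeffDelta_cons] using h
    ext c w
    rw [map_zero, add_zero, mem_forms_zero (hF c), scalarMap_apply]
    conv_lhs => rw [eq_algebraMap_add hI c]
    simp [h1, mul_assoc]
  · obtain ⟨G, hG, h⟩ := exists_coeffDelta_eq hI hs hF hd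
    refine ⟨0, zero_mem _, G, hG, by simp, ?_⟩
    rw [h]; ext c w; simp

theorem coeffDelta_eq_zero_of_mem {J : Submodule k A} (hJ : ∀ c ∈ J, ∀ a : A, c * a ∈ J)
    {F : A →ₗ[k] Fun k I} (hF : ∀ c ∈ J, F c = 0) : ∀ c ∈ J, coeffDelta F c = 0 := by
  intro c hc
  ext w
  cases w with
  | nil => rfl
  | cons a w => rw [coeffDelta_cons, hF _ (hJ c hc a), hF c hc]; simp

/-- Periodicity: from coefficients vanishing on `J` to coefficients vanishing on `J + α A`. -/
theorem Resolves.step {J J' : Submodule k A} {α β : A}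
    {S S' : ℤ → Submodule k (Fun k I)} (hR : Resolves ε J S)
    (hJ : ∀ c ∈ J, ∀ a : A, c * a ∈ J)
    (hJI : ∀ c ∈ J', ε c = 0)
    (hJJ' : J ≤ J') (hα : ∀ c ∈ J, α * c ∈ J) (hβ : ∀ c ∈ J, β * c ∈ J)
    (hεβ : ε β = 0)
    (hαβ : ∀ c, α * (β * c) ∈ J) (hβα : ∀ c, β * (α * c) ∈ J)
    (hαJ' : ∀ c, α * c ∈ J')
    (hJ'mem : ∀ c ∈ J', ∃ j ∈ J, ∃ a, c = j + α * a)
    {σ τ : A →ₗ[k] A} (hσ : ∀ c, σ (β * c) - c ∈ J') (hσJ : ∀ c ∈ J, σ c ∈ J')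
    (hτ : ∀ c, ∃ j ∈ J, ∃ a, τ (α * c) - c = j + β * a) (hτJ : ∀ c ∈ J, τ c ∈ J)
    {X Hu : A →ₗ[k] k} (hXJ : ∀ c ∈ J, X c = 0) (hXα : ∀ c, X (α * c) = ε c)
    {x u : Fun k I} (hx : coeffDelta (scalarMap X 1) = scalarMap ε.toLinearMap x)
    (hHJ : ∀ c ∈ J, Hu c = 0) (hHβ : ∀ c, Hu (β * c) = ε c)
    {Gu : A →ₗ[k] Fun k I} (hGu : ∀ c, Gu c ∈ forms k I 1) (hGJ : ∀ c ∈ J, Gu c = 0)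
    (hGα : ∀ c, Gu (α * c) = coeffDelta (scalarMap Hu 1) c)
    (hu : coeffDelta Gu = scalarMap ε.toLinearMap u)
    (hS : ∀ s, ∀ f ∈ S s, f ∈ forms k I s ∧ delta f = 0)
    (hS' : ∀ s, ∀ f ∈ S' s, f ∈ forms k I s ∧ delta f = 0)
    (h0 : ∀ s, S s ≤ S' s) (h1 : ∀ s, ∀ f ∈ S s, x * f ∈ S' (s + 1))
    (h2 : ∀ s, ∀ f ∈ S' s, u * f ∈ S' (s + 2)) :
    Resolves ε J' S' := by
  -- One round of the argument lowers the degree by two, so the induction bounds an integer degree;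
  -- in negative degrees all cochains are zero.
  suffices H : ∀ (N : ℕ) (s : ℤ), s < N → ∀ F : A →ₗ[k] Fun k I, (∀ c, F c ∈ forms k I s) →
      coeffDelta F = 0 → (∀ c ∈ J', F c = 0) → ∃ f ∈ S' s, ∃ G : A →ₗ[k] Fun k I,
        (∀ c, G c ∈ forms k I (s - 1)) ∧ (∀ c ∈ J', G c = 0) ∧
        F = scalarMap ε.toLinearMap f + coeffDelta G from
    fun s F => H (s.toNat + 1) s (by omega) F
  intro N
  induction N with
  | zero =>
    intro s hs F hF _ _
    refine ⟨0, zero_mem _, 0, fun c => zero_mem _, fun c _ => rfl, ?_⟩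
    ext c w
    simp [forms_eq_zero (by exact_mod_cast hs) (hF c)]
  | succ N ih =>
    intro s hs F hF hdF hFJ
    obtain ⟨f₀, hf₀, G, hG, hGJ0, hFG⟩ := hR s F hF hdF fun c hc => hFJ c (hJJ' hc)
    -- Both `F` and `ε` vanish on `αA`, so `G` composed with multiplication by `α` is again a
    -- cocycle.
    have hG' : coeffDelta (G ∘ₗ LinearMap.mulLeft k α) = 0 := by
      rw [coeffDelta_comp_mulLeft]
      ext c w
      have h := congrArg (fun E : A →ₗ[k] Fun k I => E (α * c) w) hFG
      simpa [hFJ _ (hαJ' c), hJI _ (hαJ' c)] using h.symm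
    obtain ⟨f₁, hf₁, H, hH, hHJ0, hGH⟩ := hR (s - 1) (G ∘ₗ LinearMap.mulLeft k α)
      (fun c => hG _) hG' (fun c hc => hGJ0 _ (hα c hc))
    -- As `αβA` lies in `J` and `ε β = 0`, composing `H` with `β` gives a cocycle; it has degree `s
    -- - 2` and vanishes on `J'`, so the induction applies.
    have hH' : coeffDelta (H ∘ₗ LinearMap.mulLeft k β) = 0 := by
      rw [coeffDelta_comp_mulLeft]
      ext c w
      have h := congrArg (fun E : A →ₗ[k] Fun k I => E (β * c) w) hGH
      simpa [hGJ0 _ (hαβ c), hεβ] using h.symm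
    have hHJ' : ∀ c ∈ J', H (β * c) = 0 := by
      intro c hc
      obtain ⟨j, hj, a, rfl⟩ := hJ'mem c hc
      rw [mul_add, map_add, hHJ0 _ (hβ j hj), hHJ0 _ (hβα a), add_zero]
    obtain ⟨f₂, hf₂, M, hM, hMJ, hHM⟩ := ih (s - 1 - 1) (by push_cast at hs; omega)
      (H ∘ₗ LinearMap.mulLeft k β) (fun c => hH _) hH' hHJ'
    have hf₀' := hS _ _ hf₀
    have hf₁' := hS _ _ hf₁
    have hf₂' := hS' _ _ hf₂
    -- correct `H` so that it vanishes on `J + β A`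
    set H₁ : A →ₗ[k] Fun k I := H - coeffDelta (M ∘ₗ σ) - mulRight (scalarMap Hu 1) f₂ with hH₁
    -- `σ` divides by `β` up to `J'`, where `M` vanishes, so `M ∘ σ` extends `M` along
    -- multiplication by `β`.
    have hMσ : coeffDelta (M ∘ₗ σ) ∘ₗ LinearMap.mulLeft k β = coeffDelta M := by
      rw [← coeffDelta_comp_mulLeft]
      congr 1
      ext c w
      have h : M (σ (β * c) - c) = 0 := hMJ _ (hσ c)
      rw [map_sub, sub_eq_zero] at h
      simp [h]
    have hH₁f : ∀ c, H₁ c ∈ forms k I (s - 1 - 1) := by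
      intro c
      have e1 : coeffDelta (M ∘ₗ σ) c ∈ forms k I (s - 1 - 1) := by
        have := coeffDelta_mem_forms (F := M ∘ₗ σ) (fun c => hM (σ c)) c
        rwa [sub_add_cancel] at this
      have e2 : mulRight (scalarMap Hu 1) f₂ c ∈ forms k I (s - 1 - 1) := by
        have := mul_mem_forms (Submodule.smul_mem _ (Hu c) (one_mem_forms (k := k) (I := I)))
          hf₂'.1
        rwa [zero_add] at this
      exact sub_mem (sub_mem (hH c) e1) e2
    have hH₁J : ∀ c ∈ J, H₁ c = 0 := by
      intro c hc
      have e1 := coeffDelta_eq_zero_of_mem (F := M ∘ₗ σ) hJ (fun c hc => hMJ _ (hσJ c hc)) c hc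
      simp [hH₁, hHJ0 c hc, hHJ c hc, e1]
    have hH₁β : ∀ c, H₁ (β * c) = 0 := by
      intro c
      have e1 : coeffDelta (M ∘ₗ σ) (β * c) = coeffDelta M c :=
        congrArg (fun E : A →ₗ[k] Fun k I => E c) hMσ
      have e2 : H (β * c) = _ := congrArg (fun E : A →ₗ[k] Fun k I => E c) hHM
      rw [hH₁, LinearMap.sub_apply, LinearMap.sub_apply, e1, e2, mulRight_apply, scalarMap_apply,
        hHβ, fun_smul_mul, fun_one_mul]
      simp
    have hdH₁ : coeffDelta H₁ = G ∘ₗ LinearMap.mulLeft k α - scalarMap ε.toLinearMap f₁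
        - mulRight (coeffDelta (scalarMap Hu 1)) f₂ := by
      rw [hH₁, map_sub, map_sub, coeffDelta_coeffDelta, coeffDelta_mulRight _ hf₂'.2, hGH]
      abel
    -- correct `G` so that it vanishes on `J + α A`
    set G₁ : A →ₗ[k] Fun k I :=
      G - coeffDelta (H₁ ∘ₗ τ) - scalarMap X f₁ - mulRight Gu f₂ with hG₁
    -- `τ` divides by `α` up to `J + βA`, which is exactly where the corrected `H₁` vanishes.
    have hτα : coeffDelta (H₁ ∘ₗ τ) ∘ₗ LinearMap.mulLeft k α = coeffDelta H₁ := by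
      rw [← coeffDelta_comp_mulLeft]
      congr 1
      ext c w
      obtain ⟨j, hj, a, h⟩ := hτ c
      have h' : H₁ (τ (α * c) - c) = 0 := by rw [h, map_add, hH₁J j hj, hH₁β, add_zero]
      rw [map_sub, sub_eq_zero] at h'
      simp [h']
    have hG₁f : ∀ c, G₁ c ∈ forms k I (s - 1) := by
      intro c
      have e1 : coeffDelta (H₁ ∘ₗ τ) c ∈ forms k I (s - 1) := by
        have := coeffDelta_mem_forms (F := H₁ ∘ₗ τ) (fun c => hH₁f (τ c)) c
        rwa [sub_add_cancel] at this
      have e2 : mulRight Gu f₂ c ∈ forms k I (s - 1) := by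
        have := mul_mem_forms (hGu c) hf₂'.1
        rwa [add_sub_cancel] at this
      exact sub_mem (sub_mem (sub_mem (hG c) e1) (Submodule.smul_mem _ _ hf₁'.1)) e2
    have hG₁J' : ∀ c ∈ J', G₁ c = 0 := by
      intro c hc
      obtain ⟨j, hj, a, rfl⟩ := hJ'mem c hc
      have e1 := coeffDelta_eq_zero_of_mem (F := H₁ ∘ₗ τ) hJ
        (fun c hc => hH₁J _ (hτJ c hc)) j hj
      have e2 : coeffDelta (H₁ ∘ₗ τ) (α * a) = coeffDelta H₁ a :=
        congrArg (fun E : A →ₗ[k] Fun k I => E a) hτα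
      have e3 : G₁ j = 0 := by
        simp [hG₁, hGJ0 j hj, hXJ j hj, hGJ j hj, e1]
      rw [map_add, e3, zero_add, hG₁]
      simp only [LinearMap.sub_apply, e2, hdH₁, scalarMap_apply, mulRight_apply, hXα, hGα,
        LinearMap.comp_apply, LinearMap.mulLeft_apply, AlgHom.toLinearMap_apply]
      abel
    -- The factors `x` and `u` come from the differentials of the two terms with `X` and `Gu`
    -- subtracted in `G₁`.
    refine ⟨f₀ + x * f₁ + u * f₂, ?_, G₁, hG₁f, hG₁J', ?_⟩
    · refine add_mem (add_mem (h0 _ hf₀) ?_) ?_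
      · simpa using h1 _ _ hf₁
      · have := h2 _ _ hf₂
        rwa [show s - 1 - 1 + 2 = s by ring] at this
    · have e1 : scalarMap X f₁ = mulRight (scalarMap X (1 : Fun k I)) f₁ := by
        rw [mulRight_scalarMap, one_mul]
      rw [hG₁, map_sub, map_sub, map_sub, coeffDelta_coeffDelta, e1, coeffDelta_mulRight _ hf₁'.2,
        coeffDelta_mulRight _ hf₂'.2, hx, hu, mulRight_scalarMap, mulRight_scalarMap, hFG]
      ext c w
      simp only [scalarMap_apply, LinearMap.add_apply, LinearMap.sub_apply, add_apply, smul_apply,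
        sub_apply, LinearMap.zero_apply, zero_apply]
      simp only [mul_add, AlgHom.toLinearMap_apply]
      ring

/-- Coefficients vanishing on the augmentation ideal are cochains. -/
theorem Resolves.exists_sub_delta (hI : ∀ a : A, a ∈ I ↔ ε a = 0) {J : Submodule k A}
    (hJ : ∀ c, ε c = 0 → c ∈ J) (hJI : ∀ c ∈ J, ε c = 0) {S : ℤ → Submodule k (Fun k I)}
    (hR : Resolves ε J S)
    {s : ℤ} {f : Fun k I} (hf : f ∈ forms k I s) (hd : delta f = 0) :
    ∃ f' ∈ S s, ∃ g ∈ forms k I (s - 1), f = f' + delta g := by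
  obtain ⟨f', hf', G, hG, hGJ, h⟩ := hR s (scalarMap ε.toLinearMap f)
    (fun c => Submodule.smul_mem _ _ hf) (coeffDelta_scalarMap hI hd)
    (fun c hc => by simp [hJI c hc])
  -- Since `G` vanishes on `I`, its differential at the coefficient `1` is `-δ (G 1)`.
  refine ⟨f', hf', -G 1, neg_mem (hG 1), ?_⟩
  ext w
  have h' := congrArg (fun E : A →ₗ[k] Fun k I => E 1 w) h
  have hn : delta (-G 1) = -delta (G 1) := by
    have := delta_smul (-1 : k) (G 1)
    simpa using this
  simp only [LinearMap.add_apply, scalarMap_apply, AlgHom.toLinearMap_apply, map_one, one_smul,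
    add_apply] at h'
  rw [h', hn, add_apply, neg_apply]
  cases w with
  | nil => simp
  | cons a w =>
    rw [coeffDelta_cons, one_mul, hGJ _ (hJ _ ((hI _).1 a.2))]
    simp [sub_eq_add_neg]

end Coefficients

/-! ### Shuffles -/

section Shuffle

variable {k I : Type*} [Field k]

/-- The value of a cochain on the signed shuffle product of two words. -/
def shuffle : List I → List I → Fun k I → k
  | [], v, f => f v
  | a :: u, [], f => f (a :: u)
  | a :: u, b :: v, f =>
    shuffle u (b :: v) (tail a f) + (-1) ^ (u.length + 1) * shuffle (a :: u) v (tail b f)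
termination_by u v => u.length + v.length

@[simp] theorem shuffle_nil_left (v : List I) (f : Fun k I) : shuffle [] v f = f v := by
  simp [shuffle]

@[simp] theorem shuffle_nil_right (u : List I) (f : Fun k I) : shuffle u [] f = f u := by
  cases u <;> simp [shuffle]

theorem shuffle_cons_cons (a b : I) (u v : List I) (f : Fun k I) :
    shuffle (a :: u) (b :: v) f = shuffle u (b :: v) (tail a f) +
      (-1) ^ (u.length + 1) * shuffle (a :: u) v (tail b f) := by
  rw [shuffle]

theorem shuffle_add (u v : List I) (f g : Fun k I) :
    shuffle u v (f + g) = shuffle u v f + shuffle u v g := by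
  induction u generalizing v f g with
  | nil => simp
  | cons a u ihu =>
    induction v generalizing f g with
    | nil => simp
    | cons b v ihv =>
      have h : ∀ c : I, tail c (f + g) = tail c f + tail c g := fun c => rfl
      simp only [shuffle_cons_cons, h, ihu, ihv]
      ring

theorem shuffle_smul (u v : List I) (r : k) (f : Fun k I) :
    shuffle u v (r • f) = r * shuffle u v f := by
  induction u generalizing v f with
  | nil => simp
  | cons a u ihu =>
    induction v generalizing f with
    | nil => simp
    | cons b v ihv =>
      have h : ∀ c : I, tail c (r • f) = r • tail c f := fun c => rfl
      simp only [shuffle_cons_cons, h, ihu, ihv]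
      ring

theorem shuffle_sub (u v : List I) (f g : Fun k I) :
    shuffle u v (f - g) = shuffle u v f - shuffle u v g := by
  have h : f - g = f + (-1 : k) • g := by ext w; simp [sub_eq_add_neg]
  rw [h, shuffle_add, shuffle_smul]; ring

theorem shuffle_zero (u v : List I) : shuffle u v (0 : Fun k I) = 0 := by
  simpa using shuffle_smul u v (0 : k) 0

theorem shuffle_comm (u v : List I) (f : Fun k I) :
    shuffle v u f = (-1) ^ (u.length * v.length) * shuffle u v f := by
  induction u generalizing v f with
  | nil => simp
  | cons a u ihu =>
    induction v generalizing f with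
    | nil => simp
    | cons b v ihv =>
      rw [shuffle_cons_cons, shuffle_cons_cons, ihu, ihv]
      simp only [List.length_cons, pow_add, mul_add, add_mul, one_mul, mul_one, pow_one]
      have h : ∀ n : ℕ, ((-1 : k) ^ n) * (-1) ^ n = 1 := fun n => by
        rw [← pow_add, ← two_mul]; simp
      linear_combination (-1 : k) ^ (v.length) * (-1) ^ (u.length * v.length) *
        shuffle (a :: u) v (tail b f) * (-1) * h u.length

/-- A cochain that vanishes on all words containing the letter `c`. -/
def Kills (c : I) (f : Fun k I) : Prop := ∀ u v : List I, f (u ++ c :: v) = 0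

theorem Kills.tail_eq_zero {c : I} {f : Fun k I} (hf : Kills c f) : tail c f = 0 := by
  ext w; exact hf [] w

theorem Kills.tail {c : I} {f : Fun k I} (hf : Kills c f) (a : I) : Kills c (tail a f) :=
  fun u v => hf (a :: u) v

theorem Kills.mul {c : I} {f g : Fun k I} (hf : Kills c f) (hg : Kills c g) : Kills c (f * g) := by
  intro u v
  induction u generalizing f with
  | nil =>
    have h : f [] * g (c :: v) = 0 := by rw [show g (c :: v) = 0 from hg [] v, mul_zero]
    simp [mul_cons, hf.tail_eq_zero, h]
  | cons a u ih =>
    rw [List.cons_append, mul_cons, ih (hf.tail a),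
      show g (a :: (u ++ c :: v)) = 0 from hg (a :: u) v]
    simp

theorem kills_one (c : I) : Kills c (1 : Fun k I) := fun u v => by simp [one_apply]

/-- `f` reads an initial segment and tolerates no letter of `v`; `g` reads the rest and tolerates no
letter of `u`. Among all shuffles only `u` followed by `v` survives, and its sign is `+1`. -/
theorem shuffle_mul {u v : List I} {f g : Fun k I} (hf : ∀ c ∈ v, Kills c f)
    (hg : ∀ c ∈ u, Kills c g) : shuffle u v (f * g) = f u * g v := by
  induction u generalizing v f g with
  | nil =>
    cases v with
    | nil => simp [mul_nil]
    | cons b v => simp [mul_cons, (hf b (by simp)).tail_eq_zero]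
  | cons a u ihu =>
    have hga := (hg a (by simp)).tail_eq_zero
    induction v generalizing f g with
    | nil =>
      have := ihu (f := tail a f) (g := g) (v := []) (by simp) (fun c hc => hg c (by simp [hc]))
      simp only [shuffle_nil_right, tail_apply] at this ⊢
      rw [mul_cons, this, show g (a :: u) = 0 from hg a (by simp) [] u]
      simp
    | cons b v ihv =>
      rw [shuffle_cons_cons, tail_mul, tail_mul, hga, (hf b (by simp)).tail_eq_zero,
        fun_zero_mul, smul_zero, zero_add, add_zero,
        ihu (fun c hc => (hf c hc).tail a) (fun c hc => hg c (by simp [hc])), shuffle_smul]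
      -- If the first letter comes from `v`, then `f` has to read the empty word and `g` meets the
      -- letter `a`. The induction hypothesis with `f` replaced by `1` shows that these terms
      -- vanish.
      have h := ihv (f := 1) (g := tail b g) (fun c _ => kills_one c)
        (fun c hc => (hg c hc).tail b) ((hg a (by simp)).tail b).tail_eq_zero
      rw [one_mul] at h
      rw [h]
      simp [one_apply]

variable [NonUnitalRing I] [Module k I]

/-- Within its own word `a` annihilates the letter that follows it, so it can only merge with the
first letter of the other word. -/
theorem shuffle_mergeHead_right {a b : I} {u v : List I} {f : Fun k I} (hf : f ∈ multilinear k I)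
    (hu : (a :: u).IsChain fun x y => x * y = 0) :
    shuffle u (b :: v) (mergeHead a f) = (-1) ^ u.length * shuffle u v (tail (a * b) f) := by
  cases u with
  | nil => simp
  | cons c u =>
    have h1 : tail c (mergeHead a f) = 0 := by
      rw [show tail c (mergeHead a f) = tail (a * c) f from rfl,
        (List.isChain_cons_cons.1 hu).1, tail_zero_left hf]
    rw [shuffle_cons_cons, h1, shuffle_zero, zero_add]
    rfl

theorem shuffle_mergeHead_left {a b : I} {u v : List I} {f : Fun k I} (hf : f ∈ multilinear k I)
    (hv : (b :: v).IsChain fun x y => x * y = 0) :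
    shuffle (a :: u) v (mergeHead b f) = shuffle u v (tail (b * a) f) := by
  cases v with
  | nil => simp
  | cons c v =>
    have h1 : tail c (mergeHead b f) = 0 := by
      rw [show tail c (mergeHead b f) = tail (b * c) f from rfl,
        (List.isChain_cons_cons.1 hv).1, tail_zero_left hf]
    rw [shuffle_cons_cons, h1, shuffle_zero, mul_zero, add_zero]
    rfl

theorem delta_apply_of_isChain {u : List I} (hu : u.IsChain fun x y => x * y = 0) {f : Fun k I}
    (hf : f ∈ multilinear k I) : delta f u = 0 := by
  induction u generalizing f with
  | nil => simp
  | cons a u ih =>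
    cases u with
    | nil => simp
    | cons b u =>
      have h := List.isChain_cons_cons.1 hu
      rw [delta_cons_cons, h.1, ih h.2 (tail_mem_multilinear hf a),
        show f (0 :: u) = 0 from congrFun (tail_zero_left hf) u, sub_zero]

/-- The shuffle product of two cycles is a cycle. -/
theorem shuffle_delta (hcomm : ∀ x y : I, x * y = y * x) {u v : List I}
    (hu : u.IsChain fun x y => x * y = 0) (hv : v.IsChain fun x y => x * y = 0) {f : Fun k I}
    (hf : f ∈ multilinear k I) : shuffle u v (delta f) = 0 := by
  induction u generalizing v f with
  | nil => simpa using delta_apply_of_isChain hv hf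
  | cons a u ihu =>
    induction v generalizing f with
    | nil => simpa using delta_apply_of_isChain hu hf
    | cons b v ihv =>
      -- Only the terms that merge `a` with `b`, in either order, remain; their signs are opposite
      -- and they cancel by commutativity.
      rw [shuffle_cons_cons, tail_delta, tail_delta, shuffle_sub, shuffle_sub,
        ihu hu.tail hv (tail_mem_multilinear hf a), ihv hv.tail (tail_mem_multilinear hf b),
        shuffle_mergeHead_right hf hu, shuffle_mergeHead_left hf hv, hcomm b a]
      ring

end Shuffle

/-! ### Truncated polynomial algebras on two generators -/

/-- A presentation of `A` as the truncated polynomial algebra `k[X, Y] / (X ^ a, Y ^ b)`, with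
augmentation `ε` and augmentation ideal `I`. -/
structure Truncated {k A : Type*} [Field k] [Ring A] [Algebra k A]
    (I : NonUnitalSubalgebra k A) where
  ε : A →ₐ[k] k
  mem_iff : ∀ c : A, c ∈ I ↔ ε c = 0
  commutes : ∀ c c' : A, c * c' = c' * c
  a : ℕ
  b : ℕ
  three_le_a : 3 ≤ a
  three_le_b : 3 ≤ b
  X : I
  Y : I
  basis : Module.Basis (Fin a × Fin b) k A
  basis_apply : ∀ i j, basis (i, j) = (X : A) ^ (i : ℕ) * (Y : A) ^ (j : ℕ)
  X_pow : (X : A) ^ a = 0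
  Y_pow : (Y : A) ^ b = 0

namespace Truncated

variable {k A : Type*} [Field k] [Ring A] [Algebra k A] {I : NonUnitalSubalgebra k A}
  (T : Truncated I)

/-- Exchanges the two generators. -/
noncomputable def swap : Truncated I where
  ε := T.ε
  mem_iff := T.mem_iff
  commutes := T.commutes
  a := T.b
  b := T.a
  three_le_a := T.three_le_b
  three_le_b := T.three_le_a
  X := T.Y
  Y := T.X
  basis := T.basis.reindex (Equiv.prodComm _ _)
  basis_apply i j := by simp [T.basis_apply, T.commutes ((T.X : A) ^ (j : ℕ))]
  X_pow := T.Y_pow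
  Y_pow := T.X_pow

theorem induction {P : A → Prop}
    (hmon : ∀ i < T.a, ∀ j < T.b, P ((T.X : A) ^ i * (T.Y : A) ^ j))
    (hadd : ∀ c c', P c → P c' → P (c + c')) (hsmul : ∀ (r : k) (c : A), P c → P (r • c))
    (c : A) : P c := by
  have hc : c ∈ Submodule.span k (Set.range T.basis) := T.basis.mem_span c
  have h0 : P 0 := by
    simpa using hsmul 0 _ (hmon 0 (by have := T.three_le_a; omega) 0
      (by have := T.three_le_b; omega))
  induction hc using Submodule.span_induction with
  | mem x hx =>
    obtain ⟨⟨i, j⟩, rfl⟩ := hx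
    rw [T.basis_apply]
    exact hmon i i.2 j j.2
  | zero => exact h0
  | add x y _ _ hx hy => exact hadd _ _ hx hy
  | smul r x _ hx => exact hsmul _ _ hx

theorem ε_X : T.ε T.X = 0 := (T.mem_iff _).1 T.X.2

theorem ε_Y : T.ε T.Y = 0 := (T.mem_iff _).1 T.Y.2

/-- The coefficient of `X ^ i`. -/
noncomputable def coeffX (i : ℕ) : A →ₗ[k] k :=
  if h : i < T.a then T.basis.coord (⟨i, h⟩, ⟨0, by have := T.three_le_b; omega⟩) else 0

theorem coeffX_of_le {i : ℕ} (h : T.a ≤ i) : T.coeffX i = 0 := by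
  simp [coeffX, not_lt.2 h]

theorem coeffX_monomial {i : ℕ} (hi : i < T.a) (m n : ℕ) :
    T.coeffX i ((T.X : A) ^ m * (T.Y : A) ^ n) = if m = i ∧ n = 0 then 1 else 0 := by
  by_cases hm : m < T.a
  · by_cases hn : n < T.b
    · have h := T.basis_apply ⟨m, hm⟩ ⟨n, hn⟩
      simp only at h
      rw [← h, coeffX, dif_pos hi, Module.Basis.coord_apply, Module.Basis.repr_self,
        Finsupp.single_apply]
      simp
    · have h : (T.Y : A) ^ n = 0 := pow_eq_zero_of_le (not_lt.1 hn) T.Y_pow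
      rw [h, mul_zero, map_zero, if_neg]
      have := T.three_le_b
      omega
  · have h : (T.X : A) ^ m = 0 := pow_eq_zero_of_le (not_lt.1 hm) T.X_pow
    rw [h, zero_mul, map_zero, if_neg]
    omega

theorem coeffX_zero (c : A) : T.coeffX 0 c = T.ε c := by
  induction c using T.induction with
  | hmon i hi j hj =>
    rw [T.coeffX_monomial (by omega)]
    simp only [map_mul, map_pow, T.ε_X, T.ε_Y, zero_pow_eq]
    by_cases h1 : i = 0 <;> by_cases h2 : j = 0 <;> simp [h1, h2]
  | hadd c c' h h' => rw [map_add, map_add, h, h']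
  | hsmul r c h => rw [map_smul, map_smul, h]

theorem X_mul_monomial (m n : ℕ) :
    (T.X : A) * ((T.X : A) ^ m * (T.Y : A) ^ n) = (T.X : A) ^ (m + 1) * (T.Y : A) ^ n := by
  rw [← mul_assoc, pow_succ']

theorem Y_mul_monomial (m n : ℕ) :
    (T.Y : A) * ((T.X : A) ^ m * (T.Y : A) ^ n) = (T.X : A) ^ m * (T.Y : A) ^ (n + 1) := by
  rw [← mul_assoc, T.commutes T.Y, mul_assoc, pow_succ']

theorem coeffX_X_mul {i : ℕ} (hi : i + 1 < T.a) (c : A) :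
    T.coeffX (i + 1) (T.X * c) = T.coeffX i c := by
  induction c using T.induction with
  | hmon m _ n _ =>
    rw [T.X_mul_monomial, T.coeffX_monomial hi, T.coeffX_monomial (by omega)]
    simp
  | hadd c c' h h' => rw [mul_add, map_add, map_add, h, h']
  | hsmul r c h => rw [mul_smul_comm, map_smul, map_smul, h]

theorem coeffX_Y_mul (i : ℕ) (c : A) : T.coeffX i (T.Y * c) = 0 := by
  by_cases hi : i < T.a
  · induction c using T.induction with
    | hmon m _ n _ =>
      rw [T.Y_mul_monomial, T.coeffX_monomial hi]
      simp
    | hadd c c' h h' => rw [mul_add, map_add, h, h', add_zero]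
    | hsmul r c h => rw [mul_smul_comm, map_smul, h, smul_zero]
  · rw [T.coeffX_of_le (not_lt.1 hi), LinearMap.zero_apply]

theorem coeffX_X_pow_mul (c : A) : T.coeffX (T.a - 1) ((T.X : A) ^ (T.a - 1) * c) = T.ε c := by
  suffices h : ∀ i < T.a, T.coeffX i ((T.X : A) ^ i * c) = T.ε c from
    h _ (by have := T.three_le_a; omega)
  intro i
  induction i with
  | zero => intro _; simp [coeffX_zero]
  | succ i ih => intro hi; rw [pow_succ', mul_assoc, T.coeffX_X_mul hi, ih (by omega)]

/-- Every element is a constant plus a multiple of `X` plus a multiple of `Y`. -/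
theorem exists_eq (c : A) : ∃ r s : A, c = T.ε c • 1 + T.X * r + T.Y * s := by
  induction c using T.induction with
  | hmon i hi j hj =>
    rcases i with _ | i
    · rcases j with _ | j
      · exact ⟨0, 0, by simp⟩
      · exact ⟨0, (T.Y : A) ^ j, by simp [T.ε_Y, pow_succ']⟩
    · exact ⟨(T.X : A) ^ i * (T.Y : A) ^ j, 0, by simp [T.ε_X, T.X_mul_monomial]⟩
  | hadd c c' h h' =>
    obtain ⟨r, s, h⟩ := h
    obtain ⟨r', s', h'⟩ := h'
    refine ⟨r + r', s + s', ?_⟩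
    conv_lhs => rw [h, h']
    rw [map_add, mul_add, mul_add, add_smul]
    abel
  | hsmul t c h =>
    obtain ⟨r, s, h⟩ := h
    refine ⟨t • r, t • s, ?_⟩
    conv_lhs => rw [h]
    rw [map_smul, mul_smul_comm, mul_smul_comm, smul_add, smul_add, smul_assoc]

/-- The coefficients of pure powers of `X` describe an element modulo `Y`, where multiplication is
that of truncated polynomials in `X`. The induction peels one factor `X` off `c`. -/
theorem coeffX_mul {i : ℕ} (hi : i < T.a) (c c' : A) :
    T.coeffX i (c * c') =
      ∑ x ∈ Finset.HasAntidiagonal.antidiagonal i, T.coeffX x.1 c * T.coeffX x.2 c' := by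
  induction i generalizing c with
  | zero => simp [coeffX_zero]
  | succ i ih =>
    obtain ⟨r, s, h⟩ := T.exists_eq c
    have h1 : ∀ n, T.coeffX n (1 : A) = if n = 0 then 1 else 0 := by
      intro n
      by_cases hn : n < T.a
      · have := T.coeffX_monomial hn 0 0
        simp only [pow_zero, mul_one] at this
        rw [this]; simp [eq_comm]
      · rw [T.coeffX_of_le (not_lt.1 hn), LinearMap.zero_apply, if_neg (by omega)]
    have h2 : ∀ n, n + 1 < T.a → T.coeffX (n + 1) c = T.coeffX n r := by
      intro n hn
      conv_lhs => rw [h]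
      simp [h1, T.coeffX_X_mul hn, T.coeffX_Y_mul]
    rw [Finset.Nat.antidiagonal_succ, Finset.sum_cons, Finset.sum_map]
    conv_lhs => rw [h, add_mul, add_mul, mul_assoc, mul_assoc, map_add, map_add, T.coeffX_X_mul hi,
      T.coeffX_Y_mul, add_zero, smul_one_mul, map_smul, ih (by omega)]
    simp only [coeffX_zero, smul_eq_mul, add_right_inj]
    refine Finset.sum_congr rfl fun x hx => ?_
    have hx' := Finset.HasAntidiagonal.mem_antidiagonal.1 hx
    simp only [Function.Embedding.prodMap, Function.Embedding.coeFn_mk, Prod.map_fst, Prod.map_snd,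
      Nat.succ_eq_add_one, Function.Embedding.refl_apply]
    rw [h2 _ (by omega)]

/-- Division by `X`. -/
noncomputable def divX : A →ₗ[k] A :=
  T.basis.constr k fun x =>
    if (x.1 : ℕ) = 0 then 0 else (T.X : A) ^ ((x.1 : ℕ) - 1) * T.Y ^ (x.2 : ℕ)

theorem divX_monomial {m : ℕ} (hm : m < T.a) (n : ℕ) :
    T.divX ((T.X : A) ^ m * (T.Y : A) ^ n) =
      if m = 0 then 0 else (T.X : A) ^ (m - 1) * (T.Y : A) ^ n := by
  by_cases hn : n < T.b
  · have h := T.basis_apply ⟨m, hm⟩ ⟨n, hn⟩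
    simp only at h
    rw [← h, divX, Module.Basis.constr_basis]
  · have h : (T.Y : A) ^ n = 0 := pow_eq_zero_of_le (not_lt.1 hn) T.Y_pow
    simp [h]

/-- Division by `X ^ (a - 1)`. -/
noncomputable def divTop : A →ₗ[k] A :=
  T.basis.constr k fun x => if (x.1 : ℕ) + 1 = T.a then (T.Y : A) ^ (x.2 : ℕ) else 0

theorem divTop_monomial {m : ℕ} (hm : m < T.a) (n : ℕ) :
    T.divTop ((T.X : A) ^ m * (T.Y : A) ^ n) = if m + 1 = T.a then (T.Y : A) ^ n else 0 := by
  by_cases hn : n < T.b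
  · have h := T.basis_apply ⟨m, hm⟩ ⟨n, hn⟩
    simp only at h
    rw [← h, divTop, Module.Basis.constr_basis]
  · have h : (T.Y : A) ^ n = 0 := pow_eq_zero_of_le (not_lt.1 hn) T.Y_pow
    simp [h]

/-- Division by `X` fails to undo multiplication only on monomials with `X`-exponent `a - 1`, which
`X` annihilates. -/
theorem divX_X_mul (c : A) : ∃ d, T.divX (T.X * c) - c = (T.X : A) ^ (T.a - 1) * d := by
  induction c using T.induction with
  | hmon m hm n hn =>
    rw [T.X_mul_monomial]
    by_cases h : m + 1 < T.a
    · exact ⟨0, by rw [T.divX_monomial h]; simp⟩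
    · obtain rfl : m = T.a - 1 := by omega
      refine ⟨-(T.Y : A) ^ n, ?_⟩
      rw [pow_eq_zero_of_le (by omega) T.X_pow]
      simp
  | hadd c c' h h' =>
    obtain ⟨d, h⟩ := h
    obtain ⟨d', h'⟩ := h'
    exact ⟨d + d', by rw [mul_add, map_add, mul_add, ← h, ← h']; abel⟩
  | hsmul r c h =>
    obtain ⟨d, h⟩ := h
    exact ⟨r • d, by rw [mul_smul_comm, map_smul, mul_smul_comm, ← h, smul_sub]⟩

theorem divX_Y_mul (c : A) : ∃ d, T.divX (T.Y * c) = T.Y * d := by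
  induction c using T.induction with
  | hmon m hm n hn =>
    rw [T.Y_mul_monomial, T.divX_monomial hm]
    split_ifs
    · exact ⟨0, by simp⟩
    · exact ⟨_, (T.Y_mul_monomial _ _).symm⟩
  | hadd c c' h h' =>
    obtain ⟨d, h⟩ := h
    obtain ⟨d', h'⟩ := h'
    exact ⟨d + d', by rw [mul_add, map_add, mul_add, ← h, ← h']⟩
  | hsmul r c h =>
    obtain ⟨d, h⟩ := h
    exact ⟨r • d, by rw [mul_smul_comm, map_smul, mul_smul_comm, ← h]⟩

theorem X_pow_mul_monomial (i m n : ℕ) : (T.X : A) ^ i * ((T.X : A) ^ m * (T.Y : A) ^ n) =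
    (T.X : A) ^ (i + m) * (T.Y : A) ^ n := by
  rw [← mul_assoc, pow_add]

/-- Multiplication by `X ^ (a - 1)` forgets exactly the multiples of `X`, so division recovers an
element up to those. -/
theorem divTop_X_pow_mul (c : A) :
    ∃ d, T.divTop ((T.X : A) ^ (T.a - 1) * c) - c = (T.X : A) * d := by
  have ha := T.three_le_a
  induction c using T.induction with
  | hmon m hm n hn =>
    rw [T.X_pow_mul_monomial]
    rcases m with _ | m
    · refine ⟨0, ?_⟩
      rw [T.divTop_monomial (by omega), if_pos (by omega)]
      simp
    · refine ⟨-((T.X : A) ^ m * (T.Y : A) ^ n), ?_⟩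
      rw [pow_eq_zero_of_le (by omega) T.X_pow, zero_mul, map_zero, zero_sub, mul_neg,
        T.X_mul_monomial]
  | hadd c c' h h' =>
    obtain ⟨d, h⟩ := h
    obtain ⟨d', h'⟩ := h'
    exact ⟨d + d', by rw [mul_add, map_add, mul_add, ← h, ← h']; abel⟩
  | hsmul r c h =>
    obtain ⟨d, h⟩ := h
    exact ⟨r • d, by rw [mul_smul_comm, map_smul, mul_smul_comm, ← h, smul_sub]⟩

theorem divTop_Y_mul (c : A) : ∃ d, T.divTop (T.Y * c) = T.Y * d := by
  induction c using T.induction with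
  | hmon m hm n hn =>
    rw [T.Y_mul_monomial, T.divTop_monomial hm]
    split_ifs
    · exact ⟨_, pow_succ' _ _⟩
    · exact ⟨0, by simp⟩
  | hadd c c' h h' =>
    obtain ⟨d, h⟩ := h
    obtain ⟨d', h'⟩ := h'
    exact ⟨d + d', by rw [mul_add, map_add, mul_add, ← h, ← h']⟩
  | hsmul r c h =>
    obtain ⟨d, h⟩ := h
    exact ⟨r • d, by rw [mul_smul_comm, map_smul, mul_smul_comm, ← h]⟩

end Truncated

/-! ### Cochains of degree one, towers and alternating words -/

section

variable {k A : Type*} [Field k] [Ring A] [Algebra k A] {I : NonUnitalSubalgebra k A}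

/-- The cochain of degree one given by a linear form. -/
def lin (θ : A →ₗ[k] k) : Fun k I
  | [] => 0
  | [c] => θ c
  | _ :: _ :: _ => 0

@[simp] theorem lin_single (θ : A →ₗ[k] k) (c : I) : lin θ [c] = θ c := rfl

theorem lin_mem_forms (θ : A →ₗ[k] k) : (lin θ : Fun k I) ∈ forms k I 1 := by
  refine ⟨⟨fun u v a b => ?_, fun u v c a => ?_⟩, fun w hw => ?_⟩
  · rcases u with _ | ⟨e, _ | ⟨e', u⟩⟩ <;> cases v <;> simp [lin]
  · rcases u with _ | ⟨e, _ | ⟨e', u⟩⟩ <;> cases v <;> simp [lin]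
  · rcases w with _ | ⟨a, _ | ⟨b, w⟩⟩
    · rfl
    · simp at hw
    · rfl

theorem ext_forms_two {f g : Fun k I} (hf : f ∈ forms k I 2) (hg : g ∈ forms k I 2)
    (h : ∀ a b : I, f [a, b] = g [a, b]) : f = g := by
  ext w
  by_cases hw : w.length = 2
  · obtain ⟨a, b, rfl⟩ := List.length_eq_two.1 hw
    exact h a b
  · rw [hf.2 w (by exact_mod_cast hw), hg.2 w (by exact_mod_cast hw)]

theorem delta_one : delta (1 : Fun k I) = 0 := by
  have h : (1 : Fun k I) * 1 = 1 := mul_one 1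
  have hs : sign (1 : Fun k I) = 1 := by
    ext w
    cases w <;> simp [one_apply]
  have := delta_mul (1 : Fun k I) 1
  rw [hs, mul_one, mul_one, one_mul] at this
  exact left_eq_add.1 this

theorem delta_eq_zero_of_coeffDelta_eq {ε : A →ₐ[k] k} (hI : ∀ a : A, a ∈ I ↔ ε a = 0)
    {F : A →ₗ[k] Fun k I} {f : Fun k I} (h : coeffDelta F = scalarMap ε.toLinearMap f) :
    delta f = 0 := by
  ext w
  cases w with
  | nil => simp
  | cons a w =>
    have h' := congrArg (fun E : A →ₗ[k] Fun k I => E 1 (a :: w)) (coeffDelta_coeffDelta F)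
    simp only [h, coeffDelta_cons] at h'
    simpa [(hI _).1 a.2] using h'

/-- The cochains `1, x, u, u x, u ^ 2, …`. -/
def tower (x u : Fun k I) : ℕ → Fun k I
  | 0 => 1
  | 1 => x
  | n + 2 => u * tower x u n

theorem tower_eq (x u : Fun k I) (n : ℕ) : tower x u n = u ^ (n / 2) * x ^ (n % 2) := by
  induction n using Nat.twoStepInduction with
  | zero => simp [tower]
  | one => simp [tower]
  | more n ih _ =>
    rw [tower, ih, Nat.add_div_right _ (by norm_num), Nat.add_mod_right, pow_succ', mul_assoc]

theorem tower_mem_forms {x u : Fun k I} (hx : x ∈ forms k I 1) (hu : u ∈ forms k I 2) (n : ℕ) :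
    tower x u n ∈ forms k I n := by
  induction n using Nat.twoStepInduction with
  | zero => exact one_mem_forms
  | one => exact hx
  | more n ih _ =>
    rw [tower]
    have := mul_mem_forms hu ih
    rwa [add_comm] at this

theorem delta_tower {x u : Fun k I} (hx : delta x = 0) (hu : delta u = 0) (n : ℕ) :
    delta (tower x u n) = 0 := by
  induction n using Nat.twoStepInduction with
  | zero => exact delta_one
  | one => exact hx
  | more n ih _ => rw [tower, delta_mul, ih, hu, zero_mul, mul_zero, add_zero]

theorem Kills.tower {c : I} {x u : Fun k I} (hx : Kills c x) (hu : Kills c u) (n : ℕ) :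
    Kills c (tower x u n) := by
  induction n using Nat.twoStepInduction with
  | zero => exact kills_one c
  | one => exact hx
  | more n ih _ => rw [Cobar.tower]; exact hu.mul ih

/-- The word `[c, d, c, d, …]` of length `n`. -/
def alternating (c d : I) : ℕ → List I
  | 0 => []
  | 1 => [c]
  | n + 2 => c :: d :: alternating c d n

theorem length_alternating (c d : I) (n : ℕ) : (alternating c d n).length = n := by
  induction n using Nat.twoStepInduction with
  | zero => rfl
  | one => rfl
  | more n ih _ => simp [alternating, ih]

/-- Every merge of neighbouring letters vanishes, so these words are cycles of the bar complex. -/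
theorem isChain_alternating {c d : I} (h : c * d = 0) (h' : d * c = 0) (n : ℕ) :
    (alternating c d n).IsChain fun x y => x * y = 0 := by
  induction n using Nat.twoStepInduction with
  | zero => simp [alternating]
  | one => simp [alternating]
  | more n ih _ =>
    rw [alternating, List.isChain_cons_cons]
    refine ⟨h, ?_⟩
    rcases n with _ | _ | n
    · simp [alternating]
    · simp [alternating, h']
    · rw [alternating, List.isChain_cons_cons]
      exact ⟨h', ih⟩

theorem eq_or_eq_of_mem_alternating {c d e : I} {n : ℕ} (h : e ∈ alternating c d n) :
    e = c ∨ e = d := by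
  induction n using Nat.twoStepInduction with
  | zero => simp [alternating] at h
  | one => simp [alternating] at h; exact Or.inl h
  | more n ih _ =>
    simp only [alternating, List.mem_cons] at h
    tauto

/-- Each factor `u` consumes one pair `[c, d]` with value one, and unequal lengths give zero by
degree. Towers and alternating words are thus dual families. -/
theorem tower_alternating {x u : Fun k I} (hx : x ∈ forms k I 1) (hu : u ∈ forms k I 2) {c d : I}
    (hxc : x [c] = 1) (hucd : u [c, d] = 1) (m n : ℕ) :
    tower x u m (alternating c d n) = if m = n then 1 else 0 := by
  split_ifs with h
  · subst h
    induction m using Nat.twoStepInduction with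
    | zero => simp [tower, alternating, one_apply]
    | one => simp [tower, alternating, hxc]
    | more n ih _ => rw [tower, alternating, mul_apply_of_forms_two hu, ih, hucd, mul_one]
  · exact (tower_mem_forms hx hu m).2 _ (by rw [length_alternating]; exact_mod_cast Ne.symm h)

end

/-! ### Dual cochains, the Massey power and periodicity -/

namespace Truncated

variable {k A : Type*} [Field k] [Ring A] [Algebra k A] {I : NonUnitalSubalgebra k A}
  (T : Truncated I)

/-- The cochain dual to `X ^ i`. -/
noncomputable def dualX (i : ℕ) : Fun k I := lin (T.coeffX i)

theorem dualX_mem_forms (i : ℕ) : T.dualX i ∈ forms k I 1 := lin_mem_forms _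

theorem coeffX_zero_coe (c : I) : T.coeffX 0 (c : A) = 0 := by
  rw [coeffX_zero]; exact (T.mem_iff _).1 c.2

theorem coeffX_mul_coe {i : ℕ} (hi : i < T.a) (c : A) (c' : I) :
    T.coeffX i (c * c') = ∑ j ∈ Finset.Icc 1 i, T.coeffX (i - j) c * T.coeffX j c' := by
  have h : ∑ j ∈ Finset.range (i + 1), T.coeffX (i - j) c * T.coeffX j c' =
      ∑ j ∈ Finset.Icc 1 i, T.coeffX (i - j) c * T.coeffX j c' := by
    refine (Finset.sum_subset (fun j hj => ?_) fun j hj hj' => ?_).symm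
    · simp at hj ⊢; omega
    · obtain rfl : j = 0 := by simp at hj hj'; omega
      rw [T.coeffX_zero_coe, mul_zero]
  rw [T.coeffX_mul hi, ← h, Finset.Nat.sum_antidiagonal_eq_sum_range_succ
    (fun p q => T.coeffX p c * T.coeffX q c'), ← Finset.sum_range_reflect]
  refine Finset.sum_congr rfl fun j hj => ?_
  have hj' := Finset.mem_range.1 hj
  rw [show i + 1 - 1 - j = i - j by omega, show i - (i - j) = j by omega]

/-- `δ` is the transpose of multiplication, and the coefficient of `X ^ i` in a product is a
convolution whose two end terms vanish because elements of `I` have no constant term. -/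
theorem delta_dualX {i : ℕ} (hi : i < T.a) :
    delta (T.dualX i) = ∑ j ∈ Finset.Icc 1 (i - 1), T.dualX j * T.dualX (i - j) := by
  refine ext_forms_two (delta_mem_forms (T.dualX_mem_forms i))
    (sum_mem fun j _ => mul_mem_forms (T.dualX_mem_forms j) (T.dualX_mem_forms _)) fun p q => ?_
  have h1 : delta (T.dualX i) [p, q] = T.coeffX i ((p : A) * q) := by
    rw [delta_cons_cons, delta_single, sub_zero]; rfl
  rw [h1, sum_apply, T.coeffX_mul_coe hi]
  simp only [mul_apply_cons_of_forms_one (T.dualX_mem_forms _)]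
  simp only [dualX, lin_single]
  rw [← Finset.sum_subset (s₁ := Finset.Icc 1 (i - 1)) (fun j hj => ?_) fun j hj hj' => ?_]
  rotate_left
  · simp at hj ⊢; omega
  · obtain rfl : j = i := by simp at hj hj'; omega
    rw [Nat.sub_self, T.coeffX_zero_coe, zero_mul]
  -- The reflection `j ↦ i - j` undoes the order of indices in `coeffX_mul_coe`.
  · refine Finset.sum_nbij' (fun j => i - j) (fun j => i - j) ?_ ?_ ?_ ?_ ?_
    all_goals intro j hj; simp at hj ⊢
    · omega
    · omega
    · omega
    · omega
    · rw [show i - (i - j) = j by omega]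
      exact Or.inl rfl

/-- The symmetric Massey power of `dualX 1`. -/
noncomputable def massey : Fun k I :=
  ∑ j ∈ Finset.Icc 1 (T.a - 1), T.dualX j * T.dualX (T.a - j)

theorem massey_mem_forms : T.massey ∈ forms k I 2 :=
  sum_mem fun j _ => mul_mem_forms (T.dualX_mem_forms j) (T.dualX_mem_forms _)

/-- For `a` in `I`, the coefficient of `X` in `c * a` is `ε c` times that in `a`. This is how `x`
enters the periodicity argument. -/
theorem coeffDelta_coeffX_one :
    coeffDelta (scalarMap (T.coeffX 1) (1 : Fun k I)) =
      scalarMap T.ε.toLinearMap (T.dualX 1) := by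
  ext c w
  cases w with
  | nil => simp [dualX, lin]
  | cons a w =>
    have ha := T.three_le_a
    rw [coeffDelta_cons, scalarMap_apply, scalarMap_apply, delta_smul, delta_one, smul_zero,
      scalarMap_apply, T.coeffX_mul_coe (by omega)]
    cases w with
    | nil => simp [dualX, lin, one_apply, coeffX_zero]
    | cons b w => simp [dualX, lin, one_apply]

/-- The cochain with coefficients linking `X ^ (a - 1)` to the Massey power. -/
noncomputable def link : A →ₗ[k] Fun k I :=
  ∑ j ∈ Finset.Icc 1 (T.a - 1), scalarMap (T.coeffX (T.a - j)) (T.dualX j)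

theorem link_apply (c : A) :
    T.link c = ∑ j ∈ Finset.Icc 1 (T.a - 1), T.coeffX (T.a - j) c • T.dualX j := by
  simp [link, LinearMap.sum_apply]

theorem link_mem_forms (c : A) : T.link c ∈ forms k I 1 := by
  rw [link_apply]
  exact sum_mem fun j _ => Submodule.smul_mem _ _ (T.dualX_mem_forms j)

theorem link_Y_mul (c : A) : T.link (T.Y * c) = 0 := by
  rw [link_apply]
  exact Finset.sum_eq_zero fun j _ => by rw [T.coeffX_Y_mul, zero_smul]

/-- Both sides expand the coefficient of `X ^ (a - 1)` in a product `c * p`; on the left the factor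
`X` lowers the index `a - j` by one. `Resolves.step` needs this relation between `Gu` and `Hu`. -/
theorem link_X_mul (c : A) :
    T.link (T.X * c) = coeffDelta (scalarMap (T.coeffX (T.a - 1)) (1 : Fun k I)) c := by
  have ha := T.three_le_a
  have h1 : coeffDelta (scalarMap (T.coeffX (T.a - 1)) (1 : Fun k I)) c ∈ forms k I 1 := by
    simpa using coeffDelta_mem_forms (F := scalarMap (T.coeffX (T.a - 1)) (1 : Fun k I))
      (fun c => Submodule.smul_mem _ _ one_mem_forms) c
  ext w
  by_cases hw : w.length = 1
  · obtain ⟨p, rfl⟩ := List.length_eq_one_iff.1 hw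
    rw [link_apply, sum_apply, coeffDelta_cons, scalarMap_apply, scalarMap_apply, delta_smul,
      delta_one, smul_zero, smul_apply, T.coeffX_mul_coe (by omega)]
    simp only [one_apply, List.length_nil, if_true, mul_one, zero_apply, sub_zero]
    refine Finset.sum_congr rfl fun j hj => ?_
    have hj' := Finset.mem_Icc.1 hj
    rw [show T.a - j = (T.a - 1 - j) + 1 by omega, smul_apply, T.coeffX_X_mul (by omega)]
    rfl
  · rw [(T.link_mem_forms _).2 w (by exact_mod_cast hw), h1.2 w (by exact_mod_cast hw)]

/-- It suffices to look at `1`, `XA` and `YA`. On `XA` the cochain is itself a coboundary, on `YA`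
it is zero, and at `1` its differential is the Massey sum. -/
theorem coeffDelta_link : coeffDelta T.link = scalarMap T.ε.toLinearMap T.massey := by
  ext c w
  obtain ⟨r, s, h⟩ := T.exists_eq c
  have h1 : coeffDelta T.link (T.X * r) = 0 := by
    have e : T.link ∘ₗ LinearMap.mulLeft k (T.X : A) =
        coeffDelta (scalarMap (T.coeffX (T.a - 1)) (1 : Fun k I)) := by
      ext1 c; exact T.link_X_mul c
    have := coeffDelta_comp_mulLeft T.link (T.X : A)
    rw [e, coeffDelta_coeffDelta] at this
    exact (congrArg (fun E : A →ₗ[k] Fun k I => E r) this).symm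
  have h2 : coeffDelta T.link (T.Y * s) = 0 := by
    have e : T.link ∘ₗ LinearMap.mulLeft k (T.Y : A) = 0 := by
      ext1 c; exact T.link_Y_mul c
    have := coeffDelta_comp_mulLeft T.link (T.Y : A)
    rw [e, map_zero] at this
    exact (congrArg (fun E : A →ₗ[k] Fun k I => E s) this).symm
  have h3 : coeffDelta T.link 1 = T.massey := by
    have h4 : T.link 1 = 0 := by
      rw [link_apply]
      refine Finset.sum_eq_zero fun j hj => ?_
      have hj' := Finset.mem_Icc.1 hj
      have := T.coeffX_monomial (i := T.a - j) (by omega) 0 0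
      simp only [pow_zero, mul_one] at this
      rw [this, if_neg (by omega), zero_smul]
    ext w
    cases w with
    | nil => rw [coeffDelta_nil, T.massey_mem_forms.2 [] (by simp)]
    | cons p w =>
      rw [coeffDelta_cons, h4, delta_zero, one_mul, link_apply, massey, sum_apply, sum_apply]
      simp only [mul_apply_cons_of_forms_one (T.dualX_mem_forms _), smul_apply, zero_apply,
        sub_zero]
      refine Finset.sum_nbij' (fun j => T.a - j) (fun j => T.a - j) ?_ ?_ ?_ ?_ ?_
      all_goals intro j hj; simp at hj ⊢
      · omega
      · omega
      · omega
      · omega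
      · rw [show T.a - (T.a - j) = j by omega]
        rfl
  conv_lhs => rw [h]
  rw [map_add, map_add, h1, h2, map_smul, h3, add_zero, add_zero]
  rfl

theorem delta_dualX_one : delta (T.dualX 1) = 0 :=
  delta_eq_zero_of_coeffDelta_eq T.mem_iff T.coeffDelta_coeffX_one

theorem delta_massey : delta T.massey = 0 :=
  delta_eq_zero_of_coeffDelta_eq T.mem_iff T.coeffDelta_link

/-- `Resolves.step` with `α = X` and `β = X ^ (a - 1)`: their product is zero, and division by
either is defined up to multiples of the other. Since `J` consists of multiples of `Y`, the
coefficients of pure powers of `X` vanish on it. -/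
theorem resolves_step {J : Submodule k A} {S S' : ℤ → Submodule k (Fun k I)}
    (hR : Resolves T.ε J S) (hJY : ∀ c ∈ J, ∃ d, c = T.Y * d)
    (hJ : ∀ c ∈ J, ∀ a : A, c * a ∈ J) (hτJ : ∀ c ∈ J, T.divX c ∈ J) (hσJ : ∀ c ∈ J, T.divTop c ∈ J)
    (hS : ∀ s, ∀ f ∈ S s, f ∈ forms k I s ∧ delta f = 0)
    (hS' : ∀ s, ∀ f ∈ S' s, f ∈ forms k I s ∧ delta f = 0)
    (h0 : ∀ s, S s ≤ S' s) (h1 : ∀ s, ∀ f ∈ S s, T.dualX 1 * f ∈ S' (s + 1))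
    (h2 : ∀ s, ∀ f ∈ S' s, T.massey * f ∈ S' (s + 2)) :
    Resolves T.ε (J ⊔ LinearMap.range (LinearMap.mulLeft k (T.X : A))) S' := by
  have ha := T.three_le_a
  have hX : ∀ c, (T.X : A) * c ∈ J ⊔ LinearMap.range (LinearMap.mulLeft k (T.X : A)) :=
    fun c => Submodule.mem_sup_right ⟨c, rfl⟩
  have hmem : ∀ c ∈ J ⊔ LinearMap.range (LinearMap.mulLeft k (T.X : A)),
      ∃ j ∈ J, ∃ a, c = j + T.X * a := by
    intro c hc
    obtain ⟨j, hj, _, ⟨a, rfl⟩, rfl⟩ := Submodule.mem_sup.1 hc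
    exact ⟨j, hj, a, rfl⟩
  have hlm : ∀ (z c : A), c ∈ J → z * c ∈ J := fun z c hc => T.commutes c z ▸ hJ c hc z
  refine Resolves.step hR hJ ?_ le_sup_left (hlm _) (hlm _) (α := (T.X : A))
    (β := (T.X : A) ^ (T.a - 1)) ?_ ?_ ?_ hX hmem (σ := T.divTop) (τ := T.divX) ?_ ?_ ?_ hτJ
    (X := T.coeffX 1) (Hu := T.coeffX (T.a - 1)) ?_ ?_ T.coeffDelta_coeffX_one ?_
    T.coeffX_X_pow_mul T.link_mem_forms ?_ T.link_X_mul T.coeffDelta_link hS hS' h0 h1 h2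
  · intro c hc
    obtain ⟨j, hj, a, rfl⟩ := hmem c hc
    obtain ⟨d, rfl⟩ := hJY j hj
    simp [T.ε_X, T.ε_Y]
  · rw [map_pow, T.ε_X, zero_pow (by omega)]
  · intro c
    rw [← mul_assoc, ← pow_succ', Nat.sub_add_cancel (by omega), T.X_pow, zero_mul]
    exact zero_mem _
  · intro c
    rw [← mul_assoc, ← pow_succ, Nat.sub_add_cancel (by omega), T.X_pow, zero_mul]
    exact zero_mem _
  · intro c
    obtain ⟨d, hd⟩ := T.divTop_X_pow_mul c
    rw [hd]
    exact hX d
  · exact fun c hc => Submodule.mem_sup_left (hσJ c hc)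
  · intro c
    obtain ⟨d, hd⟩ := T.divX_X_mul c
    exact ⟨0, zero_mem _, d, by rw [hd, zero_add]⟩
  · intro c hc
    obtain ⟨d, rfl⟩ := hJY c hc
    exact T.coeffX_Y_mul _ d
  · intro c
    rw [← coeffX_zero]
    exact T.coeffX_X_mul (by omega) c
  · intro c hc
    obtain ⟨d, rfl⟩ := hJY c hc
    exact T.coeffX_Y_mul _ d
  · intro c hc
    obtain ⟨d, rfl⟩ := hJY c hc
    exact T.link_Y_mul d

/-- The cocycles `u ^ i x ^ j`, `j ≤ 1`, of homological degree `n = 2 i + j`. -/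
noncomputable def towerX (n : ℕ) : Fun k I := tower (T.dualX 1) T.massey n

theorem towerX_mem_forms (n : ℕ) : T.towerX n ∈ forms k I n :=
  tower_mem_forms (T.dualX_mem_forms 1) T.massey_mem_forms n

theorem delta_towerX (n : ℕ) : delta (T.towerX n) = 0 :=
  delta_tower T.delta_dualX_one T.delta_massey n

/-- The span of the cocycles `u ^ i x ^ j v ^ i' y ^ j'` of homological degree `s`. -/
noncomputable def monomials (s : ℤ) : Submodule k (Fun k I) :=
  Submodule.span k {f | ∃ m n : ℕ, (m + n : ℤ) = s ∧ T.towerX m * T.swap.towerX n = f}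

/-- The zero ideal is enlarged by `Y` and then by `X`. The first enlargement contributes the tower
in `y` and `v`; the second multiplies it by the tower in `x` and `u`. -/
theorem resolves_monomials :
    Resolves T.ε ((⊥ ⊔ LinearMap.range (LinearMap.mulLeft k (T.Y : A))) ⊔
      LinearMap.range (LinearMap.mulLeft k (T.X : A))) T.monomials := by
  let S₀ : ℤ → Submodule k (Fun k I) := fun s => Submodule.span k {f | s = 0 ∧ f = 1}
  let S₁ : ℤ → Submodule k (Fun k I) :=
    fun s => Submodule.span k {f | ∃ n : ℕ, (n : ℤ) = s ∧ T.swap.towerX n = f}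
  have hspan : ∀ (s : ℤ) (M : Set (Fun k I)), (∀ f ∈ M, f ∈ forms k I s ∧ delta f = 0) →
      ∀ f ∈ Submodule.span k M, f ∈ forms k I s ∧ delta f = 0 := by
    intro s M hM f hf
    induction hf using Submodule.span_induction with
    | mem f hf => exact hM f hf
    | zero => exact ⟨zero_mem _, delta_zero⟩
    | add f g _ _ hf hg => exact ⟨add_mem hf.1 hg.1, by rw [delta_add, hf.2, hg.2, add_zero]⟩
    | smul r f _ hf => exact ⟨Submodule.smul_mem _ _ hf.1, by rw [delta_smul, hf.2, smul_zero]⟩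
  have hmul : ∀ (g : Fun k I) (M : Set (Fun k I)) (N : Submodule k (Fun k I)),
      (∀ f ∈ M, g * f ∈ N) → ∀ f ∈ Submodule.span k M, g * f ∈ N := by
    intro g M N hM f hf
    exact (Submodule.span_le (p := N.comap (LinearMap.mulLeft k g))).2 hM hf
  have hS₀ : ∀ s, ∀ f ∈ S₀ s, f ∈ forms k I s ∧ delta f = 0 := by
    intro s
    refine hspan s _ ?_
    rintro _ ⟨rfl, rfl⟩
    exact ⟨one_mem_forms, delta_one⟩
  have hS₁ : ∀ s, ∀ f ∈ S₁ s, f ∈ forms k I s ∧ delta f = 0 := by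
    intro s
    refine hspan s _ ?_
    rintro _ ⟨n, rfl, rfl⟩
    exact ⟨T.swap.towerX_mem_forms n, T.swap.delta_towerX n⟩
  have hS₂ : ∀ s, ∀ f ∈ T.monomials s, f ∈ forms k I s ∧ delta f = 0 := by
    intro s
    refine hspan s _ ?_
    rintro _ ⟨m, n, rfl, rfl⟩
    refine ⟨mul_mem_forms (T.towerX_mem_forms m) (T.swap.towerX_mem_forms n), ?_⟩
    rw [delta_mul, T.delta_towerX, T.swap.delta_towerX, zero_mul, mul_zero, add_zero]
  have hR₀ : Resolves T.swap.ε ⊥ S₀ :=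
    resolves_bot T.mem_iff _ (Submodule.subset_span ⟨rfl, rfl⟩)
  have hR₁ := T.swap.resolves_step (S' := S₁) hR₀
    (by rintro c hc; obtain rfl := (Submodule.mem_bot k).1 hc; exact ⟨0, by simp⟩)
    (by rintro c hc a; obtain rfl := (Submodule.mem_bot k).1 hc; simp)
    (by rintro c hc; obtain rfl := (Submodule.mem_bot k).1 hc; simp)
    (by rintro c hc; obtain rfl := (Submodule.mem_bot k).1 hc; simp) hS₀ hS₁
    (fun s => Submodule.span_le.2 (by
      rintro _ ⟨rfl, rfl⟩
      exact Submodule.subset_span ⟨0, rfl, rfl⟩))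
    (fun s => hmul _ _ _ (by
      rintro _ ⟨rfl, rfl⟩
      rw [mul_one]
      exact Submodule.subset_span ⟨1, rfl, rfl⟩))
    (fun s => hmul _ _ _ (by
      rintro _ ⟨n, rfl, rfl⟩
      exact Submodule.subset_span ⟨n + 2, by push_cast; ring, rfl⟩))
  have hY : ∀ c ∈ (⊥ ⊔ LinearMap.range (LinearMap.mulLeft k (T.Y : A)) : Submodule k A),
      ∃ d, c = T.Y * d := by
    intro c hc
    rw [bot_sup_eq] at hc
    obtain ⟨d, rfl⟩ := hc
    exact ⟨d, rfl⟩
  have hY' : ∀ d, (T.Y : A) * d ∈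
      (⊥ ⊔ LinearMap.range (LinearMap.mulLeft k (T.Y : A)) : Submodule k A) :=
    fun d => Submodule.mem_sup_right ⟨d, rfl⟩
  refine T.resolves_step (S := S₁) hR₁ hY ?_ ?_ ?_ hS₁ hS₂ ?_ ?_ ?_
  · intro c hc a
    obtain ⟨d, rfl⟩ := hY c hc
    rw [mul_assoc]
    exact hY' _
  · intro c hc
    obtain ⟨d, rfl⟩ := hY c hc
    obtain ⟨e, he⟩ := T.divX_Y_mul d
    rw [he]
    exact hY' e
  · intro c hc
    obtain ⟨d, rfl⟩ := hY c hc
    obtain ⟨e, he⟩ := T.divTop_Y_mul d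
    rw [he]
    exact hY' e
  · intro s
    refine Submodule.span_le.2 ?_
    rintro _ ⟨n, rfl, rfl⟩
    refine Submodule.subset_span ⟨0, n, by simp, ?_⟩
    rw [towerX, tower, one_mul]
  · intro s
    refine hmul _ _ _ ?_
    rintro _ ⟨n, rfl, rfl⟩
    refine Submodule.subset_span ⟨1, n, by push_cast; ring, ?_⟩
    rw [towerX, tower]
  · intro s
    refine hmul _ _ _ ?_
    rintro _ ⟨m, n, rfl, rfl⟩
    refine Submodule.subset_span ⟨m + 2, n, by push_cast; ring, ?_⟩
    rw [towerX, tower, mul_assoc]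
    rfl

/-- Every cocycle is cohomologous to a combination of the monomials. -/
theorem exists_monomials_add_delta {s : ℤ} {f : Fun k I} (hf : f ∈ forms k I s)
    (hd : delta f = 0) : ∃ f' ∈ T.monomials s, ∃ g ∈ forms k I (s - 1), f = f' + delta g := by
  refine T.resolves_monomials.exists_sub_delta T.mem_iff (fun c hc => ?_) (fun c hc => ?_) hf hd
  · obtain ⟨r, s, h⟩ := T.exists_eq c
    rw [h, hc, zero_smul, zero_add, add_comm]
    exact add_mem (Submodule.mem_sup_left (Submodule.mem_sup_right ⟨s, rfl⟩))
      (Submodule.mem_sup_right ⟨r, rfl⟩)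
  · rw [bot_sup_eq] at hc
    obtain ⟨_, ⟨r, rfl⟩, _, ⟨s, rfl⟩, rfl⟩ := Submodule.mem_sup.1 hc
    simp [T.ε_X, T.ε_Y]

end Truncated

/-! ### Homological components of cochains -/

section

variable {k A : Type*} [Field k] [Ring A] [Algebra k A] {I : NonUnitalSubalgebra k A}

theorem Kills.lin {c : I} {θ : A →ₗ[k] k} (h : θ c = 0) : Kills c (lin θ : Fun k I) := by
  intro u v
  rcases u with _ | ⟨a, u⟩
  · cases v
    · exact h
    · rfl
  · cases u <;> rfl

theorem Kills.sum {ι : Type*} {c : I} {s : Finset ι} {f : ι → Fun k I}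
    (h : ∀ i ∈ s, Kills c (f i)) : Kills c (∑ i ∈ s, f i) := by
  intro u v
  rw [sum_apply]
  exact Finset.sum_eq_zero fun i hi => h i hi u v

theorem sign_of_mem_forms_one {f : Fun k I} (hf : f ∈ forms k I 1) : -sign f = f := by
  ext w
  by_cases hw : w.length = 1
  · simp [hw]
  · simp [hf.2 w (by exact_mod_cast hw)]

variable {d : ℕ → Submodule k I}

theorem bidegree_le_forms (s t : ℕ) : bidegree d s t ≤ forms k I s :=
  fun _ hf => ⟨⟨hf.1, hf.2.1⟩, fun w hw => hf.2.2.1 w (by exact_mod_cast hw)⟩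

theorem bidegree_le_complex {s t : ℕ} {f : Fun k I} (hf : f ∈ bidegree d s t) : f ∈ complex d := by
  change f ∈ ⨆ x : ℕ × ℕ, bidegree d x.1 x.2
  exact Submodule.mem_iSup_of_mem (s, t) hf

variable (k I) in
/-- The part of a cochain supported on words of length `s`. -/
def component (s : ℕ) : Fun k I →ₗ[k] Fun k I where
  toFun f := fun w => if w.length = s then f w else 0
  map_add' f g := by
    ext w
    change (if w.length = s then f w + g w else 0) =
      (if w.length = s then f w else 0) + if w.length = s then g w else 0
    split_ifs <;> simp
  map_smul' r f := by
    ext w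
    change (if w.length = s then r * f w else 0) = r * if w.length = s then f w else 0
    split_ifs <;> simp

theorem component_apply (s : ℕ) (f : Fun k I) (w : List I) :
    component k I s f w = if w.length = s then f w else 0 := rfl

theorem delta_component (s : ℕ) (f : Fun k I) :
    delta (component k I s f) = component k I (s + 1) (delta f) := by
  ext w
  rw [component_apply, delta_apply, delta_apply]
  split_ifs with h
  · refine Finset.sum_congr rfl fun i hi => ?_
    have := length_merge i w (by simp at hi; omega)
    rw [component_apply, if_pos (by omega)]
  · refine Finset.sum_eq_zero fun i hi => ?_
    have := length_merge i w (by simp at hi; omega)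
    rw [component_apply, if_neg (by omega), mul_zero]

theorem component_mem_forms (s : ℕ) {f : Fun k I} (hf : f ∈ complex d) :
    component k I s f ∈ forms k I s := by
  change f ∈ ⨆ x : ℕ × ℕ, bidegree d x.1 x.2 at hf
  induction hf using Submodule.iSup_induction' with
  | zero => rw [map_zero]; exact zero_mem _
  | add f g _ _ h h' => rw [map_add]; exact add_mem h h'
  | mem x f hf =>
    have hf' := bidegree_le_forms _ _ hf
    by_cases h : x.1 = s
    · subst h
      have : component k I x.1 f = f := by
        ext w
        rw [component_apply]
        split_ifs with hw
        · rfl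
        · exact (hf'.2 w (by exact_mod_cast hw)).symm
      rwa [this]
    · have : component k I s f = 0 := by
        ext w
        rw [component_apply]
        split_ifs with hw
        · exact hf'.2 w (by rw [hw]; exact_mod_cast Ne.symm h)
        · rfl
      rw [this]
      exact zero_mem _

theorem exists_eq_sum_component {f : Fun k I} (hf : f ∈ complex d) :
    ∃ N : ℕ, f = ∑ s ∈ Finset.range N, component k I s f := by
  have hN : ∃ N : ℕ, ∀ w : List I, N ≤ w.length → f w = 0 := by
    change f ∈ ⨆ x : ℕ × ℕ, bidegree d x.1 x.2 at hf
    induction hf using Submodule.iSup_induction' with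
    | zero => exact ⟨0, fun _ _ => rfl⟩
    | add f g _ _ h h' =>
      obtain ⟨N, h⟩ := h
      obtain ⟨N', h'⟩ := h'
      exact ⟨max N N', fun w hw => by
        rw [add_apply, h w (le_trans (le_max_left _ _) hw), h' w (le_trans (le_max_right _ _) hw),
          add_zero]⟩
    | mem x f hf => exact ⟨x.1 + 1, fun w hw => hf.2.2.1 w (by omega)⟩
  obtain ⟨N, hN⟩ := hN
  refine ⟨N, ?_⟩
  ext w
  rw [sum_apply]
  simp only [component_apply]
  rw [Finset.sum_ite_eq]
  split_ifs with h
  · rfl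
  · exact hN w (by simpa using h)

theorem complex_le_multilinear {f : Fun k I} (hf : f ∈ complex d) : f ∈ multilinear k I := by
  change f ∈ ⨆ x : ℕ × ℕ, bidegree d x.1 x.2 at hf
  have : (⨆ x : ℕ × ℕ, bidegree d x.1 x.2) ≤ multilinear k I :=
    iSup_le fun x f hf => ⟨hf.1, hf.2.1⟩
  exact this hf

theorem toCohomology_eq_iff {z z' : cocycles d} :
    toCohomology d z = toCohomology d z' ↔ ∃ c ∈ complex d, delta c = z - z' :=
  Ideal.Quotient.eq

end

/-! ### The grading and the detection of classes by shuffles -/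

namespace Truncated

variable {k A : Type*} [Field k] [Ring A] [Algebra k A] {I : NonUnitalSubalgebra k A}
  (T : Truncated I) (d : ℕ → Submodule k I)

/-- The grading `d` is the one in which both generators have degree `2`. -/
structure IsGraded : Prop where
  X_mem : T.X ∈ d 2
  Y_mem : T.Y ∈ d 2
  coord : ∀ (t : ℕ) (c : I), c ∈ d t → ∀ x : Fin T.a × Fin T.b, 2 * ((x.1 : ℕ) + x.2) ≠ t →
    T.basis.coord x (c : A) = 0

variable {T d}

theorem IsGraded.swap (hT : T.IsGraded d) : T.swap.IsGraded d where
  X_mem := hT.Y_mem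
  Y_mem := hT.X_mem
  coord t c hc x hx := by
    have := hT.coord t c hc (x.2, x.1) (by rwa [add_comm ((x.2 : ℕ))])
    rw [Module.Basis.coord_apply] at this ⊢
    have key : ∀ x : Fin T.b × Fin T.a,
        (T.basis.reindex (Equiv.prodComm _ _)).repr (c : A) x = T.basis.repr (c : A) (x.2, x.1) :=
      fun x => by rw [Module.Basis.repr_reindex_apply]; rfl
    exact (key x).trans this

theorem IsGraded.lin_mem_bidegree (hT : T.IsGraded d) (x : Fin T.a × Fin T.b) :
    (lin (T.basis.coord x) : Fun k I) ∈ bidegree d 1 (2 * ((x.1 : ℕ) + x.2)) := by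
  have h := lin_mem_forms (k := k) (I := I) (T.basis.coord x)
  refine ⟨h.1.1, h.1.2, fun w hw => h.2 w (by exact_mod_cast hw), fun w e he ht => ?_⟩
  rcases he with _ | @⟨c, t, _, _, hc, _ | _⟩
  · rfl
  · exact hT.coord t c hc x (by simpa using Ne.symm ht)
  · rfl

theorem IsGraded.dualX_mem_bidegree (hT : T.IsGraded d) (i : ℕ) : T.dualX i ∈ bidegree d 1
    (i * 2) := by
  by_cases hi : i < T.a
  · have := hT.lin_mem_bidegree (⟨i, hi⟩, ⟨0, by have := T.three_le_b; omega⟩)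
    rw [dualX, coeffX, dif_pos hi]
    rw [mul_comm i 2]
    simpa using this
  · have : T.dualX i = 0 := by
      rw [dualX, T.coeffX_of_le (not_lt.1 hi)]
      ext w
      rcases w with _ | ⟨a, _ | ⟨b, w⟩⟩ <;> rfl
    rw [this]
    exact zero_mem _

theorem IsGraded.massey_mem_bidegree (hT : T.IsGraded d) : T.massey ∈ bidegree d 2 (2 * T.a) := by
  refine sum_mem fun j hj => ?_
  have hj' := Finset.mem_Icc.1 hj
  have := mul_mem_bidegree (hT.dualX_mem_bidegree j) (hT.dualX_mem_bidegree (T.a - j))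
  rwa [show j * 2 + (T.a - j) * 2 = 2 * T.a by omega] at this

/-- The complex contains only finite sums of homogeneous cochains. As `A` has a finite homogeneous
basis, expanding a form in its first letter gives such a sum, by induction on the degree. -/
theorem IsGraded.forms_le_complex (hT : T.IsGraded d) (s : ℕ) {f : Fun k I} (hf : f ∈ forms k I s) :
    f ∈ complex d := by
  induction s generalizing f with
  | zero =>
    rw [mem_forms_zero hf]
    exact (complex d).smul_mem (one_mem _) _
  | succ s ih =>
    have h : f = ∑ x, (lin (T.basis.coord x) : Fun k I) *
        tail (toAugIdeal T.mem_iff (T.basis x)) f := by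
      ext w
      rw [sum_apply]
      cases w with
      | nil => simp [mul_nil, lin, hf.2 [] (by simp; omega)]
      | cons c w =>
        have hc : c = ∑ x, T.basis.coord x (c : A) • toAugIdeal T.mem_iff (T.basis x) := by
          conv_lhs => rw [← toAugIdeal_coe T.mem_iff c, ← T.basis.sum_repr (c : A), map_sum]
          simp
        have h2 : tail c f = ∑ x, T.basis.coord x (c : A) •
            tail (toAugIdeal T.mem_iff (T.basis x)) f := by
          let L : I →ₗ[k] Fun k I :=
            { toFun := fun c => tail c f
              map_add' := tail_add_left hf.1
              map_smul' := tail_smul_left hf.1 }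
          have := congrArg L hc
          rw [map_sum] at this
          simp only [map_smul] at this
          exact this
        have h3 := congrFun h2 w
        rw [sum_apply] at h3
        simp only [mul_apply_cons_of_forms_one (lin_mem_forms _)]
        exact h3
    rw [h]
    refine sum_mem fun x _ => mul_mem (bidegree_le_complex (hT.lin_mem_bidegree x)) (ih ?_)
    have := tail_mem_forms hf (toAugIdeal T.mem_iff (T.basis x))
    push_cast at this
    rwa [add_sub_cancel_right] at this

variable (T) in
/-- The element `X ^ (a - 1)`. -/
def powX : I :=
  ⟨(T.X : A) ^ (T.a - 1), (T.mem_iff _).2 (by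
    have := T.three_le_a
    rw [map_pow, T.ε_X, zero_pow (by omega)])⟩

variable (T) in
theorem coeffX_X_pow {i : ℕ} (hi : i < T.a) (m : ℕ) :
    T.coeffX i ((T.X : A) ^ m) = if m = i then 1 else 0 := by
  simpa using T.coeffX_monomial hi m 0

variable (T) in
theorem coeffX_X (i : ℕ) : T.coeffX i (T.X : A) = if i = 1 then 1 else 0 := by
  have := T.three_le_a
  by_cases hi : i < T.a
  · simpa [eq_comm] using T.coeffX_X_pow hi 1
  · rw [T.coeffX_of_le (not_lt.1 hi), LinearMap.zero_apply, if_neg (by omega)]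

variable (T) in
theorem X_mul_powX : T.X * T.powX = 0 := by
  have := T.three_le_a
  ext
  simp only [powX, NonUnitalSubalgebra.coe_mul]
  rw [← pow_succ', Nat.sub_add_cancel (by omega), T.X_pow]
  rfl

theorem mul_comm_coe (T : Truncated I) (x y : I) : x * y = y * x := by
  ext; exact T.commutes _ _

variable (T) in
/-- The word dual to `towerX n`. -/
def word (n : ℕ) : List I := alternating T.X T.powX n

variable (T) in
theorem isChain_word (n : ℕ) : (T.word n).IsChain fun x y => x * y = 0 :=
  isChain_alternating T.X_mul_powX (by rw [T.mul_comm_coe, T.X_mul_powX]) n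

variable (T) in
theorem length_word (n : ℕ) : (T.word n).length = n := length_alternating _ _ n

variable (T) in
theorem massey_apply (c c' : I) : T.massey [c, c'] =
    ∑ j ∈ Finset.Icc 1 (T.a - 1), T.coeffX j c * T.coeffX (T.a - j) c' := by
  rw [massey, sum_apply]
  simp only [mul_apply_cons_of_forms_one (T.dualX_mem_forms _)]
  rfl

variable (T) in
theorem massey_X_powX : T.massey [T.X, T.powX] = 1 := by
  have ha := T.three_le_a
  rw [massey_apply, Finset.sum_eq_single 1]
  · simp only [powX]
    rw [T.coeffX_X, T.coeffX_X_pow (by omega)]; simp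
  · intro j _ hj
    rw [T.coeffX_X, if_neg hj, zero_mul]
  · intro h
    simp at h
    omega

variable (T) in
theorem massey_powX_X : T.massey [T.powX, T.X] = 1 := by
  have ha := T.three_le_a
  rw [massey_apply, Finset.sum_eq_single (T.a - 1)]
  · simp only [powX]
    rw [T.coeffX_X, T.coeffX_X_pow (by omega), if_pos rfl, if_pos (by omega), mul_one]
  · intro j hj hj'
    have := Finset.mem_Icc.1 hj
    rw [T.coeffX_X, if_neg (by omega), mul_zero]
  · intro h
    simp at h
    omega

variable (T) in
theorem dualX_one_X : T.dualX 1 [T.X] = 1 := by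
  change T.coeffX 1 (T.X : A) = 1
  rw [T.coeffX_X, if_pos rfl]

variable (T) in
theorem dualX_one_powX : T.dualX 1 [T.powX] = 0 := by
  have ha := T.three_le_a
  change T.coeffX 1 ((T.X : A) ^ (T.a - 1)) = 0
  rw [T.coeffX_X_pow (by omega), if_neg (by omega)]

variable (T) in
theorem towerX_word (m n : ℕ) : T.towerX m (T.word n) = if m = n then 1 else 0 :=
  tower_alternating (T.dualX_mem_forms 1) T.massey_mem_forms T.dualX_one_X T.massey_X_powX m n

variable (T) in
/-- The cochains that vanish on all words containing a power of `Y`. -/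
def IsPure (f : Fun k I) : Prop := ∀ n, ∀ c ∈ T.swap.word n, Kills c f

theorem IsPure.mul {f g : Fun k I} (hf : T.IsPure f) (hg : T.IsPure g) : T.IsPure (f * g) :=
  fun n c hc => (hf n c hc).mul (hg n c hc)

variable (T) in
theorem isPure_one : T.IsPure 1 := fun _ c _ => kills_one c

variable (T) in
theorem isPure_dualX (i : ℕ) : T.IsPure (T.dualX i) := by
  intro n c hc
  refine Kills.lin ?_
  have hb := T.three_le_b
  have h : ∃ e, (c : A) = T.Y * e := by
    rcases eq_or_eq_of_mem_alternating hc with rfl | rfl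
    · exact ⟨1, (mul_one _).symm⟩
    · refine ⟨(T.Y : A) ^ (T.b - 2), ?_⟩
      change (T.Y : A) ^ (T.b - 1) = _
      rw [← pow_succ', show T.b - 2 + 1 = T.b - 1 by omega]
  obtain ⟨e, he⟩ := h
  rw [he, T.coeffX_Y_mul]

variable (T) in
theorem isPure_massey : T.IsPure T.massey := fun n c hc =>
  Kills.sum fun j _ => (T.isPure_dualX j n c hc).mul (T.isPure_dualX _ n c hc)

variable (T) in
theorem isPure_towerX (m : ℕ) : T.IsPure (T.towerX m) := fun n c hc =>
  (T.isPure_dualX 1 n c hc).tower (T.isPure_massey n c hc) m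

theorem shuffle_word_mul {f g : Fun k I} (hf : T.IsPure f) (hg : T.swap.IsPure g) (m n : ℕ) :
    shuffle (T.word m) (T.swap.word n) (f * g) = f (T.word m) * g (T.swap.word n) :=
  shuffle_mul (hf n) (hg m)

/-- The two words are exchanged before `shuffle_mul` is applied; the resulting sign is the source of
graded commutativity between the `X` and `Y` classes. -/
theorem shuffle_word_mul' {f g : Fun k I} (hf : T.IsPure f) (hg : T.swap.IsPure g) (m n : ℕ) :
    shuffle (T.word m) (T.swap.word n) (g * f) =
      (-1) ^ (m * n) * (f (T.word m) * g (T.swap.word n)) := by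
  have h : shuffle (T.swap.word n) (T.word m) (g * f) = g (T.swap.word n) * f (T.word m) :=
    shuffle_mul (hg m) (hf n)
  rw [shuffle_comm (T.swap.word n) (T.word m), h, length_word, length_word, mul_comm n m,
    mul_comm (g _)]

/-- Every cocycle is cohomologous to a combination of the monomials. -/
theorem IsGraded.exists_span_add_delta (hT : T.IsGraded d) (z : cocycles d) :
    ∃ f ∈ Submodule.span k (Set.range fun x : ℕ × ℕ => T.towerX x.1 * T.swap.towerX x.2),
      ∃ g ∈ complex d, (z : Fun k I) = f + delta g := by
  obtain ⟨N, hN⟩ := exists_eq_sum_component z.2.1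
  have hs : ∀ s : ℕ, ∃ f ∈ Submodule.span k
      (Set.range fun x : ℕ × ℕ => T.towerX x.1 * T.swap.towerX x.2),
      ∃ g ∈ complex d, component k I s (z : Fun k I) = f + delta g := by
    intro s
    obtain ⟨f, hf, g, hg, h⟩ := T.exists_monomials_add_delta (component_mem_forms s z.2.1)
      (by rw [delta_component, z.2.2, map_zero])
    refine ⟨f, Submodule.span_mono ?_ hf, g, ?_, h⟩
    · rintro _ ⟨m, n, _, rfl⟩
      exact ⟨(m, n), rfl⟩
    · cases s with
      | zero =>
        rw [forms_eq_zero (by simp) hg]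
        exact zero_mem _
      | succ s =>
        push_cast at hg
        rw [add_sub_cancel_right] at hg
        exact hT.forms_le_complex s hg
  choose f hf g hg hfg using hs
  refine ⟨∑ s ∈ Finset.range N, f s, sum_mem fun s _ => hf s,
    ∑ s ∈ Finset.range N, g s, sum_mem fun s _ => hg s, ?_⟩
  rw [delta_sum, ← Finset.sum_add_distrib]
  exact hN.trans (Finset.sum_congr rfl fun s _ => hfg s)
/-- The shuffles of the dual words detect cohomology classes. -/
theorem IsGraded.toCohomology_eq_zero_iff (hT : T.IsGraded d) (z : cocycles d) :
    toCohomology d z = 0 ↔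
    ∀ m n, shuffle (T.word m) (T.swap.word n) (z : Fun k I) = 0 := by
  constructor
  · intro h m n
    obtain ⟨c, hc, h⟩ := (toCohomology_eq_iff (z' := 0)).1 (h.trans (map_zero _).symm)
    have h' : (z : Fun k I) = delta c := by rw [h]; simp
    rw [h', shuffle_delta T.mul_comm_coe (T.isChain_word m) (T.swap.isChain_word n)
      (complex_le_multilinear hc)]
  · intro h
    obtain ⟨f, hf, g, hg, hz⟩ := hT.exists_span_add_delta z
    -- Pairing with the shuffle of the words of lengths `x.1` and `x.2` kills the coboundary and
    -- reads off the coefficient `c x`.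
    have hf0 : f = 0 := by
      obtain ⟨c, rfl⟩ := (Finsupp.mem_span_range_iff_exists_finsupp).1 hf
      have hc : c = 0 := by
        ext x
        let L : Fun k I →ₗ[k] k :=
          { toFun := shuffle (T.word x.1) (T.swap.word x.2)
            map_add' := shuffle_add _ _
            map_smul' := shuffle_smul _ _ }
        have h1 : L (z : Fun k I) = 0 := h x.1 x.2
        have h2 : L (delta g) = 0 := shuffle_delta T.mul_comm_coe (T.isChain_word _)
          (T.swap.isChain_word _) (complex_le_multilinear hg)
        rw [hz, map_add, h2, add_zero, Finsupp.sum, map_sum] at h1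
        have h3 : ∀ y : ℕ × ℕ, L (c y • (T.towerX y.1 * T.swap.towerX y.2)) =
            if x = y then c y else 0 := by
          intro y
          rw [map_smul]
          change c y • shuffle (T.word x.1) (T.swap.word x.2) _ = _
          rw [shuffle_word_mul (T.isPure_towerX _) (T.swap.isPure_towerX _), towerX_word,
            towerX_word]
          by_cases hxy : x = y
          · subst hxy; simp
          · rw [if_neg hxy]
            have : ¬ (y.1 = x.1 ∧ y.2 = x.2) := fun h => hxy (Prod.ext h.1.symm h.2.symm)
            by_cases h1 : y.1 = x.1
            · simp [show ¬ y.2 = x.2 from fun h2 => this ⟨h1, h2⟩]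
            · simp [h1]
        simp only [h3] at h1
        rw [Finset.sum_ite_eq] at h1
        by_cases hx : x ∈ c.support
        · simpa [hx] using h1
        · simpa using hx
      rw [hc, Finsupp.sum_zero_index]
    rw [hf0, zero_add] at hz
    rw [← map_zero (toCohomology d), toCohomology_eq_iff]
    exact ⟨g, hg, by rw [hz]; simp⟩

theorem IsGraded.toCohomology_eq_iff (hT : T.IsGraded d) (z z' : cocycles d) :
    toCohomology d z = toCohomology d z' ↔ ∀ m n, shuffle (T.word m) (T.swap.word n) (z : Fun k I) =
      shuffle (T.word m) (T.swap.word n) (z' : Fun k I) := by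
  rw [← sub_eq_zero, ← map_sub, hT.toCohomology_eq_zero_iff]
  refine forall_congr' fun m => forall_congr' fun n => ?_
  rw [← sub_eq_zero (a := shuffle _ _ (z : Fun k I)), ← shuffle_sub]
  rfl

end Truncated

/-! ### Recognizing `Λ[x, y] ⊗ k[u, v]` by relations and a basis -/

section Presentation

variable {k : Type*} [Field k]

/-- The span of `1, x, y, x y` contains `1` and is stable under left multiplication by the
generators. Exponents are taken modulo two so that the index set agrees with that of the tower
monomials. -/
theorem exteriorAlgebra_span :
    Submodule.span k (Set.range fun x : ℕ × ℕ =>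
      ExteriorAlgebra.ι k (Pi.single 0 1 : Fin 2 → k) ^ (x.1 % 2) *
        ExteriorAlgebra.ι k (Pi.single 1 1 : Fin 2 → k) ^ (x.2 % 2)) = ⊤ := by
  set x := ExteriorAlgebra.ι k (Pi.single 0 1 : Fin 2 → k) with hx
  set y := ExteriorAlgebra.ι k (Pi.single 1 1 : Fin 2 → k) with hy
  set S := Submodule.span k (Set.range fun z : ℕ × ℕ => x ^ (z.1 % 2) * y ^ (z.2 % 2)) with hS
  have hxx : x * x = 0 := ExteriorAlgebra.ι_sq_zero _
  have hyy : y * y = 0 := ExteriorAlgebra.ι_sq_zero _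
  have hyx : y * x = -(x * y) := eq_neg_of_add_eq_zero_left (ExteriorAlgebra.ι_add_mul_swap _ _)
  have h1 : (1 : ExteriorAlgebra k (Fin 2 → k)) ∈ S := Submodule.subset_span ⟨(0, 0), by simp⟩
  have h2 : x ∈ S := Submodule.subset_span ⟨(1, 0), by simp⟩
  have h3 : y ∈ S := Submodule.subset_span ⟨(0, 1), by simp⟩
  have h4 : x * y ∈ S := Submodule.subset_span ⟨(1, 1), by simp⟩
  have hmul : ∀ z : ExteriorAlgebra k (Fin 2 → k), z * 1 ∈ S → z * x ∈ S → z * y ∈ S →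
      z * (x * y) ∈ S → ∀ s ∈ S, z * s ∈ S := by
    intro z h1 h2 h3 h4 s hs
    refine (Submodule.span_le (p := S.comap (LinearMap.mulLeft k z))).2 ?_ hs
    rintro _ ⟨⟨i, j⟩, rfl⟩
    change z * (x ^ (i % 2) * y ^ (j % 2)) ∈ S
    rw [mul_one] at h1
    rcases Nat.mod_two_eq_zero_or_one i with hi | hi <;>
      rcases Nat.mod_two_eq_zero_or_one j with hj | hj <;> simpa [hi, hj]
  have hxS : ∀ s ∈ S, x * s ∈ S := hmul x (by rwa [mul_one]) (by rw [hxx]; exact zero_mem _) h4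
    (by rw [← mul_assoc, hxx, zero_mul]; exact zero_mem _)
  have hyS : ∀ s ∈ S, y * s ∈ S := hmul y (by rwa [mul_one]) (by rw [hyx]; exact neg_mem h4)
    (by rw [hyy]; exact zero_mem _)
    (by rw [← mul_assoc, hyx, neg_mul, mul_assoc, hyy, mul_zero, neg_zero]; exact zero_mem _)
  rw [eq_top_iff]
  intro a _
  have key : ∀ s ∈ S, a * s ∈ S := by
    induction a using ExteriorAlgebra.induction with
    | algebraMap r =>
      intro s hs
      rw [← Algebra.smul_def]
      exact Submodule.smul_mem _ _ hs
    | ι v =>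
      intro s hs
      have hv : v = v 0 • Pi.single 0 1 + v 1 • Pi.single 1 1 := by
        ext i; fin_cases i <;> simp
      rw [hv, map_add, map_smul, map_smul, add_mul, smul_mul_assoc, smul_mul_assoc]
      exact add_mem (Submodule.smul_mem _ _ (hxS s hs)) (Submodule.smul_mem _ _ (hyS s hs))
    | mul a b ha hb =>
      intro s hs
      rw [mul_assoc]
      exact ha trivial _ (hb trivial s hs)
    | add a b ha hb =>
      intro s hs
      rw [add_mul]
      exact add_mem (ha trivial s hs) (hb trivial s hs)
  simpa using key 1 h1

theorem mvPolynomial_span :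
    Submodule.span k (Set.range fun x : ℕ × ℕ =>
      (MvPolynomial.X 0 ^ x.1 * MvPolynomial.X 1 ^ x.2 : MvPolynomial (Fin 2) k)) = ⊤ := by
  rw [eq_top_iff]
  intro f _
  induction f using MvPolynomial.induction_on' with
  | monomial s c =>
    rw [MvPolynomial.monomial_eq, Finsupp.prod_fintype _ _ (by simp), Fin.prod_univ_two,
      ← MvPolynomial.smul_eq_C_mul]
    exact Submodule.smul_mem _ _ (Submodule.subset_span ⟨(s 0, s 1), rfl⟩)
  | add f g hf hg => exact add_mem (hf trivial) (hg trivial)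

/-- `H` need not be commutative, so the map is built from the monoid of exponents; only the
commutation of `u` with `v` matters. -/
theorem exists_mvPolynomial_algHom {H : Type*} [Ring H] [Algebra k H] {u v : H}
    (huv : Commute u v) :
    ∃ g : MvPolynomial (Fin 2) k →ₐ[k] H, g (MvPolynomial.X 0) = u ∧ g (MvPolynomial.X 1) = v := by
  let F : Multiplicative (Fin 2 →₀ ℕ) →* H :=
    { toFun := fun s => u ^ (Multiplicative.toAdd s 0) * v ^ (Multiplicative.toAdd s 1)
      map_one' := by simp
      map_mul' := fun s t => by
        simp only [toAdd_mul, Finsupp.add_apply, pow_add, mul_assoc]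
        congr 1
        rw [← mul_assoc, ← mul_assoc, ((huv.pow_left _).pow_right _).eq] }
  let g : MvPolynomial (Fin 2) k →ₐ[k] H := AddMonoidAlgebra.lift k H (Fin 2 →₀ ℕ) F
  have hg : ∀ s, g (MvPolynomial.monomial s 1) = u ^ (s 0) * v ^ (s 1) := by
    intro s
    have := AddMonoidAlgebra.lift_single (R := k) F s (1 : k)
    rw [one_smul] at this
    exact this
  exact ⟨g, by rw [MvPolynomial.X, hg]; simp, by rw [MvPolynomial.X, hg]; simp⟩

/-- An algebra with the relations and the basis of `Λ[x, y] ⊗ k[u, v]` is isomorphic to it. -/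
theorem exists_algEquiv {H : Type*} [Ring H] [Algebra k H] {x y u v : H} (hxx : x * x = 0)
    (hyy : y * y = 0) (hyx : y * x = -(x * y)) (hux : Commute u x) (huy : Commute u y)
    (hvx : Commute v x) (hvy : Commute v y) (huv : Commute u v)
    (hli : LinearIndependent k fun z : ℕ × ℕ =>
      u ^ (z.1 / 2) * x ^ (z.1 % 2) * (v ^ (z.2 / 2) * y ^ (z.2 % 2)))
    (hspan : Submodule.span k (Set.range fun z : ℕ × ℕ =>
      u ^ (z.1 / 2) * x ^ (z.1 % 2) * (v ^ (z.2 / 2) * y ^ (z.2 % 2))) = ⊤) :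
    ∃ e : (ExteriorAlgebra k (Fin 2 → k) ⊗[k] MvPolynomial (Fin 2) k) ≃ₐ[k] H,
      e (ExteriorAlgebra.ι k (Pi.single 0 1) ⊗ₜ[k] 1) = x ∧
      e (ExteriorAlgebra.ι k (Pi.single 1 1) ⊗ₜ[k] 1) = y ∧
      e (1 ⊗ₜ[k] MvPolynomial.X 0) = u ∧
      e (1 ⊗ₜ[k] MvPolynomial.X 1) = v := by
  let L : (Fin 2 → k) →ₗ[k] H :=
    (LinearMap.proj 0).smulRight x + (LinearMap.proj 1).smulRight y
  have hLv : ∀ w, L w = w 0 • x + w 1 • y := fun w => rfl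
  let f : ExteriorAlgebra k (Fin 2 → k) →ₐ[k] H := ExteriorAlgebra.lift k ⟨L, fun w => by
    simp only [hLv, add_mul, mul_add, smul_mul_assoc, mul_smul_comm, hxx, hyy, hyx, smul_zero,
      smul_neg]
    rw [zero_add, add_zero, smul_neg, smul_comm (w 0) (w 1), neg_add_cancel]⟩
  obtain ⟨g, hg0, hg1⟩ := exists_mvPolynomial_algHom (k := k) huv
  have hgX : ∀ i, g (MvPolynomial.X i) = if i = 0 then u else v := by
    intro i
    fin_cases i <;> simp [hg0, hg1]
  have hf0 : f (ExteriorAlgebra.ι k (Pi.single 0 1)) = x := by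
    rw [ExteriorAlgebra.lift_ι_apply, hLv]; simp
  have hf1 : f (ExteriorAlgebra.ι k (Pi.single 1 1)) = y := by
    rw [ExteriorAlgebra.lift_ι_apply, hLv]; simp
  have hcomm : ∀ a b, Commute (f a) (g b) := by
    intro a b
    have hu : Commute u (f a) ∧ Commute v (f a) := by
      induction a using ExteriorAlgebra.induction with
      | algebraMap r => rw [AlgHom.commutes]; exact ⟨Algebra.commute_algebraMap_right _ _,
          Algebra.commute_algebraMap_right _ _⟩
      | ι w =>
        rw [ExteriorAlgebra.lift_ι_apply, hLv]
        exact ⟨(hux.smul_right _).add_right (huy.smul_right _),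
          (hvx.smul_right _).add_right (hvy.smul_right _)⟩
      | mul a b ha hb => rw [map_mul]; exact ⟨ha.1.mul_right hb.1, ha.2.mul_right hb.2⟩
      | add a b ha hb => rw [map_add]; exact ⟨ha.1.add_right hb.1, ha.2.add_right hb.2⟩
    induction b using MvPolynomial.induction_on with
    | C r =>
      rw [← MvPolynomial.algebraMap_eq, AlgHom.commutes]
      exact Algebra.commute_algebraMap_right _ _
    | add b b' h h' => rw [map_add]; exact h.add_right h'
    | mul_X b i h =>
      rw [map_mul, hgX]
      refine h.mul_right ?_
      split_ifs
      exacts [hu.1.symm, hu.2.symm]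
  let φ := Algebra.TensorProduct.lift f g hcomm
  let B : ℕ × ℕ → ExteriorAlgebra k (Fin 2 → k) ⊗[k] MvPolynomial (Fin 2) k := fun z =>
    (ExteriorAlgebra.ι k (Pi.single 0 1 : Fin 2 → k) ^ (z.1 % 2) *
      ExteriorAlgebra.ι k (Pi.single 1 1 : Fin 2 → k) ^ (z.2 % 2)) ⊗ₜ[k]
      (MvPolynomial.X 0 ^ (z.1 / 2) * MvPolynomial.X 1 ^ (z.2 / 2) : MvPolynomial (Fin 2) k)
  have hB : ∀ z, φ (B z) = u ^ (z.1 / 2) * x ^ (z.1 % 2) * (v ^ (z.2 / 2) * y ^ (z.2 % 2)) := by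
    intro z
    change φ (_ ⊗ₜ _) = _
    rw [Algebra.TensorProduct.lift_tmul, map_mul, map_mul, map_pow, map_pow, map_pow, map_pow,
      hf0, hf1, hgX, hgX, if_pos rfl, if_neg (by decide)]
    have h1 : Commute (x ^ (z.1 % 2) * y ^ (z.2 % 2)) (u ^ (z.1 / 2)) :=
      ((hux.symm.pow_pow _ _).mul_left (huy.symm.pow_pow _ _))
    rw [← mul_assoc, h1.eq, mul_assoc, mul_assoc, mul_assoc, (hvy.symm.pow_pow _ _).eq]
  have hBspan : Submodule.span k (Set.range B) = ⊤ := by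
    rw [eq_top_iff, ← TensorProduct.map₂_mk_top_top_eq_top, ← exteriorAlgebra_span,
      ← mvPolynomial_span, Submodule.map₂_span_span, Submodule.span_le]
    rintro _ ⟨_, ⟨⟨i, j⟩, rfl⟩, _, ⟨⟨p, q⟩, rfl⟩, rfl⟩
    -- Half of an index encodes the polynomial exponent, its parity the exterior one.
    refine Submodule.subset_span ⟨(2 * p + i % 2, 2 * q + j % 2), ?_⟩
    simp only [B, TensorProduct.mk_apply]
    rw [show (2 * p + i % 2) % 2 = i % 2 by omega, show (2 * q + j % 2) % 2 = j % 2 by omega,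
      show (2 * p + i % 2) / 2 = p by omega, show (2 * q + j % 2) / 2 = q by omega]
  have hinj : Function.Injective φ := by
    rw [injective_iff_map_eq_zero]
    intro t ht
    obtain ⟨c, rfl⟩ := (Finsupp.mem_span_range_iff_exists_finsupp (R := k) (v := B)).1
      (hBspan ▸ Submodule.mem_top : t ∈ Submodule.span k (Set.range B))
    have h0 := linearIndependent_iff.1 hli c
    rw [Finsupp.sum, map_sum] at ht
    simp only [map_smul, hB] at ht
    rw [h0 ht, Finsupp.sum_zero_index]
  have hsurj : Function.Surjective φ := by
    intro h
    obtain ⟨c, rfl⟩ := (Finsupp.mem_span_range_iff_exists_finsupp (R := k)).1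
      (hspan ▸ Submodule.mem_top : h ∈ Submodule.span k (Set.range _))
    refine ⟨c.sum fun z r => r • B z, ?_⟩
    rw [Finsupp.sum, map_sum, Finsupp.sum]
    simp only [map_smul, hB]
  refine ⟨AlgEquiv.ofBijective φ ⟨hinj, hsurj⟩, ?_, ?_, ?_, ?_⟩
  · change φ (_ ⊗ₜ _) = _
    rw [Algebra.TensorProduct.lift_tmul, map_one, mul_one, hf0]
  · change φ (_ ⊗ₜ _) = _
    rw [Algebra.TensorProduct.lift_tmul, map_one, mul_one, hf1]
  · change φ (_ ⊗ₜ _) = _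
    rw [Algebra.TensorProduct.lift_tmul, map_one, one_mul, hgX, if_pos rfl]
  · change φ (_ ⊗ₜ _) = _
    rw [Algebra.TensorProduct.lift_tmul, map_one, one_mul, hgX, if_neg (by decide)]

end Presentation

/-! ### The cohomology algebra and its Massey products -/

namespace Truncated

variable {k A : Type*} [Field k] [Ring A] [Algebra k A] {I : NonUnitalSubalgebra k A}
  {T : Truncated I} {d : ℕ → Submodule k I}

/-- The cocycle `dualX 1`. -/
noncomputable def IsGraded.cocycleX (hT : T.IsGraded d) : cocycles d :=
  ⟨T.dualX 1, bidegree_le_complex (hT.dualX_mem_bidegree 1), T.delta_dualX_one⟩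

/-- The cocycle `massey`. -/
noncomputable def IsGraded.cocycleU (hT : T.IsGraded d) : cocycles d :=
  ⟨T.massey, bidegree_le_complex hT.massey_mem_bidegree, T.delta_massey⟩

theorem IsGraded.pow_mul_pow (hT : T.IsGraded d) (m : ℕ) :
    ((hT.cocycleU ^ (m / 2) * hT.cocycleX ^ (m % 2) : cocycles d) : Fun k I) = T.towerX m := by
  rw [towerX, tower_eq]
  rfl

theorem IsGraded.eq_of_isPure (hT : T.IsGraded d) {z z' : cocycles d} (hz : T.IsPure z)
    (hz' : T.IsPure z') (h : ∀ m, (z : Fun k I) (T.word m) = (z' : Fun k I) (T.word m)) :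
    toCohomology d z = toCohomology d z' := by
  rw [hT.toCohomology_eq_iff]
  intro m n
  rw [← mul_one (z : Fun k I), ← mul_one (z' : Fun k I), shuffle_word_mul hz T.swap.isPure_one,
    shuffle_word_mul hz' T.swap.isPure_one, h]

/-- Both products vanish on every shuffle except the one with lengths `(r, r')`, where they differ
by the shuffle sign. -/
theorem IsGraded.mul_comm_of_isPure (hT : T.IsGraded d) {z z' : cocycles d} (hz : T.IsPure z)
    (hz' : T.swap.IsPure z') {r r' : ℕ} (hr : (z : Fun k I) ∈ forms k I r)
    (hr' : (z' : Fun k I) ∈ forms k I r') :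
    toCohomology d z' * toCohomology d z =
      (-1 : k) ^ (r * r') • (toCohomology d z * toCohomology d z') := by
  rw [← map_mul, ← map_mul, ← map_smul, hT.toCohomology_eq_iff]
  intro m n
  change shuffle _ _ ((z' : Fun k I) * (z : Fun k I)) =
    shuffle _ _ ((-1 : k) ^ (r * r') • ((z : Fun k I) * (z' : Fun k I)))
  rw [shuffle_smul, shuffle_word_mul hz hz', shuffle_word_mul' hz hz']
  by_cases hm : m = r
  · by_cases hn : n = r'
    · rw [hm, hn]
    · rw [hr'.2 (T.swap.word n) (by rw [length_word]; exact_mod_cast hn)]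
      simp
  · rw [hr.2 (T.word m) (by rw [length_word]; exact_mod_cast hm)]
    simp

/-- By degree only the word `[X, X ^ (a - 1)]` matters. There the second factor takes the
coefficient of `X` in `X ^ (a - 1)`, which is zero because `a ≥ 3`. -/
theorem IsGraded.cocycleX_sq (hT : T.IsGraded d) :
    toCohomology d hT.cocycleX * toCohomology d hT.cocycleX = 0 := by
  rw [← map_mul, ← map_zero (toCohomology d)]
  refine hT.eq_of_isPure ((T.isPure_dualX 1).mul (T.isPure_dualX 1)) (fun _ _ _ _ _ => rfl) ?_
  intro m
  change (T.dualX 1 * T.dualX 1) (T.word m) = 0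
  by_cases hm : m = 2
  · subst hm
    rw [word, alternating, mul_apply_cons_of_forms_one (T.dualX_mem_forms 1), alternating,
      T.dualX_one_powX, mul_zero]
  · exact (mul_mem_forms (T.dualX_mem_forms 1) (T.dualX_mem_forms 1)).2 _
      (by rw [length_word]; norm_num; exact_mod_cast hm)

/-- Only the word `[X, X ^ (a - 1), X]` could separate `u x` from `x u`, and both take the value one
on it. -/
theorem IsGraded.commute_cocycleU_cocycleX (hT : T.IsGraded d) :
    Commute (toCohomology d hT.cocycleU) (toCohomology d hT.cocycleX) := by
  change _ * _ = _ * _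
  rw [← map_mul, ← map_mul]
  refine hT.eq_of_isPure (T.isPure_massey.mul (T.isPure_dualX 1))
    ((T.isPure_dualX 1).mul T.isPure_massey) ?_
  intro m
  change (T.massey * T.dualX 1) (T.word m) = (T.dualX 1 * T.massey) (T.word m)
  by_cases hm : m = 3
  · subst hm
    rw [word, alternating, alternating, mul_apply_of_forms_two T.massey_mem_forms,
      mul_apply_cons_of_forms_one (T.dualX_mem_forms 1), T.massey_X_powX, T.massey_powX_X,
      T.dualX_one_X]
  · have h : ((T.word m).length : ℤ) ≠ 3 := by rw [length_word]; exact_mod_cast hm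
    rw [(mul_mem_forms T.massey_mem_forms (T.dualX_mem_forms 1)).2 _ (by norm_num [h]),
      (mul_mem_forms (T.dualX_mem_forms 1) T.massey_mem_forms).2 _ (by norm_num [h])]

/-- The dual of `X` and the Massey powers are the only choices in a defining system. -/
theorem IsGraded.eq_zero_of_delta_eq_zero (hT : T.IsGraded d) {i : ℕ} (hi : i ≠ 1) {f : Fun k I}
    (hf : f ∈ bidegree d 1 (i * 2)) (hd : delta f = 0) : f = 0 := by
  have hf' := bidegree_le_forms 1 _ hf
  -- The generators have internal degree `2`, whereas `f` has internal degree `2 i ≠ 2`.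
  have hX : f [T.X] = 0 := hf.2.2.2 [T.X] [2] (by simp [hT.X_mem]) (by simp; omega)
  have hY : f [T.Y] = 0 := hf.2.2.2 [T.Y] [2] (by simp [hT.Y_mem]) (by simp; omega)
  -- A one-cocycle vanishes on products, and every other basis monomial of `I` is a product of two
  -- elements of `I`.
  have hmul : ∀ a b : I, f [a * b] = 0 := by
    intro a b
    have := congrFun hd [a, b]
    rw [delta_cons_cons, delta_single, sub_zero] at this
    exact this
  have key : ∀ c : A, f [toAugIdeal T.mem_iff c] = 0 := by
    have hv : ∀ c, ∀ c' : I, c = (c' : A) → f [c'] = 0 → f [toAugIdeal T.mem_iff c] = 0 := by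
      rintro _ c' rfl h
      rwa [toAugIdeal_coe]
    have hmem : ∀ p q : ℕ, p + q ≠ 0 → (T.X : A) ^ p * (T.Y : A) ^ q ∈ I := by
      intro p q hpq
      rw [T.mem_iff, map_mul, map_pow, map_pow, T.ε_X, T.ε_Y, ← pow_add, zero_pow hpq]
    intro c
    induction c using T.induction with
    | hmon p hp q hq =>
      by_cases h0 : p = 0 ∧ q = 0
      · obtain ⟨rfl, rfl⟩ := h0
        have : toAugIdeal T.mem_iff ((T.X : A) ^ 0 * (T.Y : A) ^ 0) = (0 : k) • 0 := by
          ext; simp [toAugIdeal]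
        rw [this]
        exact (hf.2.1 [] [] 0 0).trans (zero_mul _)
      · rcases p with _ | p
        · obtain ⟨q, rfl⟩ := Nat.exists_eq_succ_of_ne_zero (show q ≠ 0 by omega)
          by_cases hq0 : q = 0
          · subst hq0
            exact hv _ T.Y (by simp) hY
          · exact hv _ (T.Y * ⟨_, hmem 0 q (by omega)⟩) (by simp [pow_succ']) (hmul _ _)
        · by_cases h1 : p + q = 0
          · obtain ⟨rfl, rfl⟩ : p = 0 ∧ q = 0 := by omega
            exact hv _ T.X (by simp) hX
          · exact hv _ (T.X * ⟨_, hmem p q h1⟩) (by simp [pow_succ', mul_assoc]) (hmul _ _)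
    | hadd c c' h h' =>
      rw [map_add, show f [toAugIdeal T.mem_iff c + toAugIdeal T.mem_iff c'] = _ from
        hf.1 [] [] _ _]
      simp [h, h']
    | hsmul r c h =>
      rw [map_smul, show f [r • toAugIdeal T.mem_iff c] = _ from hf.2.1 [] [] _ _]
      simp [h]
  ext w
  by_cases hw : w.length = 1
  · obtain ⟨c, rfl⟩ := List.length_eq_one_iff.1 hw
    have := key c
    rwa [toAugIdeal_coe] at this
  · exact hf'.2 w (by exact_mod_cast hw)

/-- The dual cochains form the only defining system. No nonzero coboundary lives in degree one, so
the class determines `a 1`; afterwards two choices of `a i` differ by a cocycle of internal degree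
`2 i`, which is zero. -/
theorem IsGraded.symMassey_eq (hT : T.IsGraded d) :
    symMassey d 1 2 T.a (toCohomology d hT.cocycleX) = {toCohomology d hT.cocycleU} := by
  have ha := T.three_le_a
  have hsum : ∀ n, ∀ a : ℕ → Fun k I, (∀ j ∈ Finset.Icc 1 n, a j = T.dualX j) →
      ∑ j ∈ Finset.Icc 1 n, -sign (a j) * a (n + 1 - j) =
        ∑ j ∈ Finset.Icc 1 n, T.dualX j * T.dualX (n + 1 - j) := by
    intro n a h
    refine Finset.sum_congr rfl fun j hj => ?_
    have hj' := Finset.mem_Icc.1 hj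
    rw [h j hj, h (n + 1 - j) (Finset.mem_Icc.2 (by omega)),
      sign_of_mem_forms_one (T.dualX_mem_forms j)]
  have hδ : ∀ i ∈ Finset.Icc 2 (T.a - 1), ∀ a : ℕ → Fun k I,
      (∀ j ∈ Finset.Icc 1 (i - 1), a j = T.dualX j) →
      ∑ j ∈ Finset.Icc 1 (i - 1), -sign (a j) * a (i - j) = delta (T.dualX i) := by
    intro i hi a h
    have hi' := Finset.mem_Icc.1 hi
    have := hsum (i - 1) a h
    rw [Nat.sub_add_cancel (by omega)] at this
    rw [this, T.delta_dualX (by omega)]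
  have hM : ∀ a : ℕ → Fun k I, (∀ j ∈ Finset.Icc 1 (T.a - 1), a j = T.dualX j) →
      ∑ j ∈ Finset.Icc 1 (T.a - 1), -sign (a j) * a (T.a - j) = T.massey := by
    intro a h
    have := hsum (T.a - 1) a h
    rwa [Nat.sub_add_cancel (by omega)] at this
  ext β
  rw [Set.mem_singleton_iff]
  constructor
  · rintro ⟨a, h1, ⟨z, hz, hzx⟩, h2, z', hz', rfl⟩
    have hdeg : ∀ i ∈ Finset.Icc 1 (T.a - 1), a i ∈ bidegree d 1 (i * 2) := by
      intro i hi
      simpa using h1 i hi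
    have key : ∀ i, i ∈ Finset.Icc 1 (T.a - 1) → a i = T.dualX i := by
      intro i
      induction i using Nat.strong_induction_on with
      | _ i ih =>
        intro hi
        have hi' := Finset.mem_Icc.1 hi
        by_cases h : i = 1
        · subst h
          obtain ⟨c, hc, hzc⟩ := Cobar.toCohomology_eq_iff.1 hzx
          ext w
          by_cases hw : w.length = 1
          · obtain ⟨e, rfl⟩ := List.length_eq_one_iff.1 hw
            have := congrFun hzc [e]
            rw [delta_single] at this
            rw [← hz]
            exact sub_eq_zero.1 this.symm
          · rw [(bidegree_le_forms _ _ (hdeg 1 hi)).2 w (by exact_mod_cast hw),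
              (T.dualX_mem_forms 1).2 w (by exact_mod_cast hw)]
        · rw [← sub_eq_zero]
          refine hT.eq_zero_of_delta_eq_zero h
            (sub_mem (hdeg i hi) (hT.dualX_mem_bidegree i)) ?_
          have hi2 : i ∈ Finset.Icc 2 (T.a - 1) := Finset.mem_Icc.2 (by omega)
          rw [delta_sub, h2 i hi2, hδ i hi2 a, sub_self]
          intro j hj
          have hj' := Finset.mem_Icc.1 hj
          exact ih j (by omega) (Finset.mem_Icc.2 (by omega))
    congr 1
    ext1
    rw [hz', hM a key]
    rfl
  · rintro rfl
    refine ⟨T.dualX, fun i _ => by simpa using hT.dualX_mem_bidegree i,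
      ⟨hT.cocycleX, rfl, rfl⟩, fun i hi => (hδ i hi _ fun _ _ => rfl).symm,
      hT.cocycleU, (hM _ fun _ _ => rfl).symm, rfl⟩

/-- The cohomology of a truncated polynomial algebra on two generators. -/
theorem IsGraded.exists_cohomology (hT : T.IsGraded d) :
    ∃ x ∈ cohomologyPart d 1 2, ∃ y ∈ cohomologyPart d 1 2,
    ∃ u ∈ cohomologyPart d 2 (2 * T.a), ∃ v ∈ cohomologyPart d 2 (2 * T.b),
      symMassey d 1 2 T.a x = {u} ∧ symMassey d 1 2 T.b y = {v} ∧
      ∃ e : (ExteriorAlgebra k (Fin 2 → k) ⊗[k] MvPolynomial (Fin 2) k) ≃ₐ[k] Cohomology d,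
        e (ExteriorAlgebra.ι k (Pi.single 0 1) ⊗ₜ[k] 1) = x ∧
        e (ExteriorAlgebra.ι k (Pi.single 1 1) ⊗ₜ[k] 1) = y ∧
        e (1 ⊗ₜ[k] MvPolynomial.X 0) = u ∧
        e (1 ⊗ₜ[k] MvPolynomial.X 1) = v := by
  have hS := hT.swap
  refine ⟨toCohomology d hT.cocycleX, ⟨hT.cocycleX, hT.dualX_mem_bidegree 1, rfl⟩,
    toCohomology d hS.cocycleX, ⟨hS.cocycleX, hS.dualX_mem_bidegree 1, rfl⟩,
    toCohomology d hT.cocycleU, ⟨hT.cocycleU, hT.massey_mem_bidegree, rfl⟩,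
    toCohomology d hS.cocycleU, ⟨hS.cocycleU, hS.massey_mem_bidegree, rfl⟩,
    hT.symMassey_eq, hS.symMassey_eq, ?_⟩
  have hX := T.isPure_dualX 1
  have hY := T.swap.isPure_dualX 1
  have hU := T.isPure_massey
  have hV := T.swap.isPure_massey
  have dX : (hT.cocycleX : Fun k I) ∈ forms k I (1 : ℕ) := T.dualX_mem_forms 1
  have dY : (hS.cocycleX : Fun k I) ∈ forms k I (1 : ℕ) := T.swap.dualX_mem_forms 1
  have dU : (hT.cocycleU : Fun k I) ∈ forms k I (2 : ℕ) := T.massey_mem_forms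
  have dV : (hS.cocycleU : Fun k I) ∈ forms k I (2 : ℕ) := T.swap.massey_mem_forms
  have hmon : ∀ z : ℕ × ℕ, toCohomology d hT.cocycleU ^ (z.1 / 2) *
      toCohomology d hT.cocycleX ^ (z.1 % 2) * (toCohomology d hS.cocycleU ^ (z.2 / 2) *
      toCohomology d hS.cocycleX ^ (z.2 % 2)) =
      toCohomology d (hT.cocycleU ^ (z.1 / 2) * hT.cocycleX ^ (z.1 % 2) *
        (hS.cocycleU ^ (z.2 / 2) * hS.cocycleX ^ (z.2 % 2))) := by
    intro z
    simp only [map_mul, map_pow]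
  have hcoe : ∀ z : ℕ × ℕ, ((hT.cocycleU ^ (z.1 / 2) * hT.cocycleX ^ (z.1 % 2) *
      (hS.cocycleU ^ (z.2 / 2) * hS.cocycleX ^ (z.2 % 2)) : cocycles d) : Fun k I) =
      T.towerX z.1 * T.swap.towerX z.2 := by
    intro z
    rw [← hT.pow_mul_pow, ← hS.pow_mul_pow]
    rfl
  refine exists_algEquiv hT.cocycleX_sq hS.cocycleX_sq ?_ hT.commute_cocycleU_cocycleX ?_ ?_
    hS.commute_cocycleU_cocycleX ?_ ?_ ?_
  · rw [hT.mul_comm_of_isPure hX hY dX dY]; simp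
  · have := hT.mul_comm_of_isPure hU hY dU dY
    exact (by simpa using this : _ = _).symm
  · have := hT.mul_comm_of_isPure hX hV dX dV
    exact (by simpa using this : _ = _)
  · have := hT.mul_comm_of_isPure hU hV dU dV
    rw [Even.neg_one_pow (by decide), one_smul] at this
    exact this.symm
  · simp only [hmon]
    rw [linearIndependent_iff]
    intro c hc
    rw [Finsupp.linearCombination_apply, Finsupp.sum] at hc
    simp only [← map_smul] at hc
    rw [← map_sum, hT.toCohomology_eq_zero_iff] at hc
    ext x
    have h := hc x.1 x.2
    let L : Fun k I →ₗ[k] k :=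
      { toFun := shuffle (T.word x.1) (T.swap.word x.2)
        map_add' := shuffle_add _ _
        map_smul' := shuffle_smul _ _ }
    change (L ∘ₗ (cocycles d).val.toLinearMap) _ = 0 at h
    rw [map_sum] at h
    have h3 : ∀ y : ℕ × ℕ, (L ∘ₗ (cocycles d).val.toLinearMap)
        (c y • (hT.cocycleU ^ (y.1 / 2) * hT.cocycleX ^ (y.1 % 2) *
          (hS.cocycleU ^ (y.2 / 2) * hS.cocycleX ^ (y.2 % 2)))) = if x = y then c y else 0 := by
      intro y
      rw [map_smul]
      change c y • shuffle (T.word x.1) (T.swap.word x.2) (((hT.cocycleU ^ (y.1 / 2) *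
        hT.cocycleX ^ (y.1 % 2) * (hS.cocycleU ^ (y.2 / 2) * hS.cocycleX ^ (y.2 % 2)) :
        cocycles d)) : Fun k I) = _
      rw [hcoe, shuffle_word_mul (T.isPure_towerX _) (T.swap.isPure_towerX _), towerX_word,
        towerX_word]
      by_cases hxy : x = y
      · subst hxy; simp
      · rw [if_neg hxy]
        have : ¬ (y.1 = x.1 ∧ y.2 = x.2) := fun h => hxy (Prod.ext h.1.symm h.2.symm)
        by_cases h1 : y.1 = x.1
        · simp [show ¬ y.2 = x.2 from fun h2 => this ⟨h1, h2⟩]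
        · simp [h1]
    simp only [h3] at h
    rw [Finset.sum_ite_eq] at h
    by_cases hx : x ∈ c.support
    · simpa [hx] using h
    · simpa using hx
  · simp only [hmon]
    rw [eq_top_iff]
    intro h _
    obtain ⟨z, rfl⟩ := Ideal.Quotient.mk_surjective h
    obtain ⟨f, hf, g, hg, hz⟩ := hT.exists_span_add_delta z
    obtain ⟨c, rfl⟩ := (Finsupp.mem_span_range_iff_exists_finsupp).1 hf
    have : toCohomology d z = toCohomology d (∑ y ∈ c.support,
        c y • (hT.cocycleU ^ (y.1 / 2) * hT.cocycleX ^ (y.1 % 2) *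
          (hS.cocycleU ^ (y.2 / 2) * hS.cocycleX ^ (y.2 % 2)))) := by
      refine Cobar.toCohomology_eq_iff.2 ⟨g, hg, ?_⟩
      have h1 : ((∑ y ∈ c.support, c y • (hT.cocycleU ^ (y.1 / 2) * hT.cocycleX ^ (y.1 % 2) *
          (hS.cocycleU ^ (y.2 / 2) * hS.cocycleX ^ (y.2 % 2))) : cocycles d) : Fun k I) =
          c.sum fun y r => r • (T.towerX y.1 * T.swap.towerX y.2) := by
        rw [AddSubmonoidClass.coe_finsetSum]
        refine Finset.sum_congr rfl fun y _ => ?_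
        exact congrArg (c y • ·) (hcoe y)
      rw [h1, hz]
      abel
    change toCohomology d z ∈ _
    rw [this, map_sum]
    refine sum_mem fun y _ => ?_
    rw [map_smul]
    exact Submodule.smul_mem _ _ (Submodule.subset_span ⟨y, rfl⟩)

end Truncated

end Cobar

namespace MetacyclicCohomology

/-! ### Metacyclic groups -/

theorem mem_lowerSeries_one (p : ℕ) {G : Type*} [Group G] (g : G) :
    g ∈ lowerSeries p G 1 := by
  rw [(isRestrictedNSeq_lowerSeries p G).one]
  trivial

theorem pow_mem_lowerSeries (p : ℕ) {G : Type*} [Group G] (a : G) (K : ℕ) :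
    a ^ p ^ K ∈ lowerSeries p G (p ^ K) := by
  have hS := isRestrictedNSeq_lowerSeries p G
  induction K with
  | zero => rw [pow_zero, hS.one]; trivial
  | succ K ih =>
    have := hS.pow _ _ ih
    rwa [← pow_mul, ← pow_succ, ← pow_succ'] at this

/-- The normal form in the metacyclic group `P(m, n, q, l)`. -/
structure IsMetacyclic (p m n q t : ℕ) {G : Type*} [Group G] (x y : G) : Prop where
  x_pow : x ^ p ^ m = 1
  y_pow : y ^ p ^ n = x ^ p ^ q
  y_mul_x : y * x = x ^ t * y
  modEq : t ≡ 1 [MOD p]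
  closure : Subgroup.closure {x, y} = ⊤
  normalForm : ∀ i j i' j' : ℕ, x ^ i * y ^ j = x ^ i' * y ^ j' →
    ∃ c : ℤ, (j : ℤ) - j' = p ^ n * c ∧ (p ^ m : ℤ) ∣ i - i' + p ^ q * c

namespace IsMetacyclic

variable {p m n q t : ℕ} {G : Type*} [Group G] {x y : G}

theorem y_pow_mul_x_pow (h : IsMetacyclic p m n q t x y) (i j : ℕ) : y ^ j * x ^ i = x ^
    (i * t ^ j) * y ^ j := by
  have h1 : ∀ i, y * x ^ i = x ^ (i * t) * y := by
    intro i
    induction i with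
    | zero => simp
    | succ i ih =>
      rw [pow_succ, ← mul_assoc, ih, mul_assoc, h.y_mul_x, ← mul_assoc, ← pow_add]
      congr 2; ring
  induction j with
  | zero => simp
  | succ j ih =>
    rw [pow_succ', mul_assoc, ih, ← mul_assoc, h1, mul_assoc, ← pow_succ']
    congr 2; ring

theorem mul_eq (h : IsMetacyclic p m n q t x y) (i j i' j' : ℕ) :
    x ^ i * y ^ j * (x ^ i' * y ^ j') = x ^ (i + i' * t ^ j) * y ^ (j + j') := by
  rw [mul_assoc, ← mul_assoc (y ^ j), h.y_pow_mul_x_pow, pow_add, pow_add]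
  simp only [mul_assoc]

theorem y_pow_mul (h : IsMetacyclic p m n q t x y) (j : ℕ) : y ^ (p ^ (m + n) * j) = 1 := by
  rw [show p ^ (m + n) * j = p ^ n * (p ^ m * j) by ring, pow_mul, h.y_pow, ← pow_mul,
    show p ^ q * (p ^ m * j) = p ^ m * (p ^ q * j) by ring, pow_mul, h.x_pow, one_pow]

theorem x_pow_mul (h : IsMetacyclic p m n q t x y) (K i : ℕ) : x ^ (p ^ (m + K) * i) = 1 := by
  rw [pow_add, mul_assoc, pow_mul, h.x_pow, one_pow]

theorem pow_modEq (h : IsMetacyclic p m n q t x y) (j : ℕ) : t ^ j ≡ 1 [MOD p] := by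
  simpa using h.modEq.pow j

/-- Starting from `t ^ s ≡ 1` modulo `p`, each `p`-th power gains one factor `p`. -/
theorem dvd_pow_sub_one (h : IsMetacyclic p m n q t x y) {K j : ℕ} (hj : p ^ K ∣ j) :
    (p ^ (K + 1) : ℤ) ∣ (t : ℤ) ^ j - 1 := by
  obtain ⟨s, rfl⟩ := hj
  have h1 : (p : ℤ) ∣ (t : ℤ) ^ s - 1 := by
    have := (h.pow_modEq s).symm
    rw [Nat.modEq_iff_dvd] at this
    exact_mod_cast this
  rw [mul_comm, pow_mul]
  generalize (t : ℤ) ^ s = u at h1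
  have := dvd_sub_pow_of_dvd_sub (R := ℤ) (p := p) (a := u) (b := 1) (by simpa using h1) K
  simpa using this

theorem pow_eq (h : IsMetacyclic p m n q t x y) (i j N : ℕ) : (x ^ i * y ^ j) ^ N =
    x ^ (i * ∑ s ∈ Finset.range N, t ^ (j * s)) * y ^ (j * N) := by
  induction N with
  | zero => simp
  | succ N ih =>
    rw [pow_succ, ih, h.mul_eq, Finset.sum_range_succ, mul_add, mul_add, mul_one]

/-- The subgroup of the elements `x ^ i y ^ j` with `i`, `j` divisible by `p ^ K`. -/
def powers [Fact p.Prime] (h : IsMetacyclic p m n q t x y) (K : ℕ) : Subgroup G where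
  carrier := {g | ∃ i j : ℕ, p ^ K ∣ i ∧ p ^ K ∣ j ∧ g = x ^ i * y ^ j}
  one_mem' := ⟨0, 0, by simp⟩
  mul_mem' := by
    rintro _ _ ⟨i, j, hi, hj, rfl⟩ ⟨i', j', hi', hj', rfl⟩
    exact ⟨_, _, dvd_add hi (hi'.mul_right _), dvd_add hj hj', h.mul_eq _ _ _ _⟩
  inv_mem' := by
    rintro _ ⟨i, j, hi, hj, rfl⟩
    have hp : 0 < p := (Fact.out : p.Prime).pos
    -- Exponents are natural numbers, so inverses are written as powers with exponent `p ^ (m + n) -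
    -- 1`; both generators have order dividing `p ^ (m + n)`.
    have h1 : y ^ (j * (p ^ (m + n) - 1)) = (y ^ j)⁻¹ := by
      rw [eq_inv_iff_mul_eq_one, ← pow_add, ← h.y_pow_mul j]
      congr 1
      have : 0 < p ^ (m + n) := pow_pos hp _
      obtain ⟨N, hN⟩ := Nat.exists_eq_succ_of_ne_zero this.ne'
      rw [hN, Nat.succ_sub_one, Nat.succ_eq_add_one]; ring
    have h2 : x ^ (i * (p ^ (m + n) - 1)) = (x ^ i)⁻¹ := by
      rw [eq_inv_iff_mul_eq_one, ← pow_add, ← h.x_pow_mul n i]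
      congr 1
      have : 0 < p ^ (m + n) := pow_pos hp _
      obtain ⟨N, hN⟩ := Nat.exists_eq_succ_of_ne_zero this.ne'
      rw [hN, Nat.succ_sub_one, Nat.succ_eq_add_one]; ring
    refine ⟨_, _, (hi.mul_right (p ^ (m + n) - 1)).mul_right (t ^ (j * (p ^ (m + n) - 1))),
      hj.mul_right (p ^ (m + n) - 1), ?_⟩
    rw [← h.y_pow_mul_x_pow, h1, h2, mul_inv_rev]

variable [Fact p.Prime]

theorem zpow_mem_powers (h : IsMetacyclic p m n q t x y) {K : ℕ} {D : ℤ} (hD : (p ^ K : ℤ) ∣ D) :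
    x ^ D ∈ h.powers K := by
  have hp : (0 : ℤ) < p := by exact_mod_cast (Fact.out : p.Prime).pos
  -- The modulus `p ^ (m + K)`, rather than `p ^ m`, preserves divisibility by `p ^ K` even when `K
  -- > m`.
  set E := D % (p ^ (m + K) : ℤ) with hE
  have h0 : 0 ≤ E := Int.emod_nonneg _ (pow_pos hp _).ne'
  have h1 : (p ^ K : ℤ) ∣ E :=
    by
    rw [hE, Int.emod_def]
    exact dvd_sub hD ((pow_dvd_pow _ (Nat.le_add_left _ _)).mul_right _)
  have h2 : x ^ D = x ^ E := by
    have := Int.emod_add_mul_ediv D (p ^ (m + K))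
    rw [← this, zpow_add, zpow_mul]
    have h3 : x ^ ((p : ℤ) ^ (m + K)) = 1 := by
      have := h.x_pow_mul K 1
      rw [mul_one, ← zpow_natCast] at this
      exact_mod_cast this
    rw [h3, one_zpow, mul_one]
  refine ⟨E.toNat, 0, ?_, dvd_zero _, ?_⟩
  · have : ((p ^ K : ℕ) : ℤ) ∣ (E.toNat : ℤ) := by
      rw [Int.toNat_of_nonneg h0]; exact_mod_cast h1
    exact_mod_cast this
  · rw [pow_zero, mul_one, h2, ← zpow_natCast, Int.toNat_of_nonneg h0]

theorem powers_antitone (h : IsMetacyclic p m n q t x y) : Antitone h.powers := by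
  rintro K K' hK _ ⟨i, j, hi, hj, rfl⟩
  exact ⟨i, j, (pow_dvd_pow p hK).trans hi, (pow_dvd_pow p hK).trans hj, rfl⟩

theorem powers_zero (h : IsMetacyclic p m n q t x y) : h.powers 0 = ⊤ := by
  rw [eq_top_iff, ← h.closure, Subgroup.closure_le]
  rintro g (rfl | rfl)
  · exact ⟨1, 0, by simp, by simp, by simp⟩
  · exact ⟨0, 1, by simp, by simp, by simp⟩

/-- Multiplying two normal forms in either order changes only the exponent of `x`, by `i' (t ^ j -
1) - i (t ^ j' - 1)`. Each difference `t ^ j - 1` carries one factor `p` beyond the power known to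
divide `j`. -/
theorem comm_mem_powers (h : IsMetacyclic p m n q t x y) {K K' : ℕ} {a b : G}
    (ha : a ∈ h.powers K) (hb : b ∈ h.powers K') :
    a⁻¹ * b⁻¹ * a * b ∈ h.powers (K + K' + 1) := by
  obtain ⟨i, j, hi, hj, ha'⟩ := inv_mem ha
  obtain ⟨i', j', hi', hj', hb'⟩ := inv_mem hb
  have h1 : a⁻¹ * b⁻¹ * a * b = (a⁻¹ * b⁻¹) * (b⁻¹ * a⁻¹)⁻¹ := by group
  have h2 : a⁻¹ * b⁻¹ * (b⁻¹ * a⁻¹)⁻¹ =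
      x ^ (((i + i' * t ^ j : ℕ) : ℤ) - ((i' + i * t ^ j' : ℕ) : ℤ)) := by
    rw [ha', hb', h.mul_eq, h.mul_eq, add_comm j' j, mul_inv_rev, zpow_sub, zpow_natCast,
      zpow_natCast]
    group
  rw [h1, h2]
  refine h.zpow_mem_powers ?_
  have e : ((i + i' * t ^ j : ℕ) : ℤ) - ((i' + i * t ^ j' : ℕ) : ℤ) =
      i' * ((t : ℤ) ^ j - 1) - i * ((t : ℤ) ^ j' - 1) := by push_cast; ring
  rw [e]
  refine dvd_sub ?_ ?_
  · rw [show K + K' + 1 = K' + (K + 1) by ring, pow_add]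
    exact mul_dvd_mul (by exact_mod_cast hi') (h.dvd_pow_sub_one hj)
  · rw [add_assoc, pow_add]
    exact mul_dvd_mul (by exact_mod_cast hi) (h.dvd_pow_sub_one hj')

/-- With `t ^ j = 1 + p e` the sum is `p + p e (0 + 1 + ⋯ + (p - 1))` modulo `p ^ 2`, and the inner
sum is divisible by `p` because `p` is odd. -/
theorem sum_pow_modEq (h : IsMetacyclic p m n q t x y) (hp : p ≠ 2) (j : ℕ) :
    ∑ s ∈ Finset.range p, t ^ (j * s) ≡ p [MOD p ^ 2] := by
  have hp' : p.Prime := Fact.out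
  obtain ⟨e, he⟩ : ∃ e : ℤ, (t : ℤ) ^ j = 1 + p * e := by
    have := (h.pow_modEq j).symm
    rw [Nat.modEq_iff_dvd] at this
    obtain ⟨e, he⟩ := this
    exact ⟨e, by push_cast at he; linarith⟩
  have h1 : ∀ s : ℕ, ∃ f : ℤ, (t : ℤ) ^ (j * s) = 1 + p * e * s + p ^ 2 * f := by
    intro s
    rw [pow_mul, he]
    induction s with
    | zero => exact ⟨0, by simp⟩
    | succ s ih =>
      obtain ⟨f, hf⟩ := ih
      refine ⟨f * (1 + p * e) + e ^ 2 * s, ?_⟩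
      rw [pow_succ, hf]; push_cast; ring
  choose f hf using h1
  have h2 : ∑ s ∈ Finset.range p, (s : ℤ) = p * ((p - 1) / 2 : ℕ) := by
    have h3 : p = 2 * ((p - 1) / 2) + 1 := by
      rcases hp'.eq_two_or_odd with h | h
      · exact absurd h hp
      · omega
    have h4 := Finset.sum_range_id_mul_two p
    have h5 : (∑ s ∈ Finset.range p, s) * 2 = (p * ((p - 1) / 2)) * 2 := by
      rw [h4, mul_assoc]; congr 1; omega
    rw [← Nat.cast_sum, Nat.eq_of_mul_eq_mul_right (by norm_num) h5, Nat.cast_mul]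
  refine Nat.ModEq.symm ?_
  rw [Nat.modEq_iff_dvd]
  push_cast
  simp only [hf]
  rw [Finset.sum_add_distrib, Finset.sum_add_distrib, ← Finset.mul_sum, ← Finset.mul_sum, h2]
  refine ⟨e * ((p - 1) / 2 : ℕ) + ∑ s ∈ Finset.range p, f s, ?_⟩
  simp only [Finset.sum_const, Finset.card_range, nsmul_eq_mul, mul_one]
  ring

theorem dvd_sum_pow (h : IsMetacyclic p m n q t x y) (hp : p ≠ 2) (j : ℕ) :
    p ∣ ∑ s ∈ Finset.range p, t ^ (j * s) :=
  ((h.sum_pow_modEq hp j).dvd_iff (Dvd.intro_left (p ^ 1) (by ring))).2 dvd_rfl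

theorem pow_mem_powers (h : IsMetacyclic p m n q t x y) (hp : p ≠ 2) {K : ℕ} {a : G}
    (ha : a ∈ h.powers K) :
    a ^ p ∈ h.powers (K + 1) := by
  obtain ⟨i, j, hi, hj, rfl⟩ := ha
  refine ⟨_, _, ?_, ?_, h.pow_eq i j p⟩
  · rw [pow_succ]
    exact mul_dvd_mul hi (h.dvd_sum_pow hp j)
  · rw [pow_succ]
    exact mul_dvd_mul hj dvd_rfl

/-- If `i ≤ p ^ K` and `j ≤ p ^ K'`, then `i + j ≤ p ^ (K + K' + 1)`, so the extra factor `p` gained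
by commutators is enough. -/
theorem isRestrictedNSeq (h : IsMetacyclic p m n q t x y) (hp : p ≠ 2) :
    IsRestrictedNSeq p fun i => h.powers (Nat.clog p i) := by
  have hp1 : 1 < p := (Fact.out : p.Prime).one_lt
  refine ⟨by simp [h.powers_zero], by simp [h.powers_zero],
    fun i j hij => h.powers_antitone (Nat.clog_mono_right p hij), ?_, ?_⟩
  · intro i j a ha b hb
    refine h.powers_antitone (Nat.clog_le_of_le_pow ?_) (h.comm_mem_powers ha hb)
    have h1 := Nat.le_pow_clog hp1 i
    have h2 := Nat.le_pow_clog hp1 j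
    have h3 : p ^ Nat.clog p i ≤ p ^ (Nat.clog p i + Nat.clog p j) :=
      Nat.pow_le_pow_right hp1.le (Nat.le_add_right _ _)
    have h4 : p ^ Nat.clog p j ≤ p ^ (Nat.clog p i + Nat.clog p j) :=
      Nat.pow_le_pow_right hp1.le (Nat.le_add_left _ _)
    rw [pow_succ]
    nlinarith
  · intro i a ha
    refine h.powers_antitone (Nat.clog_le_of_le_pow ?_) (h.pow_mem_powers hp ha)
    rw [pow_succ']
    exact Nat.mul_le_mul_left p (Nat.le_pow_clog hp1 i)

theorem mem_powers_of_mem_lowerSeries (h : IsMetacyclic p m n q t x y) (hp : p ≠ 2) {i : ℕ}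
    {a : G} (ha : a ∈ lowerSeries p G i) :
    a ∈ h.powers (Nat.clog p i) :=
  mem_lowerSeries.1 ha _ (h.isRestrictedNSeq hp)

/-- Together with `mem_powers_of_mem_lowerSeries` this determines the series: it drops only after
powers of `p`. -/
theorem powers_le_lowerSeries (h : IsMetacyclic p m n q t x y) (K : ℕ) :
    h.powers K ≤ lowerSeries p G (p ^ K) := by
  rintro _ ⟨_, _, ⟨i, rfl⟩, ⟨j, rfl⟩, rfl⟩
  rw [pow_mul, pow_mul]
  exact mul_mem (pow_mem (pow_mem_lowerSeries p x K) i) (pow_mem (pow_mem_lowerSeries p y K) j)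

end IsMetacyclic

/-! ### A model of the metacyclic group -/

section Model

variable (N q' n' : ℕ)

/-- The quotient of `ℤ / N × ℤ` by `(-q', n')`. -/
abbrev Carrier : Type :=
  (ZMod N × ℤ) ⧸ AddSubgroup.zmultiples ((-(q' : ZMod N), (n' : ℤ)) : ZMod N × ℤ)

variable {N q' n'}

/-- Multiplication of the first coordinate by `s`. -/
def scale (s : ZMod N) (hs : s * q' = q') : Carrier N q' n' →+ Carrier N q' n' :=
  QuotientAddGroup.map _ _ ((AddMonoidHom.mulLeft s).prodMap (AddMonoidHom.id ℤ)) (by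
    rw [AddSubgroup.zmultiples_le]
    refine AddSubgroup.mem_comap.2 ?_
    simp only [AddMonoidHom.prodMap_def, AddMonoidHom.prod_apply, AddMonoidHom.comp_apply,
      AddMonoidHom.coe_fst, AddMonoidHom.coe_snd, AddMonoidHom.coe_mulLeft, mul_neg, hs,
      AddMonoidHom.id_apply]
    exact AddSubgroup.mem_zmultiples _)

theorem scale_mk (s : ZMod N) (hs : s * q' = q') (a : ZMod N) (b : ℤ) :
    scale s hs (QuotientAddGroup.mk (a, b) : Carrier N q' n') = QuotientAddGroup.mk (s * a, b) :=
  rfl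

variable (N q' n') in
/-- The action of the generator `x`. -/
def permX : Equiv.Perm (Carrier N q' n') := Equiv.addRight (QuotientAddGroup.mk (1, 0))

variable (n') in
/-- The action of the generator `y`. -/
def permY (s r : ZMod N) (hs : s * q' = q') (hr : r * q' = q') (hsr : s * r = 1) :
    Equiv.Perm (Carrier N q' n') where
  toFun z := scale s hs z + QuotientAddGroup.mk (0, 1)
  invFun z := scale r hr (z - QuotientAddGroup.mk (0, 1))
  left_inv z := by
    induction z using QuotientAddGroup.induction_on with | _ z =>
    dsimp only
    rw [add_sub_cancel_right, ← Prod.mk.eta (p := z), scale_mk, scale_mk, ← mul_assoc,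
      mul_comm r s, hsr, one_mul]
  right_inv z := by
    generalize hw : z - QuotientAddGroup.mk (0, 1) = w
    obtain rfl : z = w + QuotientAddGroup.mk (0, 1) := by rw [← hw, sub_add_cancel]
    dsimp only
    rw [add_sub_cancel_right]
    congr 1
    clear hw
    induction w using QuotientAddGroup.induction_on with | _ w =>
    rw [← Prod.mk.eta (p := w), scale_mk, scale_mk, ← mul_assoc, hsr, one_mul]

theorem permX_pow (i : ℕ) (a : ZMod N) (b : ℤ) :
    (permX N q' n' ^ i) (QuotientAddGroup.mk (a, b)) = QuotientAddGroup.mk (a + i, b) := by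
  induction i with
  | zero => simp
  | succ i ih =>
    rw [pow_succ', Equiv.Perm.mul_apply, ih]
    change (QuotientAddGroup.mk ((a + i, b) + (1, 0)) : Carrier N q' n') = _
    rw [Prod.mk_add_mk, add_zero, add_assoc]
    push_cast
    rfl

theorem permY_pow (s r : ZMod N) (hs : s * q' = q') (hr : r * q' = q') (hsr : s * r = 1)
    (j : ℕ) (a : ZMod N) (b : ℤ) :
    (permY n' s r hs hr hsr ^ j) (QuotientAddGroup.mk (a, b)) =
      QuotientAddGroup.mk (s ^ j * a, b + j) := by
  induction j with
  | zero => simp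
  | succ j ih =>
    rw [pow_succ', Equiv.Perm.mul_apply, ih]
    change (QuotientAddGroup.mk ((s * (s ^ j * a), b + j) + (0, 1)) : Carrier N q' n') = _
    rw [Prod.mk_add_mk, add_zero, add_assoc, pow_succ', mul_assoc]
    push_cast
    rfl

end Model

/-- The relation says `y⁻¹ x y = x ^ (p ^ l + 1)`, so conjugation the other way raises `x` to the
inverse `t` of `p ^ l + 1` modulo `p ^ m`. The normal form bounds the group from below and is read
off from an action on `Carrier`. -/
theorem isMetacyclic_metacyclic (p : ℕ) [Fact p.Prime] (m n q l : ℕ) (hl : 1 ≤ l)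
    (hpn : (p ^ l + 1) ^ p ^ n ≡ 1 [MOD p ^ m])
    (hpq : (p ^ l + 1) * p ^ q ≡ p ^ q [MOD p ^ m]) :
    IsMetacyclic p m n q ((p ^ l + 1) ^ (p ^ n - 1))
      (PresentedGroup.of (rels := metacyclicRels p m n q l) 0) (PresentedGroup.of 1) := by
  have hp : 0 < p ^ n := pow_pos (Fact.out : p.Prime).pos _
  set t := (p ^ l + 1) ^ (p ^ n - 1) with ht
  have hrt : (p ^ l + 1) * t = (p ^ l + 1) ^ p ^ n := by
    rw [ht, ← pow_succ', Nat.sub_add_cancel hp]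
  set x : Metacyclic p m n q l := PresentedGroup.of 0 with hx
  set y : Metacyclic p m n q l := PresentedGroup.of 1 with hy
  have hrel : ∀ w ∈ metacyclicRels p m n q l,
      PresentedGroup.mk (metacyclicRels p m n q l) w = 1 :=
    fun w hw => PresentedGroup.one_of_mem hw
  have r1 : x ^ p ^ m = 1 := hrel _ (Or.inl rfl)
  have r2 : y ^ p ^ n * (x ^ p ^ q)⁻¹ = 1 := hrel _ (Or.inr (Or.inl rfl))
  have r3 : x⁻¹ * y⁻¹ * x * y * (x ^ p ^ l)⁻¹ = 1 := hrel _ (Or.inr (Or.inr rfl))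
  have hxt : x ^ ((p ^ l + 1) * t) = x := by
    have : (p ^ l + 1) * t ≡ 1 [MOD p ^ m] := hrt ▸ hpn
    have h1 := pow_eq_pow_iff_modEq.2 (this.of_dvd (orderOf_dvd_of_pow_eq_one r1))
    rwa [pow_one] at h1
  refine ⟨r1, by simpa using mul_inv_eq_one.1 r2, ?_, ?_, ?_, ?_⟩
  · have h1 : y * x ^ (p ^ l + 1) * y⁻¹ = x := by
      have := mul_inv_eq_one.1 r3
      rw [pow_succ', ← this]
      group
    have h2 : y * x * y⁻¹ = x ^ t := by
      have h3 := congrArg (· ^ t) h1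
      simp only [conj_pow, ← pow_mul] at h3
      rwa [hxt] at h3
    rw [← h2]; group
  · have h1 : p ^ l + 1 ≡ 1 [MOD p] := by
      have : p ^ l ≡ 0 [MOD p] := (Nat.modEq_zero_iff_dvd).2 (dvd_pow_self p (by omega))
      simpa using this.add_right 1
    simpa using h1.pow (p ^ n - 1)
  · rw [← PresentedGroup.closure_range_of]
    congr 1
    ext g
    constructor
    · rintro (rfl | rfl)
      exacts [⟨0, rfl⟩, ⟨1, rfl⟩]
    · rintro ⟨i, rfl⟩
      fin_cases i
      exacts [Or.inl rfl, Or.inr rfl]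
  · have hr' : ((p ^ l + 1 : ℕ) : ZMod (p ^ m)) * ((p ^ q : ℕ) : ZMod (p ^ m)) =
        ((p ^ q : ℕ) : ZMod (p ^ m)) := by
      rw [← Nat.cast_mul]; exact (ZMod.natCast_eq_natCast_iff _ _ _).2 hpq
    have hsr : (t : ZMod (p ^ m)) * ((p ^ l + 1 : ℕ) : ZMod (p ^ m)) = 1 := by
      rw [mul_comm, ← Nat.cast_mul, hrt]
      simpa using (ZMod.natCast_eq_natCast_iff _ _ _).2 hpn
    -- Scaling by `t` fixes `p ^ q` modulo `p ^ m`, so it descends to the quotient by `(-p ^ q, p ^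
    -- n)`.
    have hs' : (t : ZMod (p ^ m)) * ((p ^ q : ℕ) : ZMod (p ^ m)) =
        ((p ^ q : ℕ) : ZMod (p ^ m)) := by
      conv_lhs => rw [← hr', ← mul_assoc, hsr, one_mul]
    have htn : (t : ZMod (p ^ m)) ^ p ^ n = 1 := by
      have h1 : ((p ^ l + 1 : ℕ) : ZMod (p ^ m)) ^ p ^ n = 1 := by
        simpa using (ZMod.natCast_eq_natCast_iff _ _ _).2 hpn
      rw [ht, Nat.cast_pow, ← pow_mul, mul_comm, pow_mul, h1, one_pow]
    let PX := permX (p ^ m) (p ^ q) (p ^ n)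
    let PY := permY (p ^ n) (t : ZMod (p ^ m)) _ hs' hr' hsr
    let f : Fin 2 → Equiv.Perm (Carrier (p ^ m) (p ^ q) (p ^ n)) := ![PX, PY]
    have hf : ∀ w ∈ metacyclicRels p m n q l, FreeGroup.lift f w = 1 := by
      rintro w (rfl | rfl | rfl)
      · simp only [map_pow, FreeGroup.lift_apply_of]
        change PX ^ p ^ m = 1
        ext z
        induction z using QuotientAddGroup.induction_on with | _ z =>
        rw [← Prod.mk.eta (p := z), permX_pow, ZMod.natCast_self, add_zero]
        rfl
      · simp only [map_mul, map_inv, map_pow, FreeGroup.lift_apply_of]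
        change PY ^ p ^ n * (PX ^ p ^ q)⁻¹ = 1
        rw [mul_inv_eq_one]
        ext z
        induction z using QuotientAddGroup.induction_on with | _ z =>
        rw [← Prod.mk.eta (p := z), permX_pow, permY_pow, htn, one_mul, QuotientAddGroup.eq]
        refine AddSubgroup.mem_zmultiples_iff.2 ⟨-1, ?_⟩
        ext <;> simp
      · simp only [map_mul, map_inv, map_pow, FreeGroup.lift_apply_of]
        change PX⁻¹ * PY⁻¹ * PX * PY * (PX ^ p ^ l)⁻¹ = 1
        have key : PX * PY = PY * PX ^ (p ^ l + 1) := by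
          ext z
          induction z using QuotientAddGroup.induction_on with | _ z =>
          have h1 := permX_pow (N := p ^ m) (q' := p ^ q) (n' := p ^ n) 1 (t * z.1) (z.2 + 1)
          have h2 := fun a b => permY_pow (n' := p ^ n) _ _ hs' hr' hsr 1 a b
          simp only [pow_one] at h1 h2
          rw [Equiv.Perm.mul_apply, Equiv.Perm.mul_apply, ← Prod.mk.eta (p := z), permX_pow, h2, h2]
          push_cast at h1 ⊢
          rw [h1, mul_add]
          push_cast at hsr
          rw [hsr]
        rw [mul_inv_eq_one, mul_assoc, mul_assoc, key, pow_succ' PX]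
        group
    let F := PresentedGroup.toGroup hf
    intro i j i' j' hij
    -- The element `x ^ i y ^ j` sends the origin to the class of `(i, j)`.
    have h1 := congrArg (fun g => F g (QuotientAddGroup.mk (0, 0))) hij
    simp only [map_mul, map_pow] at h1
    have e0 : F x = PX := PresentedGroup.toGroup.of hf
    have e1 : F y = PY := PresentedGroup.toGroup.of hf
    rw [e0, e1, Equiv.Perm.mul_apply, Equiv.Perm.mul_apply, permY_pow, permY_pow, permX_pow,
      permX_pow, QuotientAddGroup.eq, AddSubgroup.mem_zmultiples_iff] at h1
    obtain ⟨c, hc⟩ := h1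
    rw [Prod.ext_iff] at hc
    obtain ⟨hc1, hc2⟩ := hc
    simp at hc1 hc2
    refine ⟨-c, by linarith, ?_⟩
    have : (((i : ℤ) - i' + p ^ q * -c : ℤ) : ZMod (p ^ m)) = 0 := by
      push_cast
      linear_combination hc1
    rw [ZMod.intCast_zmod_eq_zero_iff_dvd] at this
    exact_mod_cast this

namespace VL

/-! ### The restricted enveloping algebra: generators and maps out of it -/

variable {p : ℕ} [Fact p.Prime] {G : Type*} [Group G]

theorem cls_congr {n n' : ℕ} (hn : n = n') {g : lowerSeries p G n} {g' : lowerSeries p G n'}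
    (hg : (g : G) = g') : cls n g = cls n' g' := by
  subst hn
  rw [Subtype.ext hg]

theorem cls_mul {n : ℕ} (g h : lowerSeries p G n) : cls n (g * h) = cls n g + cls n h := by
  rw [cls, cls, cls, ← map_add]
  rfl

theorem cls_eq_zero {n : ℕ} (g : lowerSeries p G n) (hg : (g : G) ∈ lowerSeries p G (n + 1)) :
    cls n g = 0 := by
  have h : rho n g = 0 :=
    congrArg Additive.ofMul ((QuotientGroup.eq_one_iff g).2 (Subgroup.mem_subgroupOf.2 hg))
  rw [cls, h, map_zero]

theorem cls_pow {n : ℕ} (g : lowerSeries p G n) (N : ℕ) : cls n (g ^ N) = N • cls n g := by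
  induction N with
  | zero => rw [pow_zero, zero_smul]; exact cls_eq_zero _ (one_mem _)
  | succ N ih => rw [pow_succ, cls_mul, ih, succ_nsmul]

theorem ι_mul_sub_mul (r s : ℕ) (g : lowerSeries p G r) (h : lowerSeries p G s) :
    ι p G (cls r g) * ι p G (cls s h) - ι p G (cls s h) * ι p G (cls r g) =
      ι p G (cls (r + s) ⟨(g : G)⁻¹ * (h : G)⁻¹ * g * h,
        (isRestrictedNSeq_lowerSeries p G).comm r s g g.2 h h.2⟩) := by
  have := RingQuot.mkAlgHom_rel (ZMod p) (EnvRel.bracket r s g h)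
  rw [map_sub, map_mul, map_mul] at this
  exact this

theorem ι_pow (r : ℕ) (g : lowerSeries p G r) :
    ι p G (cls r g) ^ p = ι p G (cls (p * r) ⟨(g : G) ^ p,
      (isRestrictedNSeq_lowerSeries p G).pow r g g.2⟩) := by
  have := RingQuot.mkAlgHom_rel (ZMod p) (EnvRel.restriction r g)
  rw [map_pow] at this
  exact this

theorem ι_pow_pow (g : lowerSeries p G 1) (K : ℕ) :
    ι p G (cls 1 g) ^ p ^ K =
      ι p G (cls (p ^ K) ⟨(g : G) ^ p ^ K, pow_mem_lowerSeries p (g : G) K⟩) := by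
  induction K with
  | zero =>
    refine (pow_one (ι p G (cls 1 g))).trans (congrArg _ (cls_congr (pow_zero p).symm ?_))
    simp
  | succ K ih =>
    refine Eq.trans (by rw [pow_succ, pow_mul]) ((congrArg (· ^ p) ih).trans ?_)
    rw [ι_pow]
    exact congrArg _ (cls_congr (by ring) (by simp [pow_succ, pow_mul]))

instance : Nontrivial (VL p G) := (augmentation p G).domain_nontrivial

instance : CharP (VL p G) p :=
  charP_of_injective_algebraMap (FaithfulSMul.algebraMap_injective (ZMod p) (VL p G)) p

theorem adjoin_cls :
    Algebra.adjoin (ZMod p) {z : VL p G | ∃ n g, ι p G (cls n g) = z} = ⊤ := by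
  set S := Algebra.adjoin (ZMod p) {z : VL p G | ∃ n g, ι p G (cls n g) = z}
  rw [eq_top_iff]
  rintro z -
  obtain ⟨w, rfl⟩ := RingQuot.mkAlgHom_surjective (ZMod p) (EnvRel p G) z
  induction w using TensorAlgebra.induction with
  | algebraMap r => rw [AlgHom.commutes]; exact S.algebraMap_mem r
  | ι a =>
    change ι p G a ∈ S
    induction a using DirectSum.induction_on with
    | zero => rw [map_zero]; exact zero_mem S
    | of n a =>
      obtain ⟨g, rfl⟩ : ∃ g, rho n g = a := QuotientGroup.mk_surjective (Additive.toMul a)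
      exact Algebra.subset_adjoin ⟨n, g, rfl⟩
    | add a b ha hb => rw [map_add]; exact add_mem ha hb
  | mul a b ha hb => rw [map_mul]; exact mul_mem ha hb
  | add a b ha hb => rw [map_add]; exact add_mem ha hb

/-- A map on homogeneous elements that respects sums, brackets and restrictions extends to the
enveloping algebra. -/
theorem exists_lift {Q : Type*} [Ring Q] [Algebra (ZMod p) Q]
    (f : ∀ n, lowerSeries p G n → Q) (hmul : ∀ n g h, f n (g * h) = f n g + f n h)
    (hnext : ∀ (n : ℕ) (g : lowerSeries p G n), (g : G) ∈ lowerSeries p G (n + 1) → f n g = 0)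
    (hbracket : ∀ r s g h, f r g * f s h - f s h * f r g =
      f (r + s) ⟨(g : G)⁻¹ * (h : G)⁻¹ * g * h,
        (isRestrictedNSeq_lowerSeries p G).comm r s g g.2 h h.2⟩)
    (hpow : ∀ r g, f r g ^ p = f (p * r) ⟨(g : G) ^ p,
      (isRestrictedNSeq_lowerSeries p G).pow r g g.2⟩) :
    ∃ ψ : VL p G →ₐ[ZMod p] Q, ∀ n g, ψ (ι p G (cls n g)) = f n g := by
  let F : ∀ n, lowerSeries p G n →* Multiplicative Q := fun n =>
    MonoidHom.mk' (fun g => Multiplicative.ofAdd (f n g))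
      fun g h => congrArg Multiplicative.ofAdd (hmul n g h)
  let F' : ∀ n, GradedPiece p G n →+ Q := fun n =>
    MonoidHom.toAdditiveLeft (QuotientGroup.lift (nextSeries p G n) (F n) fun g hg =>
      congrArg Multiplicative.ofAdd (hnext n g (Subgroup.mem_subgroupOf.1 hg)))
  let L : LieG p G →ₗ[ZMod p] Q :=
    DirectSum.toModule (ZMod p) ℕ Q fun n => AddMonoidHom.toZModLinearMap p (F' n)
  have hL : ∀ n g, TensorAlgebra.lift (ZMod p) L (TensorAlgebra.ι (ZMod p) (cls n g)) = f n g := by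
    intro n g
    rw [TensorAlgebra.lift_ι_apply]
    exact DirectSum.toModule_lof (ZMod p) n (rho n g)
  refine ⟨RingQuot.liftAlgHom (ZMod p) ⟨TensorAlgebra.lift (ZMod p) L, ?_⟩, fun n g => ?_⟩
  · rintro _ _ (⟨r, s, g, h⟩ | ⟨r, g⟩)
    · rw [map_sub, map_mul, map_mul, hL, hL, hL, hbracket]
    · rw [map_pow, hL, hL, hpow]
  · exact (RingQuot.liftAlgHom_mkAlgHom_apply _ _ _ _).trans (hL n g)

theorem ι_mem_degreePart (n : ℕ) (g : lowerSeries p G n) :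
    ι p G (cls n g) ∈ degreePart p G (2 * n) :=
  Submodule.subset_span ⟨[⟨n, g⟩], by simp⟩

end VL

/-! ### Maps from the enveloping algebra to commutative algebras -/

namespace IsMetacyclic

variable {p m n q t : ℕ} {G : Type*} [Group G] {x y : G}

section Lift

variable {Q : Type*} [CommRing Q]

theorem natCast_eq_zero_of_dvd {p : ℕ} {Q : Type*} [CommRing Q] [Algebra (ZMod p) Q]
    {i : ℕ} (hi : p ∣ i) : (i : Q) = 0 := by
  rw [← map_natCast (algebraMap (ZMod p) Q), (ZMod.natCast_eq_zero_iff i p).2 hi, map_zero]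

open Classical in
/-- The value on `g = x ^ (p ^ k * i) * y ^ (p ^ k * j)` of the map into `Q` that sends the classes
of `x` and `y` to `U` and `V`. -/
noncomputable def liftFun (p : ℕ) (x y : G) (U V : Q) (k : ℕ) (g : G) : Q :=
  if hg : ∃ z : ℕ × ℕ, g = x ^ (p ^ k * z.1) * y ^ (p ^ k * z.2) then
    (hg.choose.1 : Q) * U ^ p ^ k + (hg.choose.2 : Q) * V ^ p ^ k
  else 0

/-- The relations between `U ^ p ^ k` and `V ^ p ^ k` forced by those between `x` and `y`. -/
def Compatible (p m n q : ℕ) (U V : Q) : Prop :=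
  ∀ (k : ℕ) (i j c e : ℤ), p ^ k * i = -(p ^ q * c) + p ^ m * e → p ^ k * j = p ^ n * c →
    (i : Q) * U ^ p ^ k + (j : Q) * V ^ p ^ k = 0

/-- Two expressions of one group element differ by the relations in `normalForm`, and `Compatible`
says that these do not change the value. -/
theorem liftFun_eq (h : IsMetacyclic p m n q t x y) {U V : Q} (hUV : Compatible p m n q U V)
    (k i j : ℕ) :
    liftFun p x y U V k (x ^ (p ^ k * i) * y ^ (p ^ k * j)) =
      (i : Q) * U ^ p ^ k + (j : Q) * V ^ p ^ k := by
  have hg : ∃ z : ℕ × ℕ,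
    x ^ (p ^ k * i) * y ^ (p ^ k * j) = x ^ (p ^ k * z.1) * y ^ (p ^ k * z.2) := ⟨(i, j), rfl⟩
  rw [liftFun, dif_pos hg]
  obtain ⟨c, hc, e, he⟩ := h.normalForm _ _ _ _ hg.choose_spec.symm
  push_cast at hc he
  have := hUV k (hg.choose.1 - i) (hg.choose.2 - j) c e (by linear_combination he)
    (by linear_combination hc)
  push_cast at this
  linear_combination this

variable [Fact p.Prime]

theorem exists_of_mem_powers (h : IsMetacyclic p m n q t x y) {k : ℕ} {g : G}
    (hg : g ∈ h.powers k) : ∃ i j : ℕ, g = x ^ (p ^ k * i) * y ^ (p ^ k * j) := by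
  obtain ⟨_, _, ⟨i, rfl⟩, ⟨j, rfl⟩, rfl⟩ := hg
  exact ⟨i, j, rfl⟩

variable [Algebra (ZMod p) Q]

theorem liftFun_mul (h : IsMetacyclic p m n q t x y) {U V : Q} (hUV : Compatible p m n q U V)
    {k : ℕ} {g g' : G} (hg : g ∈ h.powers k) (hg' : g' ∈ h.powers k) :
    liftFun p x y U V k (g * g') = liftFun p x y U V k g + liftFun p x y U V k g' := by
  obtain ⟨i, j, rfl⟩ := h.exists_of_mem_powers hg
  obtain ⟨i', j', rfl⟩ := h.exists_of_mem_powers hg'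
  have e : p ^ k * i + p ^ k * i' * t ^ (p ^ k * j) = p ^ k * (i + i' * t ^ (p ^ k * j)) := by ring
  rw [h.mul_eq, e, ← mul_add, h.liftFun_eq hUV, h.liftFun_eq hUV, h.liftFun_eq hUV]
  -- Moving `y` past `x` multiplies exponents by powers of `t ≡ 1` modulo `p`, which is invisible in
  -- `Q`.
  have ht : ((t ^ (p ^ k * j) : ℕ) : Q) = 1 := by
    rw [← map_natCast (algebraMap (ZMod p) Q),
      (ZMod.natCast_eq_natCast_iff _ _ _).2 (h.pow_modEq (p ^ k * j))]
    simp
  rw [Nat.cast_add, Nat.cast_mul, ht]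
  push_cast
  ring

theorem liftFun_eq_zero (h : IsMetacyclic p m n q t x y) {U V : Q} (hUV : Compatible p m n q U V)
    {k : ℕ} {g : G} (hg : g ∈ h.powers (k + 1)) : liftFun p x y U V k g = 0 := by
  obtain ⟨i, j, rfl⟩ := h.exists_of_mem_powers hg
  rw [pow_succ, mul_assoc, mul_assoc, h.liftFun_eq hUV,
    natCast_eq_zero_of_dvd (p := p) (dvd_mul_right p i),
    natCast_eq_zero_of_dvd (p := p) (dvd_mul_right p j)]
  ring

theorem liftFun_pow (h : IsMetacyclic p m n q t x y) (hp : p ≠ 2) {U V : Q}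
    (hUV : Compatible p m n q U V) {k : ℕ} {g : G} (hg : g ∈ h.powers k) :
    liftFun p x y U V k g ^ p = liftFun p x y U V (k + 1) (g ^ p) := by
  have hp' : p.Prime := Fact.out
  obtain ⟨i, j, rfl⟩ := h.exists_of_mem_powers hg
  -- Raising to the power `p` multiplies the exponent of `x` by `p S`, where `S ≡ 1` modulo `p`.
  obtain ⟨S, hS⟩ : p ∣ ∑ s ∈ Finset.range p, t ^ (p ^ k * j * s) :=
    h.dvd_sum_pow hp _
  have hS1 : (S : Q) = 1 := by
    have h1 := h.sum_pow_modEq hp (p ^ k * j)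
    rw [hS, sq] at h1
    have h2 : p * S ≡ p * 1 [MOD p * p] := by rwa [mul_one]
    have h3 := Nat.ModEq.mul_left_cancel' hp'.ne_zero h2
    rw [← map_natCast (algebraMap (ZMod p) Q), (ZMod.natCast_eq_natCast_iff _ _ _).2 h3]
    simp
  have hfermat : ∀ c : ℕ, (c : Q) ^ p = c := by
    intro c
    rw [← map_natCast (algebraMap (ZMod p) Q), ← map_pow, ZMod.pow_card]
  have e1 : p ^ k * i * (p * S) = p ^ (k + 1) * (i * S) := by ring
  have e2 : p ^ k * j * p = p ^ (k + 1) * j := by ring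
  rw [h.pow_eq, hS, e1, e2, h.liftFun_eq hUV, h.liftFun_eq hUV, add_pow_prime_eq hp',
    natCast_eq_zero_of_dvd (p := p) (dvd_refl p), mul_pow, mul_pow, hfermat, hfermat, ← pow_mul,
    ← pow_mul, ← pow_succ, Nat.cast_mul, hS1]
  ring

/-- The graded pieces vanish outside the indices `p ^ k`, so a map is prescribed there only;
additivity, brackets and restrictions follow from the arithmetic of `powers`. -/
theorem exists_lift (h : IsMetacyclic p m n q t x y) (hp : p ≠ 2) {U V : Q}
    (hUV : Compatible p m n q U V) (hx : x ∈ lowerSeries p G 1) (hy : y ∈ lowerSeries p G 1) :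
    ∃ ψ : VL p G →ₐ[ZMod p] Q,
      ψ (VL.ι p G (cls 1 ⟨x, hx⟩)) = U ∧ ψ (VL.ι p G (cls 1 ⟨y, hy⟩)) = V := by
  have hp1 : 1 < p := (Fact.out : p.Prime).one_lt
  have hmem : ∀ r (g : lowerSeries p G r), (g : G) ∈ h.powers (Nat.clog p r) :=
    fun r g => h.mem_powers_of_mem_lowerSeries hp g.2
  -- At `r = 0` the test fails because `p ^ Nat.clog p 0 = 1`, so index zero is sent to zero.
  let f : ∀ r, lowerSeries p G r → Q := fun r g =>
    if p ^ Nat.clog p r = r then liftFun p x y U V (Nat.clog p r) g else 0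
  suffices H : ∃ ψ : VL p G →ₐ[ZMod p] Q, ∀ n g, ψ (VL.ι p G (cls n g)) = f n g by
    obtain ⟨ψ, hψ⟩ := H
    refine ⟨ψ, ?_, ?_⟩
    · have h1 := h.liftFun_eq hUV 0 1 0
      rw [hψ]
      simp only [f, Nat.clog_one_right, pow_zero, if_true]
      simpa using h1
    · have h1 := h.liftFun_eq hUV 0 0 1
      rw [hψ]
      simp only [f, Nat.clog_one_right, pow_zero, if_true]
      simpa using h1
  refine VL.exists_lift f ?_ ?_ ?_ ?_
  · intro r g g'
    simp only [f]
    split_ifs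
    · exact h.liftFun_mul hUV (hmem r g) (hmem r g')
    · rw [add_zero]
  · intro r g hg
    simp only [f]
    split_ifs with hr
    · refine h.liftFun_eq_zero hUV (h.powers_antitone ?_ (h.mem_powers_of_mem_lowerSeries hp hg))
      rw [Nat.succ_le_iff, Nat.lt_clog_iff_pow_lt hp1]
      omega
    · rfl
  · intro r s g g'
    rw [mul_comm, sub_self]
    simp only [f]
    split_ifs with hr
    · refine (h.liftFun_eq_zero hUV (h.powers_antitone ?_
        (h.comm_mem_powers (hmem r g) (hmem s g')))).symm
      have h1 := Nat.le_pow_clog hp1 r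
      have h2 := Nat.le_pow_clog hp1 s
      have h3 : 1 ≤ p ^ Nat.clog p r := Nat.one_le_pow _ _ (by omega)
      have h4 : 1 ≤ p ^ Nat.clog p s := Nat.one_le_pow _ _ (by omega)
      -- When `r + s` is a power of `p`, this strict bound places the commutator at least one step
      -- deeper than its index, where the map is zero.
      have h5 : p ^ Nat.clog p (r + s) < p ^ (Nat.clog p r + Nat.clog p s + 1) := by
        rw [hr, pow_succ, pow_add]
        generalize p ^ Nat.clog p r = A at *
        generalize p ^ Nat.clog p s = B at *
        have h6 : A + B ≤ A * B + 1 := by nlinarith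
        have h7 : A * B * 3 ≤ A * B * p := Nat.mul_le_mul_left _ (by omega)
        have h8 : 1 ≤ A * B := Nat.mul_pos h3 h4
        omega
      have := (Nat.pow_lt_pow_iff_right hp1).1 h5
      omega
    · rfl
  · intro r g
    by_cases hr : p ^ Nat.clog p r = r
    · have hr' : Nat.clog p (p * r) = Nat.clog p r + 1 := by
        conv_lhs => rw [← hr, ← pow_succ', Nat.clog_pow _ _ hp1]
      simp only [f]
      rw [if_pos hr, if_pos (by rw [hr', pow_succ', hr]), hr']
      exact h.liftFun_pow hp hUV (hmem r g)
    · have hr' : p ^ Nat.clog p (p * r) ≠ p * r := by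
        intro h1
        rcases hk : Nat.clog p (p * r) with _ | k
        · rw [hk, pow_zero] at h1
          have := Nat.eq_one_of_mul_eq_one_right h1.symm
          omega
        · rw [hk, pow_succ'] at h1
          have h2 := Nat.eq_of_mul_eq_mul_left (by omega) h1
          exact hr (by rw [← h2, Nat.clog_pow _ _ hp1])
      simp only [f]
      rw [if_neg hr, if_neg hr', zero_pow (by omega)]

end Lift

end IsMetacyclic

/-! ### Generators of the enveloping algebra and their relations -/

namespace VL

variable (p : ℕ) [Fact p.Prime] {G : Type*} [Group G]

/-- The generator of degree `2` given by an element of the group. -/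
def gen (g : G) : VL p G := ι p G (cls 1 ⟨g, mem_lowerSeries_one p g⟩)

theorem gen_mem_degreePart (g : G) : gen p g ∈ degreePart p G 2 := ι_mem_degreePart 1 _

theorem gen_pow (g : G) (K : ℕ) :
    gen p g ^ p ^ K = ι p G (cls (p ^ K) ⟨g ^ p ^ K, pow_mem_lowerSeries p g K⟩) :=
  ι_pow_pow _ K

theorem gen_pow_eq_zero {g : G} {K : ℕ} (hg : g ^ p ^ K ∈ lowerSeries p G (p ^ K + 1)) :
    gen p g ^ p ^ K = 0 := by
  rw [gen_pow, cls_eq_zero _ hg, map_zero]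

end VL

namespace IsMetacyclic

variable {p m n q t : ℕ} {G : Type*} [Group G] {x y : G}

theorem intCast_eq_zero_of_dvd [Fact p.Prime] {Q : Type*} [CommRing Q] [Algebra (ZMod p) Q]
    {i : ℤ} (hi : (p : ℤ) ∣ i) : (i : Q) = 0 := by
  rw [← map_intCast (algebraMap (ZMod p) Q), (ZMod.intCast_zmod_eq_zero_iff_dvd i p).2 hi, map_zero]

/-- In each range of `k`, either a power of a generator is zero or its coefficient is divisible by
`p`. For `q = n` the element `y` goes to `Y + X`, and once `k ≥ n` only the sum `i + j` matters. -/
theorem compatible [Fact p.Prime] {Q : Type*} [CommRing Q] [Algebra (ZMod p) Q] (hqm : q ≤ m)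
    {a b : ℕ} (hab₁ : n ≤ q → a = p ^ m ∧ b = p ^ n)
    (hab₂ : q < n → a = p ^ q ∧ b = p ^ (m + n - q)) {X Y : Q} (hX : X ^ a = 0) (hY : Y ^ b = 0) :
    Compatible p m n q X (if q = n then Y + X else Y) := by
  intro k i j c e h1 h2
  have hp : (p : ℤ) ≠ 0 := by exact_mod_cast (Fact.out : p.Prime).ne_zero
  have hpos : 0 < p := (Fact.out : p.Prime).pos
  have hdvd : ∀ {K : ℕ} {w : ℤ}, (p : ℤ) ^ (K + 1) ∣ p ^ K * w → (p : ℤ) ∣ w := by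
    intro K w hw
    rw [pow_succ] at hw
    exact (mul_dvd_mul_iff_left (pow_ne_zero K hp)).1 hw
  have hle : ∀ {K K' : ℕ} (w : ℤ), K ≤ K' → (p : ℤ) ^ K ∣ p ^ K' * w := fun w hK =>
    (pow_dvd_pow _ hK).mul_right w
  have hzero : ∀ {Z : Q} {K : ℕ}, Z ^ p ^ K = 0 → K ≤ k → Z ^ p ^ k = 0 := by
    intro Z K hZ hK
    exact pow_eq_zero_of_le (Nat.pow_le_pow_right hpos hK) hZ
  have hlt : k < n → (p : ℤ) ∣ j := fun hk => hdvd (h2 ▸ hle c hk)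
  have hge : n ≤ k → c = p ^ (k - n) * j := by
    intro hk
    refine mul_left_cancel₀ (pow_ne_zero n hp) ?_
    rw [← h2, ← mul_assoc, ← pow_add, Nat.add_sub_cancel' hk]
  have hi : k < q → (p : ℤ) ∣ i := fun hk =>
    hdvd (h1 ▸ dvd_add ((hle c hk).neg_right) (hle e (hk.trans_le hqm)))
  rcases lt_trichotomy q n with hqn | hqn | hqn
  · obtain ⟨rfl, rfl⟩ := hab₂ hqn
    rw [if_neg hqn.ne]
    have hX' : (i : Q) * X ^ p ^ k = 0 := by
      rcases lt_or_ge k q with hk | hk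
      · rw [intCast_eq_zero_of_dvd (p := p) (hi hk), zero_mul]
      · rw [hzero hX hk, mul_zero]
    have hY' : (j : Q) * Y ^ p ^ k = 0 := by
      rcases lt_or_ge k (m + n - q) with hk | hk
      · rw [intCast_eq_zero_of_dvd (p := p), zero_mul]
        rcases lt_or_ge k n with hkn | hkn
        · exact hlt hkn
        -- After eliminating `c`, both terms on the right carry a higher power of `p`, because `k <
        -- m + n - q` and `q < n`.
        · have e1 : (p : ℤ) ^ (q + (k - n)) * j = p ^ m * e - p ^ k * i := by
            rw [h1, hge hkn]; ring
          refine hdvd (K := q + (k - n)) ?_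
          rw [e1]
          exact dvd_sub (hle e (by omega)) (hle i (by omega))
      · rw [hzero hY hk, mul_zero]
    rw [hX', hY', add_zero]
  · obtain ⟨rfl, rfl⟩ := hab₁ hqn.ge
    rw [if_pos hqn]
    rcases lt_or_ge k n with hk | hk
    · rw [intCast_eq_zero_of_dvd (p := p) (hi (hqn ▸ hk)),
        intCast_eq_zero_of_dvd (p := p) (hlt hk), zero_mul, zero_mul, add_zero]
    · have hYX : (Y + X) ^ p ^ k = X ^ p ^ k := by
        rcases subsingleton_or_nontrivial Q with hQ | hQ
        · exact Subsingleton.elim _ _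
        · have : CharP Q p := (Algebra.charP_iff (ZMod p) Q p).1 inferInstance
          rw [add_pow_char_pow, hzero hY hk, zero_add]
      rw [hYX]
      rcases lt_or_ge k m with hkm | hkm
      · rw [← add_mul, ← Int.cast_add, intCast_eq_zero_of_dvd (p := p), zero_mul]
        refine hdvd (K := k) ?_
        -- The contributions of `c` cancel because `q = n`.
        have e1 : (p : ℤ) ^ k * (i + j) = p ^ m * e := by
          have : (p : ℤ) ^ k = p ^ n * p ^ (k - n) := by rw [← pow_add, Nat.add_sub_cancel' hk]
          rw [mul_add, h1, hge hk, hqn, this]; ring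
        rw [e1]
        exact hle e hkm
      · rw [hzero hX hkm, mul_zero, mul_zero, add_zero]
  · obtain ⟨rfl, rfl⟩ := hab₁ hqn.le
    rw [if_neg hqn.ne']
    have hX' : (i : Q) * X ^ p ^ k = 0 := by
      rcases lt_or_ge k m with hk | hk
      · rw [intCast_eq_zero_of_dvd (p := p), zero_mul]
        rcases lt_or_ge k n with hkn | hkn
        · exact hi (hkn.trans hqn)
        · refine hdvd (K := k) ?_
          rw [h1, hge hkn, ← mul_assoc, ← pow_add]
          exact dvd_add ((hle j (by omega)).neg_right) (hle e hk)
      · rw [hzero hX hk, mul_zero]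
    have hY' : (j : Q) * Y ^ p ^ k = 0 := by
      rcases lt_or_ge k n with hk | hk
      · rw [intCast_eq_zero_of_dvd (p := p) (hlt hk), zero_mul]
      · rw [hzero hY hk, mul_zero]
    rw [hX', hY', add_zero]

variable [Fact p.Prime]

/-- The commutator of `x` and `y` lies in `Γ p`, hence in `Γ 3` as `p ≥ 3`, so its class in index
two is zero. -/
theorem commute_gen (h : IsMetacyclic p m n q t x y) (hp : p ≠ 2) :
    Commute (VL.gen p x) (VL.gen p y) := by
  have hp2 := (Fact.out : p.Prime).two_le
  refine sub_eq_zero.1 ((VL.ι_mul_sub_mul 1 1 _ _).trans ?_)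
  have hm : ∀ g : G, g ∈ h.powers 0 := fun g => by rw [h.powers_zero]; trivial
  rw [VL.cls_eq_zero, map_zero]
  exact (isRestrictedNSeq_lowerSeries p G).antitone (show 1 + 1 + 1 ≤ p ^ 1 by rw [pow_one]; omega)
    (h.powers_le_lowerSeries 1 (h.comm_mem_powers (hm x) (hm y)))

/-- The series does not drop at an index that is not a power of `p`. -/
theorem ι_cls_eq_zero (h : IsMetacyclic p m n q t x y) (hp : p ≠ 2) {r : ℕ}
    (hr : p ^ Nat.clog p r ≠ r) (g : lowerSeries p G r) : VL.ι p G (cls r g) = 0 := by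
  have h1 := Nat.le_pow_clog (Fact.out : p.Prime).one_lt r
  rw [VL.cls_eq_zero, map_zero]
  exact (isRestrictedNSeq_lowerSeries p G).antitone (show r + 1 ≤ p ^ Nat.clog p r by omega)
    (h.powers_le_lowerSeries _ (h.mem_powers_of_mem_lowerSeries hp g.2))

theorem exists_ι_cls_eq (h : IsMetacyclic p m n q t x y) (hp : p ≠ 2) {k : ℕ}
    (g : lowerSeries p G (p ^ k)) :
    ∃ i j : ℕ, VL.ι p G (cls (p ^ k) g) = i • VL.gen p x ^ p ^ k + j • VL.gen p y ^ p ^ k := by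
  have hg := h.mem_powers_of_mem_lowerSeries hp g.2
  rw [Nat.clog_pow _ _ (Fact.out : p.Prime).one_lt] at hg
  obtain ⟨i, j, hij⟩ := h.exists_of_mem_powers hg
  refine ⟨i, j, ?_⟩
  have hg' : g = ⟨x ^ p ^ k, pow_mem_lowerSeries p x k⟩ ^ i *
      ⟨y ^ p ^ k, pow_mem_lowerSeries p y k⟩ ^ j := by
    ext
    rw [hij, pow_mul, pow_mul]
    rfl
  rw [hg', VL.cls_mul, VL.cls_pow, VL.cls_pow, map_add, map_nsmul, map_nsmul, VL.gen_pow,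
    VL.gen_pow]

/-- If `q < n`, then `x ^ p ^ q = y ^ p ^ n` lies in `Γ (p ^ n)`, deeper than its own index `p ^ q`;
otherwise `x ^ p ^ m = 1` is used. -/
theorem gen_x_pow_eq_zero (h : IsMetacyclic p m n q t x y) {a b : ℕ}
    (hab₁ : n ≤ q → a = p ^ m ∧ b = p ^ n) (hab₂ : q < n → a = p ^ q ∧ b = p ^ (m + n - q)) :
    VL.gen p x ^ a = 0 := by
  have hp1 := (Fact.out : p.Prime).one_lt
  rcases lt_or_ge q n with hqn | hqn
  · rw [(hab₂ hqn).1]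
    refine VL.gen_pow_eq_zero p ?_
    rw [← h.y_pow]
    exact (isRestrictedNSeq_lowerSeries p G).antitone (Nat.pow_lt_pow_right hp1 hqn)
      (pow_mem_lowerSeries p y n)
  · rw [(hab₁ hqn).1]
    refine VL.gen_pow_eq_zero p ?_
    rw [h.x_pow]
    exact one_mem _

/-- For `q > n` the power `y ^ p ^ n = x ^ p ^ q` is too deep. For `q = n` the two generators have
the same `p ^ n`-th power, so their difference is nilpotent. For `q < n` the required power of `y`
is `x ^ p ^ m = 1`. -/
theorem gen_y_pow_eq_zero (h : IsMetacyclic p m n q t x y) (hp : p ≠ 2) (hqm : q ≤ m) {a b : ℕ}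
    (hab₁ : n ≤ q → a = p ^ m ∧ b = p ^ n) (hab₂ : q < n → a = p ^ q ∧ b = p ^ (m + n - q)) :
    (if q = n then VL.gen p y - VL.gen p x else VL.gen p y) ^ b = 0 := by
  have hp1 := (Fact.out : p.Prime).one_lt
  rcases lt_trichotomy q n with hqn | rfl | hqn
  · rw [(hab₂ hqn).2, if_neg hqn.ne]
    refine VL.gen_pow_eq_zero p ?_
    rw [show m + n - q = n + (m - q) by omega, pow_add, pow_mul, h.y_pow, ← pow_mul,
      ← pow_add p q, Nat.add_sub_cancel' hqm, h.x_pow]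
    exact one_mem _
  · rw [(hab₁ le_rfl).2, if_pos rfl,
      sub_pow_char_pow_of_commute p q (h.commute_gen hp).symm, VL.gen_pow, VL.gen_pow, sub_eq_zero]
    exact congrArg _ (VL.cls_congr rfl h.y_pow)
  · rw [(hab₁ hqn.le).2, if_neg hqn.ne']
    refine VL.gen_pow_eq_zero p ?_
    rw [h.y_pow]
    exact (isRestrictedNSeq_lowerSeries p G).antitone (Nat.pow_lt_pow_right hp1 hqn)
      (pow_mem_lowerSeries p x q)

/-- The enveloping algebra is spanned by the monomials in two generators of degree `2`. -/
theorem degreePart_le_span (h : IsMetacyclic p m n q t x y) (hp : p ≠ 2) {X Y : VL p G}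
    (hXY : Commute X Y) (hx : VL.gen p x ∈ Submodule.span (ZMod p) {X, Y})
    (hy : VL.gen p y ∈ Submodule.span (ZMod p) {X, Y}) (r : ℕ) :
    VL.degreePart p G r ≤
      Submodule.span (ZMod p) {z | ∃ i j : ℕ, 2 * (i + j) = r ∧ X ^ i * Y ^ j = z} := by
  set D : ℕ → Submodule (ZMod p) (VL p G) := fun r =>
    Submodule.span (ZMod p) {z | ∃ i j : ℕ, 2 * (i + j) = r ∧ X ^ i * Y ^ j = z} with hD
  have hone : 1 ∈ D 0 := Submodule.subset_span ⟨0, 0, rfl, by simp⟩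
  have hmul : ∀ {s t c d}, c ∈ D s → d ∈ D t → c * d ∈ D (s + t) := by
    intro s t c d hc hd
    refine Submodule.span_induction₂ (p := fun a b _ _ => a * b ∈ D (s + t)) ?_
      (fun _ _ => by rw [zero_mul]; exact zero_mem _)
      (fun _ _ => by rw [mul_zero]; exact zero_mem _)
      (fun _ _ _ _ _ _ h h' => by rw [add_mul]; exact add_mem h h')
      (fun _ _ _ _ _ _ h h' => by rw [mul_add]; exact add_mem h h')
      (fun c _ _ _ _ h => by rw [smul_mul_assoc]; exact Submodule.smul_mem _ c h)
      (fun c _ _ _ _ h => by rw [mul_smul_comm]; exact Submodule.smul_mem _ c h) hc hd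
    rintro _ _ ⟨i, j, hij, rfl⟩ ⟨i', j', hij', rfl⟩
    refine Submodule.subset_span ⟨i + i', j + j', by omega, ?_⟩
    rw [pow_add, pow_add, mul_assoc, mul_assoc, ← mul_assoc (X ^ i'), ← mul_assoc (Y ^ j),
      ((hXY.pow_left _).pow_right _).eq]
  have hpow : ∀ {c : VL p G}, c ∈ D 2 → ∀ N : ℕ, c ^ N ∈ D (2 * N) := by
    intro c hc N
    induction N with
    | zero => rw [pow_zero]; exact hone
    | succ N ih => rw [pow_succ]; exact hmul ih hc
  have hle : Submodule.span (ZMod p) {X, Y} ≤ D 2 := by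
    rw [Submodule.span_le]
    rintro _ (rfl | rfl)
    · exact Submodule.subset_span ⟨1, 0, rfl, by simp⟩
    · exact Submodule.subset_span ⟨0, 1, rfl, by simp⟩
  have hcls : ∀ r (g : lowerSeries p G r), VL.ι p G (cls r g) ∈ D (2 * r) := by
    intro r g
    by_cases hr : p ^ Nat.clog p r = r
    · generalize Nat.clog p r = k at hr
      subst hr
      obtain ⟨i, j, hij⟩ := h.exists_ι_cls_eq hp g
      rw [hij]
      exact add_mem (nsmul_mem (hpow (hle hx) _) i) (nsmul_mem (hpow (hle hy) _) j)
    · rw [h.ι_cls_eq_zero hp hr]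
      exact zero_mem _
  refine Submodule.span_le.2 ?_
  rintro _ ⟨l, rfl, rfl⟩
  change _ ∈ D _
  induction l with
  | nil => exact hone
  | cons e l ih => simpa using hmul (hcls e.1 e.2) ih

end IsMetacyclic

end MetacyclicCohomology

namespace Cobar

/-! ### Truncated polynomial algebras in two variables -/

section

variable (k : Type*) [Field k] (a b : ℕ)

/-- The algebra `k[X, Y] / (X ^ a, Y ^ b)`. -/
abbrev TruncatedPolynomial : Type _ :=
  MvPolynomial (Fin 2) k ⧸
    Ideal.span {(MvPolynomial.X 0 : MvPolynomial (Fin 2) k) ^ a, MvPolynomial.X 1 ^ b}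

/-- The ideal is generated by monomials, so every monomial occurring in one of its elements is
divisible by a generator; exponents in `Fin a × Fin b` rule this out. -/
theorem linearIndependent_truncatedPolynomial :
    LinearIndependent k fun z : Fin a × Fin b =>
      (Ideal.Quotient.mk _ (MvPolynomial.X 0) ^ (z.1 : ℕ) *
        Ideal.Quotient.mk _ (MvPolynomial.X 1) ^ (z.2 : ℕ) : TruncatedPolynomial k a b) := by
  rw [Fintype.linearIndependent_iff]
  intro c hc z
  let e : Fin a × Fin b → Fin 2 →₀ ℕ := fun z =>
    Finsupp.single 0 (z.1 : ℕ) + Finsupp.single 1 (z.2 : ℕ)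
  have he0 : ∀ z, e z 0 = z.1 := fun z => by simp [e]
  have he1 : ∀ z, e z 1 = z.2 := fun z => by simp [e]
  have he : ∀ z z', e z = e z' → z = z' := by
    intro z z' h
    have h0 := DFunLike.congr_fun h 0
    have h1 := DFunLike.congr_fun h 1
    rw [he0, he0] at h0
    rw [he1, he1] at h1
    exact Prod.ext (Fin.ext h0) (Fin.ext h1)
  set P : MvPolynomial (Fin 2) k := ∑ z, MvPolynomial.monomial (e z) (c z) with hP
  have hmem : P ∈ Ideal.span {(MvPolynomial.X 0 : MvPolynomial (Fin 2) k) ^ a,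
      MvPolynomial.X 1 ^ b} := by
    rw [← Ideal.Quotient.eq_zero_iff_mem, ← hc, hP, map_sum]
    refine Finset.sum_congr rfl fun z _ => ?_
    rw [← map_pow, ← map_pow, ← map_mul, ← Ideal.Quotient.mkₐ_eq_mk k, ← map_smul]
    congr 1
    rw [MvPolynomial.X_pow_eq_monomial, MvPolynomial.X_pow_eq_monomial,
      MvPolynomial.monomial_mul, MvPolynomial.smul_monomial]
    simp [e]
  have himage : ({(MvPolynomial.X 0 : MvPolynomial (Fin 2) k) ^ a, MvPolynomial.X 1 ^ b} : Set _) =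
      (fun s => MvPolynomial.monomial s (1 : k)) ''
        {Finsupp.single 0 a, Finsupp.single 1 b} := by
    rw [Set.image_pair, MvPolynomial.X_pow_eq_monomial, MvPolynomial.X_pow_eq_monomial]
  rw [himage, MvPolynomial.mem_ideal_span_monomial_image] at hmem
  by_contra hz
  have hcoeff : P.coeff (e z) = c z := by
    rw [hP, MvPolynomial.coeff_sum, Finset.sum_eq_single z]
    · simp
    · intro z' _ hz'
      rw [MvPolynomial.coeff_monomial, if_neg fun h => hz' (he _ _ h)]
    · simp
  obtain ⟨s, hs | hs, hle⟩ := hmem (e z) (by rw [MvPolynomial.mem_support_iff, hcoeff]; exact hz)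
  · have := hle 0
    rw [hs, he0, Finsupp.single_eq_same] at this
    exact absurd z.1.2 (by omega)
  · have := hle 1
    rw [hs, he1, Finsupp.single_eq_same] at this
    exact absurd z.2.2 (by omega)

end

section

variable {k : Type*} [Field k] {a b : ℕ} {A : Type*} [Ring A] [Algebra k A] {X Y : A}

theorem span_truncated_monomials (hX : X ^ a = 0) (hY : Y ^ b = 0)
    (hspan : Submodule.span k (Set.range fun z : ℕ × ℕ => X ^ z.1 * Y ^ z.2) = ⊤) :
    ⊤ ≤ Submodule.span k (Set.range fun z : Fin a × Fin b => X ^ (z.1 : ℕ) * Y ^ (z.2 : ℕ)) := by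
  rw [← hspan, Submodule.span_le]
  rintro _ ⟨⟨i, j⟩, rfl⟩
  dsimp only
  rcases lt_or_ge i a with hi | hi
  · rcases lt_or_ge j b with hj | hj
    · exact Submodule.subset_span ⟨(⟨i, hi⟩, ⟨j, hj⟩), rfl⟩
    · rw [pow_eq_zero_of_le hj hY, mul_zero]
      exact zero_mem _
  · rw [pow_eq_zero_of_le hi hX, zero_mul]
    exact zero_mem _

theorem mul_comm_of_span (hXY : Commute X Y)
    (hspan : Submodule.span k (Set.range fun z : ℕ × ℕ => X ^ z.1 * Y ^ z.2) = ⊤) (c c' : A) :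
    c * c' = c' * c := by
  have hc : c ∈ Submodule.span k (Set.range fun z : ℕ × ℕ => X ^ z.1 * Y ^ z.2) :=
    hspan ▸ trivial
  have hc' : c' ∈ Submodule.span k (Set.range fun z : ℕ × ℕ => X ^ z.1 * Y ^ z.2) :=
    hspan ▸ trivial
  refine Submodule.span_induction₂ (p := fun a b _ _ => Commute a b) ?_
    (fun _ _ => Commute.zero_left _) (fun _ _ => Commute.zero_right _)
    (fun _ _ _ _ _ _ h h' => h.add_left h') (fun _ _ _ _ _ _ h h' => h.add_right h')
    (fun r _ _ _ _ h => h.smul_left r) (fun r _ _ _ _ h => h.smul_right r) hc hc'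
  rintro _ _ ⟨z, rfl⟩ ⟨z', rfl⟩
  exact (((Commute.refl X).pow_pow _ _).mul_right (hXY.pow_pow _ _)).mul_left
    ((hXY.symm.pow_pow _ _).mul_right ((Commute.refl Y).pow_pow _ _))

theorem linearIndependent_truncated_monomials (ψ : A →ₐ[k] TruncatedPolynomial k a b)
    (hψX : ψ X = Ideal.Quotient.mk _ (MvPolynomial.X 0))
    (hψY : ψ Y = Ideal.Quotient.mk _ (MvPolynomial.X 1)) :
    LinearIndependent k fun z : Fin a × Fin b => X ^ (z.1 : ℕ) * Y ^ (z.2 : ℕ) := by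
  refine LinearIndependent.of_comp ψ.toLinearMap ?_
  have h : (ψ.toLinearMap ∘ fun z : Fin a × Fin b => X ^ (z.1 : ℕ) * Y ^ (z.2 : ℕ)) =
      fun z => Ideal.Quotient.mk _ (MvPolynomial.X 0) ^ (z.1 : ℕ) *
        Ideal.Quotient.mk _ (MvPolynomial.X 1) ^ (z.2 : ℕ) := by
    ext z
    simp [hψX, hψY]
  rw [h]
  exact linearIndependent_truncatedPolynomial k a b

/-- The map from the quotient is onto by `hspan` and injective because `ψ` is a left inverse. -/
theorem exists_truncatedPolynomial_algEquiv (hXY : Commute X Y) (hX : X ^ a = 0) (hY : Y ^ b = 0)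
    (hspan : Submodule.span k (Set.range fun z : ℕ × ℕ => X ^ z.1 * Y ^ z.2) = ⊤)
    (ψ : A →ₐ[k] TruncatedPolynomial k a b)
    (hψX : ψ X = Ideal.Quotient.mk _ (MvPolynomial.X 0))
    (hψY : ψ Y = Ideal.Quotient.mk _ (MvPolynomial.X 1)) :
    ∃ φ : TruncatedPolynomial k a b ≃ₐ[k] A,
      φ (Ideal.Quotient.mk _ (MvPolynomial.X 0)) = X ∧
      φ (Ideal.Quotient.mk _ (MvPolynomial.X 1)) = Y := by
  obtain ⟨g, hg0, hg1⟩ := exists_mvPolynomial_algHom (k := k) hXY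
  let φ : TruncatedPolynomial k a b →ₐ[k] A := Ideal.Quotient.liftₐ _ g (by
    intro f hf
    have : Ideal.span {(MvPolynomial.X 0 : MvPolynomial (Fin 2) k) ^ a, MvPolynomial.X 1 ^ b} ≤
        RingHom.ker g := by
      rw [Ideal.span_le]
      rintro _ (rfl | rfl)
      · change g _ = 0
        rw [map_pow, hg0, hX]
      · change g _ = 0
        rw [map_pow, hg1, hY]
    exact this hf)
  have h0 : φ (Ideal.Quotient.mk _ (MvPolynomial.X 0)) = X := hg0
  have h1 : φ (Ideal.Quotient.mk _ (MvPolynomial.X 1)) = Y := hg1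
  have hψφ : ψ.comp φ = AlgHom.id k _ := by
    refine Ideal.Quotient.algHom_ext _ (MvPolynomial.algHom_ext fun i => ?_)
    fin_cases i
    · exact (congrArg ψ h0).trans hψX
    · exact (congrArg ψ h1).trans hψY
  refine ⟨AlgEquiv.ofBijective φ ⟨?_, ?_⟩, h0, h1⟩
  · exact Function.LeftInverse.injective (g := ψ) fun z => DFunLike.congr_fun hψφ z
  · rw [← AlgHom.range_eq_top, ← Algebra.toSubmodule_eq_top, eq_top_iff, ← hspan, Submodule.span_le]
    rintro _ ⟨z, rfl⟩
    exact ⟨Ideal.Quotient.mk _ (MvPolynomial.X 0 ^ z.1 * MvPolynomial.X 1 ^ z.2), by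
      simp [h0, h1]⟩

end

end Cobar

/-! ### The enveloping algebra as a graded truncated polynomial algebra -/

namespace MetacyclicCohomology

variable {p : ℕ} [Fact p.Prime] {G : Type*} [Group G] {a b : ℕ} {X Y : VL p G}

theorem VL.span_eq_top
    (hle : ∀ r, VL.degreePart p G r ≤
      Submodule.span (ZMod p) (Set.range fun z : ℕ × ℕ => X ^ z.1 * Y ^ z.2)) :
    Submodule.span (ZMod p) (Set.range fun z : ℕ × ℕ => X ^ z.1 * Y ^ z.2) = ⊤ := by
  rw [eq_top_iff]
  refine le_trans ?_ (iSup_le hle)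
  rintro z -
  have hz : z ∈ (⊤ : Subalgebra (ZMod p) (VL p G)) := trivial
  rw [← VL.adjoin_cls] at hz
  rw [← Subalgebra.mem_toSubmodule, Algebra.adjoin_eq_span] at hz
  refine Submodule.span_induction ?_ (zero_mem _) (fun _ _ _ _ => add_mem)
    (fun c _ _ h => Submodule.smul_mem _ c h) hz
  intro w hw
  obtain ⟨l, hl⟩ : ∃ l : List (Σ n : ℕ, lowerSeries p G n),
      (l.map fun e => VL.ι p G (cls e.1 e.2)).prod = w := by
    induction hw using Submonoid.closure_induction with
    | mem _ h => obtain ⟨n, g, rfl⟩ := h; exact ⟨[⟨n, g⟩], by simp⟩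
    | one => exact ⟨[], by simp⟩
    | mul _ _ _ _ h h' =>
      obtain ⟨l, rfl⟩ := h
      obtain ⟨l', rfl⟩ := h'
      exact ⟨l ++ l', by simp⟩
  exact Submodule.mem_iSup_of_mem _ (Submodule.subset_span ⟨l, rfl, hl⟩)

/-- The augmentation ideal of an enveloping algebra that is a truncated polynomial algebra. -/
noncomputable def VL.truncated (hXY : ∀ c c' : VL p G, c * c' = c' * c) (ha : 3 ≤ a) (hb : 3 ≤ b)
    (hX : X ^ a = 0) (hY : Y ^ b = 0)
    (hspan : Submodule.span (ZMod p) (Set.range fun z : ℕ × ℕ => X ^ z.1 * Y ^ z.2) = ⊤)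
    (hindep : LinearIndependent (ZMod p) fun z : Fin a × Fin b => X ^ (z.1 : ℕ) * Y ^ (z.2 : ℕ)) :
    Cobar.Truncated (VL.augIdeal p G) where
  ε := VL.augmentation p G
  mem_iff _ := Iff.rfl
  commutes := hXY
  a := a
  b := b
  three_le_a := ha
  three_le_b := hb
  -- The augmentation takes values in a field, so it kills nilpotent elements.
  X := ⟨X, eq_zero_of_pow_eq_zero (n := a) (by rw [← map_pow, hX, map_zero])⟩
  Y := ⟨Y, eq_zero_of_pow_eq_zero (n := b) (by rw [← map_pow, hY, map_zero])⟩
  basis := Module.Basis.mk hindep (Cobar.span_truncated_monomials hX hY hspan)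
  basis_apply i j := by rw [Module.Basis.mk_apply]
  X_pow := hX
  Y_pow := hY

theorem VL.isGraded_truncated (hXY : ∀ c c' : VL p G, c * c' = c' * c) (ha : 3 ≤ a) (hb : 3 ≤ b)
    (hX : X ^ a = 0) (hY : Y ^ b = 0)
    (hspan : Submodule.span (ZMod p) (Set.range fun z : ℕ × ℕ => X ^ z.1 * Y ^ z.2) = ⊤)
    (hindep : LinearIndependent (ZMod p) fun z : Fin a × Fin b => X ^ (z.1 : ℕ) * Y ^ (z.2 : ℕ))
    (hXd : X ∈ VL.degreePart p G 2) (hYd : Y ∈ VL.degreePart p G 2)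
    (hdeg : ∀ r, VL.degreePart p G r ≤
      Submodule.span (ZMod p) {z | ∃ i j : ℕ, 2 * (i + j) = r ∧ X ^ i * Y ^ j = z}) :
    (VL.truncated hXY ha hb hX hY hspan hindep).IsGraded (VL.augDegreePart p G) where
  X_mem := hXd
  Y_mem := hYd
  coord t c hc z hz := by
    have hc' := hdeg t hc
    generalize (c : VL p G) = w at hc'
    set T := VL.truncated hXY ha hb hX hY hspan hindep
    induction hc' using Submodule.span_induction with
    | zero => rw [map_zero]
    | add _ _ _ _ h h' => rw [map_add, h, h', add_zero]
    | smul r _ _ h => rw [map_smul, h, smul_zero]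
    | mem w hw =>
      obtain ⟨i, j, hij, rfl⟩ := hw
      rcases lt_or_ge i a with hi | hi
      · rcases lt_or_ge j b with hj | hj
        · have h1 : X ^ i * Y ^ j = T.basis (⟨i, hi⟩, ⟨j, hj⟩) := 
            (T.basis_apply ⟨i, hi⟩ ⟨j, hj⟩).symm
          rw [h1, Module.Basis.coord_apply, Module.Basis.repr_self, Finsupp.single_eq_of_ne]
          rintro rfl
          exact hz hij
        · rw [pow_eq_zero_of_le hj hY, mul_zero, map_zero]
      · rw [pow_eq_zero_of_le hi hX, zero_mul, map_zero]

end MetacyclicCohomology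

/-! ### The main theorem -/

open MetacyclicCohomology in
theorem mainTheorem10 (p : ℕ) [Fact p.Prime] (hp : p ≠ 2) (m n q l : ℕ)
    (hm : 1 ≤ m) (hn : 1 ≤ n) (hq : 1 ≤ q) (hl : 1 ≤ l) (hqm : q ≤ m)
    (hpn : (p ^ l + 1) ^ p ^ n ≡ 1 [MOD p ^ m])
    (hpq : (p ^ l + 1) * p ^ q ≡ p ^ q [MOD p ^ m])
    (a b : ℕ)
    (hab₁ : n ≤ q → a = p ^ m ∧ b = p ^ n)
    (hab₂ : q < n → a = p ^ q ∧ b = p ^ (m + n - q)) :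
    (∃ φ : (MvPolynomial (Fin 2) (ZMod p) ⧸
          Ideal.span {(MvPolynomial.X 0 : MvPolynomial (Fin 2) (ZMod p)) ^ a,
            MvPolynomial.X 1 ^ b}) ≃ₐ[ZMod p] VL p (Metacyclic p m n q l),
        ∀ i : Fin 2, φ (Ideal.Quotient.mk _ (MvPolynomial.X i)) ∈
          VL.degreePart p (Metacyclic p m n q l) 2) ∧
    ∃ x ∈ HVLpart p (Metacyclic p m n q l) 1 2,
    ∃ y ∈ HVLpart p (Metacyclic p m n q l) 1 2,
    ∃ u ∈ HVLpart p (Metacyclic p m n q l) 2 (2 * a),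
    ∃ v ∈ HVLpart p (Metacyclic p m n q l) 2 (2 * b),
      Cobar.symMassey (VL.augDegreePart p (Metacyclic p m n q l)) 1 2 a x = {u} ∧
      Cobar.symMassey (VL.augDegreePart p (Metacyclic p m n q l)) 1 2 b y = {v} ∧
      ∃ e : (ExteriorAlgebra (ZMod p) (Fin 2 → ZMod p) ⊗[ZMod p] MvPolynomial (Fin 2) (ZMod p))
          ≃ₐ[ZMod p] HVL p (Metacyclic p m n q l),
        e (ExteriorAlgebra.ι (ZMod p) (Pi.single 0 1) ⊗ₜ[ZMod p] 1) = x ∧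
        e (ExteriorAlgebra.ι (ZMod p) (Pi.single 1 1) ⊗ₜ[ZMod p] 1) = y ∧
        e (1 ⊗ₜ[ZMod p] MvPolynomial.X 0) = u ∧
        e (1 ⊗ₜ[ZMod p] MvPolynomial.X 1) = v := by
  have h := isMetacyclic_metacyclic p m n q l hl hpn hpq
  have hX := h.gen_x_pow_eq_zero hab₁ hab₂
  have hY := h.gen_y_pow_eq_zero hp hqm hab₁ hab₂
  set x : Metacyclic p m n q l := PresentedGroup.of 0
  set y : Metacyclic p m n q l := PresentedGroup.of 1
  set X := VL.gen p x with hXdef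
  -- For `q = n` the classes of `x` and `y` have equal nonzero `p ^ n`-th powers when `m > n`, so
  -- the class of `y` is replaced by a difference.
  set Y := if q = n then VL.gen p y - VL.gen p x else VL.gen p y with hYdef
  have hXd : X ∈ VL.degreePart p (Metacyclic p m n q l) 2 := VL.gen_mem_degreePart p x
  have hYd : Y ∈ VL.degreePart p (Metacyclic p m n q l) 2 := by
    rw [hYdef]
    split_ifs
    · exact sub_mem (VL.gen_mem_degreePart p y) (VL.gen_mem_degreePart p x)
    · exact VL.gen_mem_degreePart p y
  have hXY : Commute X Y := by
    rw [hYdef]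
    split_ifs
    · exact (h.commute_gen hp).sub_right (Commute.refl _)
    · exact h.commute_gen hp
  have hxspan : VL.gen p x ∈ Submodule.span (ZMod p) {X, Y} := Submodule.subset_span (Or.inl rfl)
  have hyY : VL.gen p y = if q = n then Y + X else Y := by
    rw [hYdef]
    split_ifs
    · rw [hXdef, sub_add_cancel]
    · rfl
  have hyspan : VL.gen p y ∈ Submodule.span (ZMod p) {X, Y} := by
    have hYs : Y ∈ Submodule.span (ZMod p) {X, Y} := Submodule.subset_span (Or.inr rfl)
    rw [hyY]
    split_ifs
    · exact add_mem hYs hxspan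
    · exact hYs
  have hdeg := h.degreePart_le_span hp hXY hxspan hyspan
  have hle : ∀ r, VL.degreePart p (Metacyclic p m n q l) r ≤
      Submodule.span (ZMod p) (Set.range fun z : ℕ × ℕ => X ^ z.1 * Y ^ z.2) := fun r =>
    (hdeg r).trans (Submodule.span_mono (by rintro _ ⟨i, j, -, rfl⟩; exact ⟨(i, j), rfl⟩))
  have hspan := VL.span_eq_top hle
  have hcomm := Cobar.mul_comm_of_span hXY hspan
  -- The class of `y` is sent to `Y + X` when `q = n`, which undoes the change of generator.
  obtain ⟨ψ, hψx, hψy⟩ := h.exists_lift hp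
    (IsMetacyclic.compatible (Q := Cobar.TruncatedPolynomial (ZMod p) a b) hqm hab₁ hab₂
      (X := Ideal.Quotient.mk _ (MvPolynomial.X 0)) (Y := Ideal.Quotient.mk _ (MvPolynomial.X 1))
      (by
        rw [← map_pow, Ideal.Quotient.eq_zero_iff_mem]
        exact Ideal.subset_span (Or.inl rfl))
      (by
        rw [← map_pow, Ideal.Quotient.eq_zero_iff_mem]
        exact Ideal.subset_span (Or.inr rfl)))
    (mem_lowerSeries_one p _) (mem_lowerSeries_one p _)
  have hψX : ψ X = Ideal.Quotient.mk _ (MvPolynomial.X 0) := hψx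
  have hψY : ψ Y = Ideal.Quotient.mk _ (MvPolynomial.X 1) := by
    change ψ (VL.gen p y) = _ at hψy
    rw [hYdef]
    split_ifs at hψy ⊢
    · rw [map_sub, hψy, ← hXdef, hψX, add_sub_cancel_right]
    · exact hψy
  obtain ⟨φ, hφX, hφY⟩ :=
    Cobar.exists_truncatedPolynomial_algEquiv hXY hX hY hspan ψ hψX hψY
  -- Oddness of `p` gives `a, b ≥ 3`, on which the vanishing of `x ^ 2` and `y ^ 2` depends.
  have hp3 : 3 ≤ p := by
    have := (Fact.out : p.Prime).two_le
    omega
  have hpow : ∀ {r : ℕ}, 1 ≤ r → 3 ≤ p ^ r := fun hr => hp3.trans (Nat.le_self_pow (by omega) p)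
  have ha : 3 ≤ a := by
    rcases lt_or_ge q n with hqn | hqn
    · rw [(hab₂ hqn).1]; exact hpow hq
    · rw [(hab₁ hqn).1]; exact hpow hm
  have hb : 3 ≤ b := by
    rcases lt_or_ge q n with hqn | hqn
    · rw [(hab₂ hqn).2]; exact hpow (by omega)
    · rw [(hab₁ hqn).2]; exact hpow hn
  refine ⟨⟨φ, fun i => ?_⟩, (VL.isGraded_truncated hcomm ha hb hX hY hspan
    (Cobar.linearIndependent_truncated_monomials ψ hψX hψY) hXd hYd hdeg).exists_cohomology⟩
  fin_cases i
  · exact hφX ▸ hXd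
  · exact hφY ▸ hYd
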